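/- Let $(X,0)$ be a complex singularity, that is, a germ of reduced complex analytic space, with local ring $\mathcal{O}_{X,0}$ of germs of holomorphic functions. An embedding $\iota:(X,0)\to(\mathbb{C}^d,0)$ is a closed immersion of germs: $\iota$ maps a neighbourhood of $0$ in $X$ homeomorphically onto a closed analytic subset of a neighbourhood of $0$ in $\mathbb{C}^d$, with $\iota(0)=0$, and $\mathcal{O}_{X,0}$ is the set of all $H\circ\iota$ with $H\in\mathcal{O}_{\mathbb{C}^d,0}$. The embedding dimension of $(X,0)$ is the least $n\in\mathbb{N}$ such that there is an embedding $(X,0)\to(\mathbb{C}^n,0)$. An automorphism of a singularity is a holomorphic map germ from it to itself that has a holomorphic inverse germ. An automorphism $f$ of $(X,0)$ is contracting if every open neighbourhood $W$ of $0$ in $X$ contains an open neighbourhood $U$ of $0$ such that $f(U)$ is relatively compact in $U$ and $\bigcap_{n\ge 0}f^n(U)=\{0\}$. These notions apply in particular to $(\mathbb{C}^d,0)$. An extension of an automorphism $f$ of $(X,0)$ along $\iota$ is a holomorphic map germ $F:(\mathbb{C}^d,0)\to(\mathbb{C}^d,0)$ with $F\circ\iota=\iota\circ f$. **Theorem.**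 Let $(X,0)$ be a complex singularity and $\iota:(X,0)\to(\mathbb{C}^d,0)$ an embedding. The following are equivalent: 1. $d$ is the embedding dimension of $(X,0)$; 2. $\iota$ is a good embedding: for every automorphism $f$ of $(X,0)$, every extension of $f$ is an automorphism of $(\mathbb{C}^d,0)$; 3. $\iota$ is a good contracting embedding: $\iota$ is a good embedding and, for every contracting automorphism $f$ of $(X,0)$, every extension of $f$ is a contracting automorphism of $(\mathbb{C}^d,0)$. Moreover, an automorphism $F$ of $(\mathbb{C}^d,0)$ is contracting if and only if all eigenvalues of $D_0F$ have modulus less than $1$. -/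

import Mathlib

open Filter Topology

noncomputable section

/-- Let `X` be a topological space with base point `x₀`, and let `O` be a ring of germs at `x₀`
of complex-valued functions. The germ at `x₀` of `ι : X → ℂᵈ` is a closed immersion
`(X, x₀) → (ℂᵈ, 0)` with respect to `O` when it is a homeomorphism from a neighbourhood of `x₀` onto
a closed analytic subset of a neighbourhood of `0`, and `O` consists exactly of the pullbacks of the
germs of holomorphic functions at `0` (so that `ι` identifies `O` with the ring of germs of
holomorphic functions on the image of `ι`). -/
def IsClosedImmersionGerm {X : Type*} [TopologicalSpace X] (x₀ : X)
    (O : Subring (Germ (𝓝 x₀) ℂ)) {d : ℕ} (ι : X → (Fin d → ℂ)) : Prop :=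
  ι x₀ = 0 ∧
  (∃ (U : Set X) (Ω : Set (Fin d → ℂ)) (r : ℕ) (g : (Fin d → ℂ) → (Fin r → ℂ)),
    IsOpen U ∧ x₀ ∈ U ∧ IsOpen Ω ∧ IsEmbedding (U.domRestrict ι) ∧
    AnalyticOnNhd ℂ g Ω ∧ ι '' U = {z | z ∈ Ω ∧ g z = 0}) ∧
  ∀ h : X → ℂ, (h : Germ (𝓝 x₀) ℂ) ∈ O ↔
    ∃ H : (Fin d → ℂ) → ℂ, AnalyticAt ℂ H 0 ∧ h =ᶠ[𝓝 x₀] H ∘ ι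

/-- A complex singularity `(X, x₀)`, that is, a germ of reduced complex analytic space: a germ of
topological space together with its local ring of germs of holomorphic functions, isomorphic
to the germ at the origin of an analytic subset of some `ℂⁿ`. -/
structure Singularity (X : Type*) [TopologicalSpace X] (x₀ : X) where
  /-- The local ring of germs of holomorphic functions at the base point. -/
  localRing : Subring (Germ (𝓝 x₀) ℂ)
  exists_model : ∃ (n : ℕ) (ι : X → (Fin n → ℂ)), IsClosedImmersionGerm x₀ localRing ι

/-- The smooth germ `(ℂᵈ, 0)`. -/
def affineGerm (d : ℕ) : Singularity (Fin d → ℂ) 0 where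
  localRing :=
    { carrier := {h | ∃ H : (Fin d → ℂ) → ℂ, AnalyticAt ℂ H 0 ∧ h = (H : Germ (𝓝 (0 : Fin d → ℂ)) ℂ)}
      mul_mem' := by
        rintro _ _ ⟨H, hH, rfl⟩ ⟨K, hK, rfl⟩
        exact ⟨H * K, hH.mul hK, rfl⟩
      add_mem' := by
        rintro _ _ ⟨H, hH, rfl⟩ ⟨K, hK, rfl⟩
        exact ⟨H + K, hH.add hK, rfl⟩
      one_mem' := ⟨fun _ => 1, analyticAt_const, rfl⟩
      zero_mem' := ⟨fun _ => 0, analyticAt_const, rfl⟩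
      neg_mem' := by
        rintro _ ⟨H, hH, rfl⟩
        exact ⟨-H, hH.neg, rfl⟩ }
  exists_model := by
    refine ⟨d, id, rfl, ⟨Set.univ, Set.univ, 0, 0, isOpen_univ, trivial, isOpen_univ, ?_,
      analyticOnNhd_const, ?_⟩, ?_⟩
    · exact IsEmbedding.subtypeVal
    · ext z
      simp
    · intro h
      constructor
      · rintro ⟨H, hH, e⟩
        exact ⟨H, hH, Germ.coe_eq.1 e⟩
      · rintro ⟨H, hH, e⟩
        exact ⟨H, hH, Germ.coe_eq.2 e⟩

namespace Singularity

variable {X : Type*} [TopologicalSpace X] {x₀ : X} {Y : Type*} [TopologicalSpace Y] {y₀ : Y}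

/-- The germ at `x₀` of `f : X → Y` is a holomorphic map `(X, x₀) → (Y, y₀)`. As everywhere below,
a map germ is given by a representative, and only its values near the base point matter. -/
def IsMorphism (S : Singularity X x₀) (T : Singularity Y y₀) (f : X → Y) : Prop :=
  f x₀ = y₀ ∧ (∀ᶠ x in 𝓝 x₀, ContinuousAt f x) ∧
  ∀ h : Y → ℂ, (h : Germ (𝓝 y₀) ℂ) ∈ T.localRing → ((h ∘ f : X → ℂ) : Germ (𝓝 x₀) ℂ) ∈ S.localRing

/-- The germ of `f` is an automorphism of `(X, x₀)`: it has a holomorphic inverse germ. -/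
def IsAutomorphism (S : Singularity X x₀) (f : X → X) : Prop :=
  S.IsMorphism S f ∧ ∃ g : X → X, S.IsMorphism S g ∧ g ∘ f =ᶠ[𝓝 x₀] id ∧ f ∘ g =ᶠ[𝓝 x₀] id

/-- Contracting automorphisms: inside every open neighbourhood `W` of the base point there is an
open neighbourhood `U` of it such that `f U` is relatively compact in `U` (it lies in a compact
subset of `U`) and the intersection of the sets `fⁿ U` is the base point. -/
def IsContracting (S : Singularity X x₀) (f : X → X) : Prop :=
  S.IsAutomorphism f ∧
  ∀ W : Set X, IsOpen W → x₀ ∈ W → ∃ U : Set X, IsOpen U ∧ x₀ ∈ U ∧ U ⊆ W ∧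
    (∃ K : Set X, IsCompact K ∧ f '' U ⊆ K ∧ K ⊆ U) ∧
    ⋂ n : ℕ, f^[n] '' U = {x₀}

/-- The germ of `ι` is an embedding (closed immersion) `(X, x₀) → (ℂᵈ, 0)`. -/
def IsEmbeddingGerm (S : Singularity X x₀) {d : ℕ} (ι : X → (Fin d → ℂ)) : Prop :=
  IsClosedImmersionGerm x₀ S.localRing ι

/-- The least `d` such that `(X, x₀)` embeds into `(ℂᵈ, 0)`; such `d` exist by `exists_model`. -/
def embeddingDimension (S : Singularity X x₀) : ℕ :=
  sInf {d : ℕ | ∃ ι : X → (Fin d → ℂ), S.IsEmbeddingGerm ι}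

/-- `F : (ℂᵈ, 0) → (ℂᵈ, 0)` is a holomorphic extension of `f : (X, x₀) → (X, x₀)` along `ι`. -/
def IsExtension (_S : Singularity X x₀) {d : ℕ} (ι : X → (Fin d → ℂ)) (f : X → X)
    (F : (Fin d → ℂ) → (Fin d → ℂ)) : Prop :=
  (affineGerm d).IsMorphism (affineGerm d) F ∧ F ∘ ι =ᶠ[𝓝 x₀] ι ∘ f

/-- Every extension of every automorphism of `(X, x₀)` is an automorphism of `(ℂᵈ, 0)`. -/
def IsGoodEmbedding (S : Singularity X x₀) {d : ℕ} (ι : X → (Fin d → ℂ)) : Prop :=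
  ∀ f : X → X, S.IsAutomorphism f → ∀ F : (Fin d → ℂ) → (Fin d → ℂ), S.IsExtension ι f F →
    (affineGerm d).IsAutomorphism F

/-- A good embedding such that, moreover, every extension of every contracting automorphism of
`(X, x₀)` is a contracting automorphism of `(ℂᵈ, 0)`. -/
def IsGoodContractingEmbedding (S : Singularity X x₀) {d : ℕ} (ι : X → (Fin d → ℂ)) : Prop :=
  S.IsGoodEmbedding ι ∧
  ∀ f : X → X, S.IsContracting f → ∀ F : (Fin d → ℂ) → (Fin d → ℂ), S.IsExtension ι f F →
    (affineGerm d).IsContracting F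

end Singularity

end

noncomputable section

/-! Minimality of `d` enters through one fact: in the embedding dimension, an analytic function
vanishing on the image of `ι` has zero differential at `0`, since otherwise it could be made a
coordinate and dropped. If `F` and `G` extend `f` and its inverse, then `G ∘ F - id` vanishes on the
image, so `D₀G D₀F = id` and `F` is an automorphism. Conversely, let `B` and `A` be the transition
maps from a good embedding to a minimal one and back. Then `A ∘ B` extends the identity, hence is an
automorphism, so `D₀B` is injective and `d` is minimal.

The hard point is that, for `f` contracting and `d` minimal, all eigenvalues of `D₀F` lie in the
open unit disc. Suppose one does not. Split `ℂᵈ` into the generalized eigenspaces for eigenvalues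
inside and outside the open disc. After passing to a power `F^N` the linear part is `A × B` with
`‖A‖ < 1`, `‖B⁻¹‖ ‖A‖ < 1`, and `Bⁿ c → 0` only for `c = 0` (`exists_dominated_splitting`). The
graph transform produces an analytic invariant graph over the contracted factor; it is the zero set
of a submersion `h` with `h ∘ F^N = B ∘ h + o(h)` (`exists_semiconjugacy`). As `D₀h ≠ 0`, minimality
forbids that `h` vanishes on the image, so `curve_selection` gives an analytic curve `γ` in the
image with `h ∘ γ` not identically zero. If its leading term is `c tᵏ`, the coefficient of `tᵏ` in
`h ∘ F^(Nn) ∘ γ` is `Bⁿ c`. Since `f` contracts, the curves `Fⁿ ∘ γ` tend to `0` uniformly on a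
fixed disc, and Cauchy's estimate yields `Bⁿ c → 0`, hence `c = 0`: a contradiction.

For the eigenvalue criterion on `(ℂᵈ, 0)` the same argument runs with straight lines as curves; the
other direction uses a norm adapted to `D₀F`.

Curve selection is proved by induction on dimension. The roots of one equation in a suitable
coordinate are not analytic in the remaining ones, but their symmetric functions are. These
functions stratify the base according to how many roots are common zeros, and a curve in a stratum
lifts by Puiseux's theorem. -/

/-! ### Holomorphy in several variables: Osgood's lemma. -/

/-- A path of continuous functions on a compact space which is continuous for the uniform norm and
pointwise holomorphic is holomorphic for the uniform norm. -/
theorem analyticAt_continuousMap_of_eval {K F : Type*} [TopologicalSpace K] [CompactSpace K]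
    [NormedAddCommGroup F] [NormedSpace ℂ F] [CompleteSpace F] {φ : ℂ → C(K, F)} {c : ℂ} {r : ℝ}
    (hr : 0 < r) (hφ : ContinuousOn φ (Metric.closedBall c r))
    (hd : ∀ k, ∀ z ∈ Metric.ball c r, DifferentiableAt ℂ (fun w => φ w k) z) :
    AnalyticAt ℂ φ c := by
  lift r to NNReal using hr.le
  have hr' : 0 < r := by exact_mod_cast hr
  have hci : CircleIntegrable φ c r :=
    (hφ.mono Metric.sphere_subset_closedBall).circleIntegrable r.2
  -- The Cauchy integral of `φ`, taken in the Banach space `C(K, F)`, is analytic. Evaluation at `k`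
  -- commutes with the integral, so Cauchy's formula for each `k` identifies it with `φ`.
  have h := (hasFPowerSeriesOn_cauchy_integral hci hr').analyticAt
  refine h.congr ?_
  filter_upwards [Metric.ball_mem_nhds c hr] with w hw
  ext k
  have hev : ∀ ψ : C(K, F), ContinuousMap.evalCLM ℂ k ψ = ψ k := fun _ => rfl
  have hcont : ContinuousOn (fun z => (z - w)⁻¹ • φ z) (Metric.sphere c (r : ℝ)) := by
    refine ContinuousOn.smul (ContinuousOn.inv₀ (f := fun z => z - w) (by fun_prop) ?_)
      (hφ.mono Metric.sphere_subset_closedBall)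
    intro z hz e
    rw [sub_eq_zero.1 e] at hz
    exact (Metric.mem_ball.1 hw).ne (Metric.mem_sphere.1 hz)
  have hint := hcont.circleIntegrable r.2
  have e1 : ((2 * Real.pi * Complex.I : ℂ)⁻¹ • ∮ z in C(c, r), (z - w)⁻¹ • φ z) k
      = (2 * Real.pi * Complex.I : ℂ)⁻¹ • ∮ z in C(c, r), (z - w)⁻¹ • φ z k := by
    rw [← hev, map_smul]
    congr 1
    simp only [circleIntegral]
    refine (ContinuousLinearMap.intervalIntegral_comp_comm _ hint.out).symm.trans ?_
    rfl
  rw [e1]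
  refine Complex.two_pi_I_inv_smul_circleIntegral_sub_inv_smul_of_differentiable_on_off_countable
    Set.countable_empty hw ?_ ?_
  · exact (ContinuousMap.evalCLM ℂ k).continuous.comp_continuousOn hφ
  · intro z hz
    exact hd k z hz.1

/-- Continuity into `C(K, F)` is joint continuity after currying. The default value `0` of `mkD` is
never taken over `V`, where every slice is continuous. -/
theorem continuousOn_mkD {X K F : Type*} [TopologicalSpace X] [TopologicalSpace K]
    [NormedAddCommGroup F] {ψ : X → K → F} {V : Set X}
    (h : ContinuousOn (fun p : X × K => ψ p.1 p.2) (V ×ˢ Set.univ)) :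
    (∀ x ∈ V, Continuous (ψ x)) ∧
      ContinuousOn (fun x => ContinuousMap.mkD (ψ x) 0) V := by
  have h1 : ∀ x ∈ V, Continuous (ψ x) := by
    intro x hx
    rw [← continuousOn_univ]
    exact h.comp (f := fun k : K => (x, k)) (by fun_prop) (fun k _ => ⟨hx, trivial⟩)
  refine ⟨h1, ?_⟩
  rw [continuousOn_iff_continuous_domRestrict]
  have h2 : Continuous (fun p : V × K => ψ p.1 p.2) := by
    rw [← continuousOn_univ]
    exact h.comp (f := fun p : V × K => ((p.1 : X), p.2)) (by fun_prop) (fun p _ => ⟨p.1.2, trivial⟩)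
  convert (ContinuousMap.curry ⟨_, h2⟩).continuous using 1
  ext x k
  simp [Set.domRestrict, ContinuousMap.mkD_of_continuous (h1 x x.2)]

/-- The pairing `(w, φ) ↦ ∫ w φ` on continuous functions on a compact interval. -/
def integralPairing (F : Type*) [NormedAddCommGroup F] [NormedSpace ℂ F] {a b : ℝ} (hab : a ≤ b) :
    C(Set.Icc a b, ℂ) →L[ℂ] C(Set.Icc a b, F) →L[ℂ] F :=
  have hi : ∀ (w : C(Set.Icc a b, ℂ)) (φ : C(Set.Icc a b, F)), IntervalIntegrable
      (fun θ => w (Set.projIcc a b hab θ) • φ (Set.projIcc a b hab θ)) MeasureTheory.volume a b :=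
    fun w φ => ((w.continuous.comp continuous_projIcc).smul
      (φ.continuous.comp continuous_projIcc)).intervalIntegrable a b
  LinearMap.mkContinuous₂
    (LinearMap.mk₂ ℂ
      (fun w φ => ∫ θ in a..b, w (Set.projIcc a b hab θ) • φ (Set.projIcc a b hab θ))
      (fun w w' φ => by
        simp only [ContinuousMap.add_apply, add_smul]
        exact intervalIntegral.integral_add (hi w φ) (hi w' φ))
      (fun c w φ => by
        simp only [ContinuousMap.smul_apply, smul_assoc]
        exact intervalIntegral.integral_smul c _)
      (fun w φ φ' => by
        simp only [ContinuousMap.add_apply, smul_add]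
        exact intervalIntegral.integral_add (hi w φ) (hi w φ'))
      (fun c w φ => by
        simp only [ContinuousMap.smul_apply, smul_comm _ c]
        exact intervalIntegral.integral_smul c _))
    |b - a| (by
      intro w φ
      refine (intervalIntegral.norm_integral_le_of_norm_le_const (C := ‖w‖ * ‖φ‖) ?_).trans
        (le_of_eq (by ring))
      intro θ _
      rw [norm_smul]
      exact mul_le_mul (w.norm_coe_le_norm _) (φ.norm_coe_le_norm _) (norm_nonneg _)
        (norm_nonneg _))

theorem integralPairing_apply {F : Type*} [NormedAddCommGroup F] [NormedSpace ℂ F] {a b : ℝ}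
    (hab : a ≤ b) (w : C(Set.Icc a b, ℂ)) (φ : C(Set.Icc a b, F)) :
    integralPairing F hab w φ =
      ∫ θ in a..b, w (Set.projIcc a b hab θ) • φ (Set.projIcc a b hab θ) := rfl

theorem analyticAt_pairing {E A B F : Type*} [NormedAddCommGroup E] [NormedSpace ℂ E]
    [NormedAddCommGroup F] [NormedSpace ℂ F] [NormedAddCommGroup A] [NormedSpace ℂ A]
    [NormedAddCommGroup B] [NormedSpace ℂ B] (P : A →L[ℂ] B →L[ℂ] F) {k : ℂ → A} {g : E → B}
    {x₀ : E} {z₀ : ℂ} (hg : AnalyticAt ℂ g x₀) (hk : AnalyticAt ℂ k z₀) :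
    AnalyticAt ℂ (fun p : E × ℂ => P (k p.2) (g p.1)) (x₀, z₀) := by
  have h0 : AnalyticAt ℂ (fun p : E × ℂ => k p.2) (x₀, z₀) := hk.comp_of_eq analyticAt_snd rfl
  have h2 : AnalyticAt ℂ (fun p : E × ℂ => g p.1) (x₀, z₀) := hg.comp_of_eq analyticAt_fst rfl
  exact (P.analyticAt_bilinear (k z₀, g x₀)).comp_of_eq (h0.prod h2) rfl

/-- If Osgood's lemma holds for functions on `E` with values in Banach spaces, it holds on
`E × ℂ`. -/
theorem osgood_prod {E F : Type} [NormedAddCommGroup E] [NormedSpace ℂ E]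
    [NormedAddCommGroup F] [NormedSpace ℂ F] [CompleteSpace F]
    (ih : ∀ {G : Type} [NormedAddCommGroup G] [NormedSpace ℂ G] [CompleteSpace G]
      {f : E → G} {U : Set E}, IsOpen U → ContinuousOn f U →
      (∀ x ∈ U, ∀ v, DifferentiableAt ℂ (fun t : ℂ => f (x + t • v)) 0) → AnalyticOnNhd ℂ f U)
    {f : E × ℂ → F} {U : Set (E × ℂ)} (hU : IsOpen U) (hf : ContinuousOn f U)
    (hd : ∀ x ∈ U, ∀ v, DifferentiableAt ℂ (fun t : ℂ => f (x + t • v)) 0) :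
    AnalyticOnNhd ℂ f U := by
  rintro ⟨x₀, z₀⟩ hp
  obtain ⟨R, hR, hRU⟩ := Metric.isOpen_iff.1 hU _ hp
  obtain ⟨r, hr, hrR⟩ := exists_between hR
  have hmem : ∀ x ∈ Metric.ball x₀ r, ∀ z ∈ Metric.closedBall z₀ r, (x, z) ∈ U := by
    intro x hx z hz
    apply hRU
    rw [← ball_prod_same]
    exact ⟨Metric.ball_subset_ball hrR.le hx, (Metric.mem_closedBall.1 hz).trans_lt hrR⟩
  have h2π : (0 : ℝ) ≤ 2 * Real.pi := by positivity
  have hcirc : ∀ θ, circleMap z₀ r θ ∈ Metric.closedBall z₀ r := fun θ =>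
    circleMap_mem_closedBall z₀ hr.le θ
  have hneg : ∀ z ∈ Metric.ball z₀ r, ∀ θ, circleMap z₀ r θ - z ≠ 0 := by
    intro z hz θ e
    have h1 : circleMap z₀ r θ ∈ Metric.sphere z₀ r := circleMap_mem_sphere z₀ hr.le θ
    rw [sub_eq_zero.1 e] at h1
    exact (Metric.mem_ball.1 hz).ne (Metric.mem_sphere.1 h1)
  -- the family of restrictions to the circle
  obtain ⟨hg1, hg2⟩ := continuousOn_mkD (K := Set.Icc 0 (2 * Real.pi)) (V := Metric.ball x₀ r)
    (ψ := fun x θ => f (x, circleMap z₀ r θ)) (by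
      refine hf.comp (f := fun p : E × Set.Icc 0 (2 * Real.pi) => (p.1, circleMap z₀ r p.2)) ?_ ?_
      · have : Continuous (circleMap z₀ r) := continuous_circleMap z₀ r
        fun_prop
      · intro p hp
        exact hmem _ hp.1 _ (hcirc _))
  obtain ⟨hk1, hk2⟩ := continuousOn_mkD (K := Set.Icc 0 (2 * Real.pi)) (V := Metric.ball z₀ r)
    (ψ := fun z θ => (2 * Real.pi * Complex.I : ℂ)⁻¹ * (deriv (circleMap z₀ r) θ *
      (circleMap z₀ r θ - z)⁻¹)) (by
      have h1 : Continuous (circleMap z₀ r) := continuous_circleMap z₀ r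
      have h2 : Continuous (deriv (circleMap z₀ r)) := by
        have : deriv (circleMap z₀ r) = fun θ => circleMap 0 r θ * Complex.I := by
          ext θ; exact deriv_circleMap z₀ r θ
        rw [this]
        have := continuous_circleMap 0 r
        fun_prop
      refine ContinuousOn.mul continuousOn_const (ContinuousOn.mul ?_ (ContinuousOn.inv₀ ?_ ?_))
      · exact (h2.comp (continuous_subtype_val.comp continuous_snd)).continuousOn
      · exact ((h1.comp (continuous_subtype_val.comp continuous_snd)).sub
          continuous_fst).continuousOn
      · intro p hp
        exact hneg _ hp.1 _)
  set g : E → C(Set.Icc 0 (2 * Real.pi), F) := fun x =>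
    ContinuousMap.mkD (fun θ => f (x, circleMap z₀ r θ)) 0 with hg
  set k : ℂ → C(Set.Icc 0 (2 * Real.pi), ℂ) := fun z =>
    ContinuousMap.mkD (fun θ => (2 * Real.pi * Complex.I : ℂ)⁻¹ * (deriv (circleMap z₀ r) θ *
      (circleMap z₀ r θ - z)⁻¹)) 0 with hk
  have hgv : ∀ x ∈ Metric.ball x₀ r, ∀ θ, g x θ = f (x, circleMap z₀ r θ) := by
    intro x hx θ
    simp only [hg]
    rw [ContinuousMap.mkD_apply_of_continuous (hg1 x hx)]
  have hkv : ∀ z ∈ Metric.ball z₀ r, ∀ θ, k z θ = (2 * Real.pi * Complex.I : ℂ)⁻¹ *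
      (deriv (circleMap z₀ r) θ * (circleMap z₀ r θ - z)⁻¹) := by
    intro x hx θ
    simp only [hk]
    rw [ContinuousMap.mkD_apply_of_continuous (hk1 x hx)]
  -- The induction hypothesis is applied to a map with values in the Banach space of continuous
  -- functions on the parameter interval of the circle; this is why Osgood's lemma is stated for
  -- Banach-valued functions.
  have hga : AnalyticOnNhd ℂ g (Metric.ball x₀ r) := by
    refine ih Metric.isOpen_ball hg2 ?_
    intro x hx v
    have hline : Continuous fun t : ℂ => x + t • v := by fun_prop
    have h1 : ∀ᶠ t : ℂ in 𝓝 0, x + t • v ∈ Metric.ball x₀ r :=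
      hline.continuousAt.eventually_mem (Metric.isOpen_ball.mem_nhds (by simpa using hx))
    obtain ⟨ε, hε, hεs⟩ := Metric.nhds_basis_closedBall.mem_iff.1 h1
    refine (analyticAt_continuousMap_of_eval hε ?_ ?_).differentiableAt
    · exact hg2.comp hline.continuousOn hεs
    · intro θ t ht
      have h3 : (fun w : ℂ => g (x + w • v) θ) =ᶠ[𝓝 t]
          fun w => f ((x, circleMap z₀ r θ) + w • ((v, 0) : E × ℂ)) := by
        filter_upwards [Metric.isOpen_ball.mem_nhds ht] with w hw
        rw [hgv _ (hεs (Metric.ball_subset_closedBall hw))]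
        simp
      refine DifferentiableAt.congr_of_eventuallyEq ?_ h3
      have h4 := hd ((x, circleMap z₀ r θ) + t • ((v, 0) : E × ℂ)) (by
        simpa using hmem _ (hεs (Metric.ball_subset_closedBall ht)) _ (hcirc θ)) (v, 0)
      have h5 : (fun w : ℂ => f ((x, circleMap z₀ r θ) + w • ((v, 0) : E × ℂ))) =
          (fun w : ℂ => f ((x, circleMap z₀ r θ) + t • ((v, 0) : E × ℂ) + w • ((v, 0) : E × ℂ)))
            ∘ fun w => w - t := by
        ext w
        simp only [Function.comp]
        congr 1
        rw [add_assoc, ← add_smul]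
        congr 2
        ring
      rw [h5]
      refine DifferentiableAt.comp t ?_ (by fun_prop)
      simpa using h4
  have hka : AnalyticAt ℂ k z₀ := by
    refine analyticAt_continuousMap_of_eval (half_pos hr) (hk2.mono ?_) ?_
    · exact Metric.closedBall_subset_ball (half_lt_self hr)
    · intro θ z hz
      have hz' : z ∈ Metric.ball z₀ r := Metric.ball_subset_ball (half_le_self hr.le) hz
      have h3 : (fun w => k w θ) =ᶠ[𝓝 z] fun w => (2 * Real.pi * Complex.I : ℂ)⁻¹ *
          (deriv (circleMap z₀ r) θ * (circleMap z₀ r θ - w)⁻¹) := by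
        filter_upwards [Metric.isOpen_ball.mem_nhds hz'] with w hw
        exact hkv w hw θ
      refine DifferentiableAt.congr_of_eventuallyEq ?_ h3
      refine ((DifferentiableAt.inv (by fun_prop) (hneg z hz' θ)).const_mul _).const_mul _
  -- Cauchy's formula in the last variable writes `f` as a continuous bilinear pairing of a kernel
  -- analytic in `z` with a family analytic in `x`, which is jointly analytic.
  have key : (fun p : E × ℂ => integralPairing F h2π (k p.2) (g p.1)) =ᶠ[𝓝 (x₀, z₀)] f := by
    filter_upwards [prod_mem_nhds (Metric.ball_mem_nhds x₀ hr) (Metric.ball_mem_nhds z₀ hr)]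
    rintro ⟨x, z⟩ ⟨hx, hz⟩
    have hcau := Complex.two_pi_I_inv_smul_circleIntegral_sub_inv_smul_of_differentiable_on_off_countable
      (f := fun w => f (x, w)) Set.countable_empty hz
      (hf.comp (f := fun w : ℂ => (x, w)) (by fun_prop) (fun w hw => hmem x hx w hw)) (by
        intro w hw
        have h4 := hd (x, w) (hmem x hx w (Metric.ball_subset_closedBall hw.1)) (0, 1)
        have h5 : (fun w' : ℂ => f (x, w')) =
            (fun t : ℂ => f ((x, w) + t • ((0, 1) : E × ℂ))) ∘ fun w' => w' - w := by
          ext w'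
          simp
        rw [h5]
        refine DifferentiableAt.comp w ?_ (by fun_prop)
        simpa using h4)
    rw [integralPairing_apply, ← hcau, circleIntegral, ← intervalIntegral.integral_smul]
    refine intervalIntegral.integral_congr ?_
    intro θ hθ
    rw [Set.uIcc_of_le h2π] at hθ
    simp only
    rw [hkv z hz, hgv x hx, Set.projIcc_of_mem h2π hθ, mul_smul, mul_smul]
  refine AnalyticAt.congr ?_ key
  exact analyticAt_pairing _ (hga x₀ (Metric.mem_ball_self hr)) hka

/-- The standard splitting of `ℂⁿ⁺¹`. -/
def finSuccSplit (n : ℕ) : (Fin (n + 1) → ℂ) ≃L[ℂ] (Fin n → ℂ) × ℂ :=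
  ContinuousLinearEquiv.ofFinrankEq (by simp)

/-- **Osgood's lemma** on `ℂⁿ`. -/
theorem osgood_fin (n : ℕ) : ∀ {F : Type} [NormedAddCommGroup F] [NormedSpace ℂ F]
    [CompleteSpace F] {f : (Fin n → ℂ) → F} {U : Set (Fin n → ℂ)}, IsOpen U → ContinuousOn f U →
    (∀ x ∈ U, ∀ v, DifferentiableAt ℂ (fun t : ℂ => f (x + t • v)) 0) → AnalyticOnNhd ℂ f U := by
  induction n with
  | zero =>
    intro F _ _ _ f U _ _ _ x _
    have : f = fun _ => f 0 := by
      ext y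
      rw [Subsingleton.elim y 0]
    rw [this]
    exact analyticAt_const
  | succ n ih =>
    intro F _ _ _ f U hU hf hd
    set e := finSuccSplit n
    have h := osgood_prod (E := Fin n → ℂ) (f := f ∘ e.symm) (U := e.symm ⁻¹' U) ih
      (hU.preimage e.symm.continuous)
      (hf.comp e.symm.continuous.continuousOn fun _ h => h) (by
        intro x hx v
        simpa [Function.comp] using hd (e.symm x) hx (e.symm v))
    intro x hx
    have h1 := (h (e x) (by simpa using hx)).comp (e.analyticAt x)
    simpa [Function.comp_def] using h1

/-- **Osgood's lemma**: on an open subset of a finite-dimensional space, a continuous function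
which is holomorphic along complex lines is analytic. -/
theorem analyticOnNhd_of_continuousOn_of_lines {E F : Type} [NormedAddCommGroup E]
    [NormedSpace ℂ E] [FiniteDimensional ℂ E] [NormedAddCommGroup F] [NormedSpace ℂ F]
    [CompleteSpace F] {f : E → F} {U : Set E} (hU : IsOpen U) (hf : ContinuousOn f U)
    (hd : ∀ x ∈ U, ∀ v, DifferentiableAt ℂ (fun t : ℂ => f (x + t • v)) 0) :
    AnalyticOnNhd ℂ f U := by
  let e : E ≃L[ℂ] (Fin (Module.finrank ℂ E) → ℂ) := ContinuousLinearEquiv.ofFinrankEq (by simp)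
  have h := osgood_fin _ (f := f ∘ e.symm) (U := e.symm ⁻¹' U)
    (hU.preimage e.symm.continuous)
    (hf.comp e.symm.continuous.continuousOn fun _ h => h) (by
      intro x hx v
      simpa [Function.comp] using hd (e.symm x) hx (e.symm v))
  intro x hx
  have h1 := (h (e x) (by simpa using hx)).comp (e.analyticAt x)
  simpa [Function.comp_def] using h1

/-- A locally uniform limit of analytic functions on a finite-dimensional space is analytic. -/
theorem analyticOnNhd_of_tendstoUniformlyOn {E F : Type} [NormedAddCommGroup E]
    [NormedSpace ℂ E] [FiniteDimensional ℂ E] [NormedAddCommGroup F] [NormedSpace ℂ F]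
    [CompleteSpace F] {φ : ℕ → E → F} {f : E → F} {U : Set E} (hU : IsOpen U)
    (hφ : ∀ k, AnalyticOnNhd ℂ (φ k) U) (h : TendstoUniformlyOn φ f atTop U) :
    AnalyticOnNhd ℂ f U := by
  refine analyticOnNhd_of_continuousOn_of_lines hU
    (h.continuousOn (Frequently.of_forall fun k => (hφ k).continuousOn)) ?_
  intro x hx v
  have hline : Continuous fun t : ℂ => x + t • v := by fun_prop
  have hV : IsOpen ((fun t : ℂ => x + t • v) ⁻¹' U) := hU.preimage hline
  have h1 : TendstoLocallyUniformlyOn (fun k t => φ k (x + t • v)) (fun t : ℂ => f (x + t • v))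
      atTop ((fun t : ℂ => x + t • v) ⁻¹' U) :=
    (h.comp (fun t : ℂ => x + t • v)).tendstoLocallyUniformlyOn
  refine (h1.differentiableOn (Eventually.of_forall fun k t ht => ?_) hV).differentiableAt
    (hV.mem_nhds (by simpa using hx))
  refine DifferentiableAt.differentiableWithinAt ?_
  exact (hφ k _ ht).differentiableAt.comp t (by fun_prop)

/-! ### Analytic dependence of slices and circle integrals on parameters. -/

/-- Slices of an analytic function along a compact set depend analytically on the parameter, for
the uniform norm. -/
theorem analyticAt_mkD_slice {E F K : Type} [NormedAddCommGroup E] [NormedSpace ℂ E]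
    [FiniteDimensional ℂ E] [NormedAddCommGroup F] [NormedSpace ℂ F] [CompleteSpace F]
    [TopologicalSpace K] [CompactSpace K] {κ : K → ℂ} (hκ : Continuous κ) {v : E × ℂ → F} {x₀ : E}
    (hv : ∀ k, AnalyticAt ℂ v (x₀, κ k)) :
    (∀ᶠ x in 𝓝 x₀, Continuous fun k => v (x, κ k)) ∧
      AnalyticAt ℂ (fun x => ContinuousMap.mkD (fun k => v (x, κ k)) 0) x₀ := by
  have h1 : ∀ᶠ x in 𝓝 x₀, ∀ k ∈ (Set.univ : Set K), AnalyticAt ℂ v (x, κ k) := by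
    refine isCompact_univ.eventually_forall_of_forall_eventually fun k _ => ?_
    have : Tendsto (fun p : E × K => (p.1, κ p.2)) (𝓝 (x₀, k)) (𝓝 (x₀, κ k)) :=
      (continuous_fst.prodMk (hκ.comp continuous_snd)).tendsto _
    exact this.eventually (hv k).eventually_analyticAt
  obtain ⟨V, hVs, hVo, hx₀⟩ := eventually_nhds_iff.1 h1
  obtain ⟨hg1, hg2⟩ := continuousOn_mkD (K := K) (V := {x | x ∈ V}) (ψ := fun x k => v (x, κ k)) (by
    rintro ⟨x, k⟩ ⟨hx, -⟩
    refine ContinuousAt.continuousWithinAt ?_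
    exact ((hVs x hx k trivial).continuousAt).comp (f := fun p : E × K => (p.1, κ p.2))
      (continuous_fst.prodMk (hκ.comp continuous_snd)).continuousAt)
  refine ⟨eventually_of_mem (hVo.mem_nhds hx₀) hg1, ?_⟩
  refine analyticOnNhd_of_continuousOn_of_lines hVo hg2 ?_ x₀ hx₀
  intro x hx w
  have hline : Continuous fun t : ℂ => x + t • w := by fun_prop
  have h1 : ∀ᶠ t : ℂ in 𝓝 0, x + t • w ∈ V :=
    hline.continuousAt.eventually_mem (hVo.mem_nhds (by simpa using hx))
  obtain ⟨ε, hε, hεs⟩ := Metric.nhds_basis_closedBall.mem_iff.1 h1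
  refine (analyticAt_continuousMap_of_eval hε (hg2.comp hline.continuousOn hεs) ?_).differentiableAt
  intro k t ht
  have ht' := hεs (Metric.ball_subset_closedBall ht)
  have h3 : (fun t : ℂ => ContinuousMap.mkD (fun k => v (x + t • w, κ k)) 0 k) =ᶠ[𝓝 t]
      fun t => v (x + t • w, κ k) := by
    filter_upwards [Metric.isOpen_ball.mem_nhds ht] with t' ht'
    rw [ContinuousMap.mkD_apply_of_continuous (hg1 _ (hεs (Metric.ball_subset_closedBall ht')))]
  refine DifferentiableAt.congr_of_eventuallyEq ?_ h3
  exact (hVs _ ht' k trivial).differentiableAt.comp t (f := fun t : ℂ => (x + t • w, κ k))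
    (by fun_prop)

/-- Circle integrals of analytic functions are analytic in the parameters. -/
theorem analyticAt_circleIntegral {E F : Type} [NormedAddCommGroup E] [NormedSpace ℂ E]
    [FiniteDimensional ℂ E] [NormedAddCommGroup F] [NormedSpace ℂ F] [CompleteSpace F]
    {v : E × ℂ → F} {x₀ : E} {c : ℂ} {r : ℝ} (hr : 0 ≤ r)
    (hv : ∀ z ∈ Metric.sphere c r, AnalyticAt ℂ v (x₀, z)) :
    AnalyticAt ℂ (fun x => ∮ z in C(c, r), v (x, z)) x₀ := by
  have h2π : (0 : ℝ) ≤ 2 * Real.pi := by positivity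
  have hκ : Continuous fun θ : Set.Icc 0 (2 * Real.pi) => circleMap c r θ :=
    (continuous_circleMap c r).comp continuous_subtype_val
  obtain ⟨h1, h2⟩ := analyticAt_mkD_slice hκ (v := v) (x₀ := x₀)
    (fun k => hv _ (circleMap_mem_sphere c hr _))
  have hw : Continuous fun θ : Set.Icc 0 (2 * Real.pi) => deriv (circleMap c r) θ := by
    simp only [deriv_circleMap]
    exact ((continuous_circleMap 0 r).comp continuous_subtype_val).mul continuous_const
  have h3 := ((integralPairing F h2π ⟨_, hw⟩).analyticAt _).comp h2
  refine h3.congr ?_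
  filter_upwards [h1] with x hx
  rw [Function.comp, integralPairing_apply, circleIntegral]
  refine intervalIntegral.integral_congr ?_
  intro θ hθ
  rw [Set.uIcc_of_le h2π] at hθ
  simp only
  rw [ContinuousMap.mkD_apply_of_continuous hx, Set.projIcc_of_mem h2π hθ]
  rfl

/-! ### Zeros in a disc and Weierstrass preparation. -/

/-- Dividing out all zeros of an analytic function on a closed disc. -/
theorem exists_factorization_closedBall {r : ℝ} (hr : 0 < r) (n : ℕ) : ∀ {φ : ℂ → ℂ},
    AnalyticOnNhd ℂ φ (Metric.closedBall 0 r) → (∀ z ∈ Metric.sphere (0 : ℂ) r, φ z ≠ 0) →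
    (Metric.closedBall 0 r ∩ φ ⁻¹' {0}).ncard = n →
    ∃ (s : Multiset ℂ) (e : ℂ → ℂ), (∀ a ∈ s, a ∈ Metric.ball (0 : ℂ) r) ∧
      AnalyticOnNhd ℂ e (Metric.closedBall 0 r) ∧ (∀ z ∈ Metric.closedBall 0 r, e z ≠ 0) ∧
      ∀ z, φ z = (s.map fun a => z - a).prod * e z := by
  induction n with
  | zero =>
    intro φ hφ hs hn
    have hne : ∃ z, z ∈ Metric.sphere (0 : ℂ) r :=
      ⟨(r : ℂ), by simp [abs_of_pos hr]⟩
    -- `ncard` is also `0` for infinite sets. These are excluded by the identity theorem: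
    -- accumulating zeros would make `φ` vanish on the boundary circle.
    have hfin : (Metric.closedBall 0 r ∩ φ ⁻¹' {0}).Finite := by
      by_contra hinf
      obtain ⟨a, ha, hacc⟩ := Set.Infinite.exists_accPt_of_subset_isCompact hinf
        (isCompact_closedBall _ _) Set.inter_subset_left
      have h1 : ∃ᶠ z in 𝓝[≠] a, φ z = 0 :=
        (accPt_iff_frequently_nhdsNE.1 hacc).mono fun z hz => hz.2
      obtain ⟨z, hz⟩ := hne
      exact hs z hz (hφ.eqOn_zero_of_preconnected_of_frequently_eq_zero
        (convex_closedBall _ _).isPreconnected ha h1 (Metric.sphere_subset_closedBall hz))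
    rw [Set.ncard_eq_zero hfin] at hn
    refine ⟨0, φ, by simp, hφ, ?_, by simp⟩
    intro z hz h0
    exact Set.eq_empty_iff_forall_notMem.1 hn z ⟨hz, h0⟩
  | succ n ih =>
    intro φ hφ hs hn
    have hn0 : (Metric.closedBall 0 r ∩ φ ⁻¹' {0}).ncard ≠ 0 := by omega
    have hfin := Set.finite_of_ncard_ne_zero hn0
    obtain ⟨a, ha, ha0⟩ := Set.nonempty_of_ncard_ne_zero hn0
    have ha0' : φ a = 0 := ha0
    have hab : a ∈ Metric.ball (0 : ℂ) r := by
      rcases lt_or_eq_of_le (Metric.mem_closedBall.1 ha) with h | h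
      · exact h
      · exact absurd ha0' (hs a h)
    have hnt : ¬ ∀ᶠ z in 𝓝 a, φ z = 0 := by
      intro h
      have hz : (r : ℂ) ∈ Metric.sphere (0 : ℂ) r := by simp [abs_of_pos hr]
      exact hs _ hz (hφ.eqOn_zero_of_preconnected_of_eventuallyEq_zero
        (convex_closedBall _ _).isPreconnected ha h (Metric.sphere_subset_closedBall hz))
    obtain ⟨k, g, hg, hga, hgk⟩ := (hφ a ha).exists_eventuallyEq_pow_smul_nonzero_iff.2 hnt
    have hk : k ≠ 0 := by
      rintro rfl
      have := hgk.self_of_nhds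
      simp [ha0'] at this
      exact hga this.symm
    set ψ : ℂ → ℂ := fun z => if z = a then g a else φ z / (z - a) ^ k with hψ
    have hψa : ψ =ᶠ[𝓝 a] g := by
      filter_upwards [hgk] with z hz
      by_cases h : z = a
      · simp [hψ, h]
      · simp only [hψ, h, if_false, hz, smul_eq_mul]
        field_simp [sub_ne_zero.2 h]
    have hφψ : ∀ z, φ z = (z - a) ^ k * ψ z := by
      intro z
      by_cases h : z = a
      · simp [h, ha0', hk]
      · simp only [hψ, h, if_false]
        field_simp [sub_ne_zero.2 h]
    have hψan : AnalyticOnNhd ℂ ψ (Metric.closedBall 0 r) := by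
      intro z hz
      by_cases h : z = a
      · rw [h]; exact hg.congr hψa.symm
      · refine ((hφ z hz).div (g := fun z => (z - a) ^ k) (by fun_prop)
          (pow_ne_zero _ (sub_ne_zero.2 h))).congr ?_
        filter_upwards [isOpen_ne.mem_nhds h] with w hw
        simp [hψ, show w ≠ a from hw]
    have hset : Metric.closedBall 0 r ∩ ψ ⁻¹' {0} = (Metric.closedBall 0 r ∩ φ ⁻¹' {0}) \ {a} := by
      ext z
      simp only [Set.mem_inter_iff, Set.mem_preimage, Set.mem_singleton_iff, Set.mem_sdiff]
      by_cases h : z = a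
      · simp [h, hψ, hga]
      · rw [hφψ z]
        simp [h, sub_ne_zero.2 h]
    obtain ⟨s, e, hs1, he1, he2, he3⟩ := ih hψan (fun z hz h0 => hs z hz (by rw [hφψ, h0, mul_zero]))
      (by rw [hset, Set.ncard_sdiff_singleton_of_mem (Set.mem_inter ha ha0), hn]; rfl)
    refine ⟨Multiset.replicate k a + s, e, ?_, he1, he2, ?_⟩
    · intro b hb
      rcases Multiset.mem_add.1 hb with hb | hb
      · rw [Multiset.eq_of_mem_replicate hb]; exact hab
      · exact hs1 b hb
    · intro z
      rw [hφψ, he3]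
      simp [mul_assoc]

/-- The function `φ` has the zeros `a j` in the disc of radius `r`, with multiplicities. -/
def HasZeros (φ : ℂ → ℂ) (r : ℝ) {m : ℕ} (a : Fin m → ℂ) : Prop :=
  (∀ j, a j ∈ Metric.ball (0 : ℂ) r) ∧ ∃ e : ℂ → ℂ, AnalyticOnNhd ℂ e (Metric.closedBall 0 r) ∧
    (∀ z ∈ Metric.closedBall 0 r, e z ≠ 0) ∧ ∀ z, φ z = (∏ j, (z - a j)) * e z

theorem exists_hasZeros {r : ℝ} (hr : 0 < r) {φ : ℂ → ℂ}
    (hφ : AnalyticOnNhd ℂ φ (Metric.closedBall 0 r)) (hs : ∀ z ∈ Metric.sphere (0 : ℂ) r, φ z ≠ 0) :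
    ∃ (m : ℕ) (a : Fin m → ℂ), HasZeros φ r a := by
  obtain ⟨s, e, h1, h2, h3, h4⟩ := exists_factorization_closedBall hr _ hφ hs rfl
  refine ⟨s.toList.length, fun j => s.toList[j], ?_, e, h2, h3, ?_⟩
  · intro j
    exact h1 _ (Multiset.mem_toList.1 (List.getElem_mem j.2))
  · intro z
    rw [h4]
    refine Eq.trans ?_ (congrArg (· * e z) (Fin.prod_univ_fun_getElem s.toList (fun a => z - a)).symm)
    conv_lhs => rw [← Multiset.coe_toList s]
    rw [Multiset.map_coe, Multiset.prod_coe]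

theorem HasZeros.eq_zero_iff {φ : ℂ → ℂ} {r : ℝ} {m : ℕ} {a : Fin m → ℂ} (h : HasZeros φ r a)
    {z : ℂ} (hz : z ∈ Metric.closedBall 0 r) : φ z = 0 ↔ ∃ j, z = a j := by
  obtain ⟨-, e, -, h3, h4⟩ := h
  rw [h4, mul_eq_zero, or_iff_left (h3 z hz), Finset.prod_eq_zero_iff]
  simp [sub_eq_zero]

/-- The residue theorem for `u φ' / φ`. -/
theorem HasZeros.circleIntegral_eq {φ : ℂ → ℂ} {r : ℝ} (hr : 0 < r) {m : ℕ} {a : Fin m → ℂ}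
    (h : HasZeros φ r a) {u : ℂ → ℂ} (hu : AnalyticOnNhd ℂ u (Metric.closedBall 0 r)) :
    ∮ z in C(0, r), u z * (deriv φ z / φ z) = 2 * Real.pi * Complex.I * ∑ j, u (a j) := by
  obtain ⟨h1, e, h2, h3, h4⟩ := h
  have hne : ∀ z ∈ Metric.sphere (0 : ℂ) r, ∀ j, z - a j ≠ 0 := by
    intro z hz j e0
    rw [sub_eq_zero.1 e0] at hz
    exact (Metric.mem_ball.1 (h1 j)).ne (Metric.mem_sphere.1 hz)
  have hφ : φ = fun z => (∏ j, (z - a j)) * e z := funext h4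
  -- The logarithmic derivative splits into simple poles at the `a j`, treated by Cauchy's formula,
  -- and a holomorphic term whose integral is zero.
  have key : ∀ z ∈ Metric.sphere (0 : ℂ) r, u z * (deriv φ z / φ z) =
      (∑ j, (z - a j)⁻¹ • u z) + u z * (deriv e z / e z) := by
    intro z hz
    have hz' := Metric.sphere_subset_closedBall hz
    have e1 : deriv φ z / φ z = logDeriv φ z := (logDeriv_apply φ z).symm
    rw [e1, hφ, logDeriv_mul z (Finset.prod_ne_zero_iff.2 fun j _ => hne z hz j) (h3 z hz')
      (by fun_prop) (h2 z hz').differentiableAt]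
    have e2 : logDeriv (fun z => ∏ j, (z - a j)) z = ∑ j, (z - a j)⁻¹ := by
      have := logDeriv_prod (s := Finset.univ) (f := fun (j : Fin m) (z : ℂ) => z - a j) (x := z)
        (fun j _ => hne z hz j) (fun j _ => by fun_prop)
      rw [this]
      refine Finset.sum_congr rfl fun j _ => ?_
      rw [logDeriv_apply]
      simp
    rw [e2, mul_add, Finset.mul_sum, logDeriv_apply]
    congr 1
    exact Finset.sum_congr rfl fun j _ => by rw [smul_eq_mul, mul_comm]
  have hc1 : ∀ j, CircleIntegrable (fun z => (z - a j)⁻¹ • u z) 0 r := fun j =>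
    ((ContinuousOn.inv₀ (f := fun z => z - a j) (by fun_prop) (fun z hz => hne z hz j)).smul
      (hu.continuousOn.mono Metric.sphere_subset_closedBall)).circleIntegrable hr.le
  have hq : AnalyticOnNhd ℂ (fun z => u z * (deriv e z / e z)) (Metric.closedBall 0 r) :=
    hu.mul (h2.deriv.div h2 h3)
  have hc2 : CircleIntegrable (fun z => u z * (deriv e z / e z)) 0 r :=
    (hq.continuousOn.mono Metric.sphere_subset_closedBall).circleIntegrable hr.le
  rw [circleIntegral.integral_congr hr.le key, circleIntegral.integral_add
    (CircleIntegrable.fun_sum _ fun j _ => hc1 j) hc2,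
    circleIntegral.integral_fun_sum fun j _ => hc1 j,
    Complex.circleIntegral_eq_zero_of_differentiable_on_off_countable hr.le Set.countable_empty
      hq.continuousOn fun z hz => (hq z (Metric.ball_subset_closedBall hz.1)).differentiableAt,
    add_zero, Finset.mul_sum]
  refine Finset.sum_congr rfl fun j _ => ?_
  rw [Complex.circleIntegral_sub_inv_smul_of_differentiable_on_off_countable Set.countable_empty
    (h1 j) hu.continuousOn fun z hz => (hu z (Metric.ball_subset_closedBall hz.1)).differentiableAt,
    smul_eq_mul]

/-- The `z`-derivative of an analytic function of `(x, z)` is analytic. -/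
theorem AnalyticAt.fderiv_snd {E : Type} [NormedAddCommGroup E] [NormedSpace ℂ E]
    {g : E × ℂ → ℂ} {p : E × ℂ} (hg : AnalyticAt ℂ g p) :
    AnalyticAt ℂ (fun q => fderiv ℂ g q (0, 1)) p :=
  ((ContinuousLinearMap.apply ℂ ℂ ((0, 1) : E × ℂ)).analyticAt _).comp_of_eq hg.fderiv rfl

theorem deriv_slice_eq {E : Type} [NormedAddCommGroup E] [NormedSpace ℂ E]
    {g : E × ℂ → ℂ} {x : E} {z : ℂ} (hg : AnalyticAt ℂ g (x, z)) :
    deriv (fun w => g (x, w)) z = fderiv ℂ g (x, z) (0, 1) := by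
  have h1 : HasDerivAt (fun w : ℂ => (x, w)) ((0, 1) : E × ℂ) z :=
    (hasDerivAt_const z x).prodMk (hasDerivAt_id z)
  exact (hg.differentiableAt.hasFDerivAt.comp_hasDerivAt z h1).deriv

/-- **Weierstrass preparation**, in terms of the roots `ρ x` of `g (x, ·)` near the origin: sums
of values of analytic functions over the roots are analytic. -/
theorem exists_weierstrass_roots {E : Type} [NormedAddCommGroup E] [NormedSpace ℂ E]
    [FiniteDimensional ℂ E] {g : E × ℂ → ℂ} (hg : AnalyticAt ℂ g 0)
    (hg0 : ¬ ∀ᶠ z in 𝓝 (0 : ℂ), g (0, z) = 0) {r₀ : ℝ} (hr₀ : 0 < r₀) :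
    ∃ r, 0 < r ∧ r ≤ r₀ ∧ ∃ (m : ℕ) (ρ : E → Fin m → ℂ), Tendsto ρ (𝓝 0) (𝓝 0) ∧ ρ 0 = 0 ∧
      (∀ᶠ x in 𝓝 0, ∀ z ∈ Metric.closedBall (0 : ℂ) r, g (x, z) = 0 ↔ ∃ j, z = ρ x j) ∧
      (∀ u : E × ℂ → ℂ, (∀ z ∈ Metric.closedBall (0 : ℂ) r, AnalyticAt ℂ u (0, z)) →
        AnalyticAt ℂ (fun x => ∑ j, u (x, ρ x j)) 0) ∧
      analyticOrderAt (fun z => g (0, z)) 0 = m := by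
  have hslice : AnalyticAt ℂ (fun z => g (0, z)) 0 :=
    AnalyticAt.comp_of_eq (f := fun z : ℂ => ((0 : E), z)) hg (by fun_prop) rfl
  have hne : ∀ᶠ z in 𝓝 (0 : ℂ), z ≠ 0 → g (0, z) ≠ 0 :=
    eventually_nhdsWithin_iff.1 (hslice.eventually_eq_zero_or_eventually_ne_zero.resolve_left hg0)
  have han : ∀ᶠ z in 𝓝 (0 : ℂ), AnalyticAt ℂ g (0, z) := by
    have h1 : Continuous fun z : ℂ => ((0 : E), z) := by fun_prop
    exact (h1.tendsto' 0 0 rfl).eventually hg.eventually_analyticAt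
  obtain ⟨r₁, hr₁, hr₁s⟩ := Metric.nhds_basis_closedBall.mem_iff.1 (hne.and han)
  set r := min r₀ r₁ with hrdef
  have hr : 0 < r := lt_min hr₀ hr₁
  have hrs : ∀ z ∈ Metric.closedBall (0 : ℂ) r, (z ≠ 0 → g (0, z) ≠ 0) ∧ AnalyticAt ℂ g (0, z) :=
    fun z hz => hr₁s (Metric.closedBall_subset_closedBall (min_le_right _ _) hz)
  have tube : ∀ (K : Set ℂ) (P : E × ℂ → Prop), IsCompact K → (∀ z ∈ K, ∀ᶠ p in 𝓝 ((0 : E), z), P p) →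
      ∀ᶠ x in 𝓝 (0 : E), ∀ z ∈ K, P (x, z) := fun K P hK h =>
    hK.eventually_forall_of_forall_eventually h
  have hA : ∀ᶠ x in 𝓝 (0 : E), ∀ z ∈ Metric.closedBall (0 : ℂ) r, AnalyticAt ℂ g (x, z) :=
    tube _ (fun p => AnalyticAt ℂ g p) (isCompact_closedBall _ _)
      fun z hz => (hrs z hz).2.eventually_analyticAt
  -- The radius was chosen so that `g (0, ·)` has no zero other than possibly `0` in the closed
  -- disc; the tube lemma extends this to nearby `x`, on compact sets avoiding `0`.
  have hN : ∀ K : Set ℂ, IsCompact K → K ⊆ Metric.closedBall 0 r → 0 ∉ K →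
      ∀ᶠ x in 𝓝 (0 : E), ∀ z ∈ K, g (x, z) ≠ 0 := fun K hK hKs h0 =>
    tube K (fun p => g p ≠ 0) hK fun z hz => (hrs z (hKs hz)).2.continuousAt.eventually_ne
      ((hrs z (hKs hz)).1 fun h => h0 (h ▸ hz))
  have hS : ∀ᶠ x in 𝓝 (0 : E), ∀ z ∈ Metric.sphere (0 : ℂ) r, g (x, z) ≠ 0 :=
    hN _ (isCompact_sphere _ _) Metric.sphere_subset_closedBall (by simp [hr.ne])
  have hsl : ∀ {u : E × ℂ → ℂ} {x : E}, (∀ z ∈ Metric.closedBall (0 : ℂ) r, AnalyticAt ℂ u (x, z)) →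
      AnalyticOnNhd ℂ (fun z => u (x, z)) (Metric.closedBall 0 r) := fun h z hz =>
    AnalyticAt.comp_of_eq (f := fun z : ℂ => (_, z)) (h z hz) (by fun_prop) rfl
  have hex : ∀ᶠ x in 𝓝 (0 : E), ∃ (m : ℕ) (a : Fin m → ℂ), HasZeros (fun z => g (x, z)) r a := by
    filter_upwards [hA, hS] with x hx1 hx2
    exact exists_hasZeros hr (hsl hx1) hx2
  have h2πi : (2 * Real.pi * Complex.I : ℂ) ≠ 0 := by simp [Real.pi_ne_zero]
  -- sums over zeros as contour integrals
  have hint : ∀ u : E × ℂ → ℂ, (∀ z ∈ Metric.closedBall (0 : ℂ) r, AnalyticAt ℂ u (0, z)) →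
      ∃ I : E → ℂ, AnalyticAt ℂ I 0 ∧ ∀ᶠ x in 𝓝 (0 : E), ∀ (m : ℕ) (a : Fin m → ℂ),
        HasZeros (fun z => g (x, z)) r a → ∑ j, u (x, a j) = I x := by
    intro u hu
    refine ⟨fun x => (2 * Real.pi * Complex.I : ℂ)⁻¹ *
      ∮ z in C(0, r), u (x, z) * (fderiv ℂ g (x, z) (0, 1) / g (x, z)), ?_, ?_⟩
    · refine analyticAt_const.mul (analyticAt_circleIntegral
        (v := fun p => u p * (fderiv ℂ g p (0, 1) / g p)) hr.le fun z hz => ?_)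
      have hz' := Metric.sphere_subset_closedBall hz
      refine (hu z hz').mul ((hrs z hz').2.fderiv_snd.div (hrs z hz').2 ?_)
      refine (hrs z hz').1 ?_
      rintro rfl
      simp [hr.ne] at hz
    · have hA' : ∀ᶠ x in 𝓝 (0 : E), ∀ z ∈ Metric.closedBall (0 : ℂ) r, AnalyticAt ℂ u (x, z) :=
        tube _ (fun p => AnalyticAt ℂ u p) (isCompact_closedBall _ _)
          fun z hz => (hu z hz).eventually_analyticAt
      filter_upwards [hA, hA'] with x hx1 hx2 m a ha
      have h1 := ha.circleIntegral_eq hr (hsl hx2)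
      rw [circleIntegral.integral_congr hr.le (g := fun z =>
        u (x, z) * (fderiv ℂ g (x, z) (0, 1) / g (x, z)))] at h1
      · rw [h1, inv_mul_cancel_left₀ h2πi]
      · intro z hz
        simp only
        rw [deriv_slice_eq (hx1 z (Metric.sphere_subset_closedBall hz))]
  obtain ⟨m, a₀, ha₀⟩ := hex.self_of_nhds
  have ha₀0 : a₀ = 0 := by
    ext j
    by_contra h
    have hj := Metric.ball_subset_closedBall (ha₀.1 j)
    exact (hrs _ hj).1 h ((ha₀.eq_zero_iff hj).2 ⟨j, rfl⟩)
  -- the number of zeros is locally constant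
  have hcount : ∀ᶠ x in 𝓝 (0 : E), ∃ a : Fin m → ℂ, HasZeros (fun z => g (x, z)) r a := by
    obtain ⟨I, hI, hIs⟩ := hint (fun _ => 1) fun z _ => analyticAt_const
    have h0 : I 0 = m := by
      rw [← hIs.self_of_nhds m a₀ ha₀]; simp
    have h1 : ∀ᶠ x in 𝓝 (0 : E), ‖I x - m‖ < 1 := by
      have h2 : Tendsto (fun x => ‖I x - m‖) (𝓝 0) (𝓝 0) := by
        have := (hI.continuousAt.tendsto.sub_const (m : ℂ)).norm
        simpa [h0] using this
      exact h2.eventually_lt_const one_pos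
    filter_upwards [hex, hIs, h1] with x hx1 hx2 hx3
    obtain ⟨m', a, ha⟩ := hx1
    have h3 : I x = m' := by rw [← hx2 m' a ha]; simp
    have h4 : m' = m := by
      rw [h3] at hx3
      have h5 : ‖(((m' : ℤ) - (m : ℤ) : ℤ) : ℂ)‖ < 1 := by push_cast; exact hx3
      rw [Complex.norm_intCast] at h5
      have h6 : |(m' : ℤ) - m| < 1 := by exact_mod_cast h5
      rw [Int.abs_lt_one_iff] at h6
      omega
    subst h4
    exact ⟨a, ha⟩
  classical
  -- The roots are ordered by an arbitrary choice for each `x`, and `0` is a junk value where there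
  -- is no such factorization. Only sums over all roots are claimed to be analytic.
  set ρ : E → Fin m → ℂ := fun x =>
    if h : ∃ a : Fin m → ℂ, HasZeros (fun z => g (x, z)) r a then h.choose else 0 with hρ
  have hρz : ∀ᶠ x in 𝓝 (0 : E), HasZeros (fun z => g (x, z)) r (ρ x) := by
    filter_upwards [hcount] with x hx
    simp only [hρ, dif_pos hx]
    exact hx.choose_spec
  have hρ0 : ρ 0 = 0 := by
    have h0 := hρz.self_of_nhds
    ext j
    by_contra h
    have hj := Metric.ball_subset_closedBall (h0.1 j)
    exact (hrs _ hj).1 h ((h0.eq_zero_iff hj).2 ⟨j, rfl⟩)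
  refine ⟨r, hr, min_le_left _ _, m, ρ, ?_, hρ0, ?_, ?_, ?_⟩
  · rw [Metric.tendsto_nhds]
    intro ε hε
    have h1 := hN (Metric.closedBall 0 r \ Metric.ball 0 ε)
      ((isCompact_closedBall _ _).diff Metric.isOpen_ball) Set.sdiff_subset (by simp [hε])
    filter_upwards [h1, hρz] with x hx1 hx2
    rw [dist_pi_lt_iff hε]
    intro j
    by_contra h
    have hj := Metric.ball_subset_closedBall (hx2.1 j)
    exact hx1 _ ⟨hj, h⟩ ((hx2.eq_zero_iff hj).2 ⟨j, rfl⟩)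
  · filter_upwards [hρz] with x hx z hz
    exact hx.eq_zero_iff hz
  · intro u hu
    obtain ⟨I, hI, hIs⟩ := hint u hu
    refine hI.congr ?_
    filter_upwards [hIs, hρz] with x hx1 hx2
    exact (hx1 m _ hx2).symm
  · obtain ⟨-, e, he1, he2, he3⟩ := ha₀
    rw [hslice.analyticOrderAt_eq_natCast]
    refine ⟨e, he1 0 (by simp [hr.le]), he2 0 (by simp [hr.le]), Eventually.of_forall fun z => ?_⟩
    simpa [ha₀0] using he3 z

/-! ### Symmetric functions, the Newton polygon and Puiseux's theorem. -/

/-- Elementary symmetric functions are analytic as soon as the power sums are. -/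
theorem analyticAt_coeff_prod_of_powerSums {E : Type} [NormedAddCommGroup E] [NormedSpace ℂ E]
    {m : ℕ} {x : E → Fin m → ℂ} {z₀ : E}
    (h : ∀ k : ℕ, AnalyticAt ℂ (fun z => ∑ j, x z j ^ k) z₀) (q : ℕ) :
    AnalyticAt ℂ
      (fun z => (∏ j, (Polynomial.X - Polynomial.C (x z j))).coeff q) z₀ := by
  have hes : ∀ k, AnalyticAt ℂ
      (fun z => MvPolynomial.aeval (x z) (MvPolynomial.esymm (Fin m) ℂ k)) z₀ := by
    intro k
    induction k using Nat.strong_induction_on with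
    | _ k ih =>
      rcases Nat.eq_zero_or_pos k with rfl | hk
      · simpa using analyticAt_const
      -- Newton's identities, solved for the `k`-th elementary symmetric function by dividing by `k
      -- ≠ 0`.
      · have hN : ∀ z, MvPolynomial.aeval (x z) (MvPolynomial.esymm (Fin m) ℂ k) =
            (k : ℂ)⁻¹ * ((-1) ^ (k + 1) * ∑ a ∈ Finset.HasAntidiagonal.antidiagonal k with a.1 < k,
              (-1) ^ a.1 * MvPolynomial.aeval (x z) (MvPolynomial.esymm (Fin m) ℂ a.1) *
                ∑ j, x z j ^ a.2) := by
          intro z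
          have := congrArg (MvPolynomial.aeval (x z)) (MvPolynomial.mul_esymm_eq_sum (Fin m) ℂ k)
          simp only [map_mul, map_natCast, map_pow, map_neg, map_one, map_sum,
            MvPolynomial.psum, MvPolynomial.aeval_X] at this
          rw [← this, inv_mul_cancel_left₀ (by exact_mod_cast hk.ne')]
        refine AnalyticAt.congr ?_ (Eventually.of_forall fun z => (hN z).symm)
        refine analyticAt_const.mul (analyticAt_const.mul (Finset.analyticAt_fun_sum _ fun a ha => ?_))
        exact (analyticAt_const.mul (ih a.1 (Finset.mem_filter.1 ha).2)).mul (h a.2)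
  by_cases hq : q ≤ m
  · refine AnalyticAt.congr (analyticAt_const.mul (hes (m - q)) : AnalyticAt ℂ
      (fun z => (-1 : ℂ) ^ (m - q) * _) z₀) (Eventually.of_forall fun z => ?_)
    rw [Pi.mul_apply, MvPolynomial.aeval_esymm_eq_multiset_esymm]
    have := Multiset.prod_X_sub_C_coeff (Finset.univ.val.map (x z)) (k := q) (by simpa using hq)
    simp only [Multiset.map_map, Multiset.card_map, Finset.card_val, Finset.card_univ,
      Fintype.card_fin, Function.comp_def] at this
    rw [← this]
    rfl
  · refine AnalyticAt.congr (analyticAt_const (v := 0)) (Eventually.of_forall fun z => ?_)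
    symm
    refine Polynomial.coeff_eq_zero_of_natDegree_lt ?_
    rw [Polynomial.natDegree_prod_of_monic _ _ fun j _ => Polynomial.monic_X_sub_C _]
    simpa using hq

/-- A monic polynomial of degree `m` with vanishing subleading coefficient, other than `Xᵐ`, has
only roots of multiplicity less than `m`. -/
theorem exists_order_lt_of_isRoot {m : ℕ} (b : Fin m → ℂ) (hb : ∀ j : Fin m, j + 1 = m → b j = 0)
    (hb' : b ≠ 0) (w₀ : ℂ) : ∃ k < m,
      analyticOrderAt (fun w : ℂ => (w₀ + w) ^ m + ∑ j : Fin m, b j * (w₀ + w) ^ (j : ℕ)) 0 =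
        (k : ℕ) := by
  open Polynomial in
  set R : ℂ[X] := ∑ j : Fin m, C (b j) * X ^ (j : ℕ) with hR
  have hRd : R.degree < m := degree_sum_fin_lt b
  set Q : ℂ[X] := X ^ m + R with hQ
  have hQm : Q.Monic := monic_X_pow_add hRd
  have hQd : Q.natDegree = m := by
    rw [natDegree_eq_of_degree_eq_some]
    rw [hQ, degree_add_eq_left_of_degree_lt (by simpa using hRd), degree_X_pow]
  obtain ⟨P, hP1, hP2⟩ := exists_eq_pow_rootMultiplicity_mul_and_not_dvd Q hQm.ne_zero w₀
  set k := Q.rootMultiplicity w₀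
  have hPm : P.Monic := by
    have := hQm
    rw [hP1] at this
    exact Monic.of_mul_monic_left ((monic_X_sub_C w₀).pow k) this
  have hdeg : m = k + P.natDegree := by
    rw [← hQd]
    conv_lhs => rw [hP1]
    rw [((monic_X_sub_C w₀).pow k).natDegree_mul hPm, (monic_X_sub_C w₀).natDegree_pow]
    simp
  have hcoeff : ∀ j : Fin m, Q.coeff j = b j := by
    intro j
    rw [hQ, hR, coeff_add, coeff_X_pow, if_neg j.2.ne, zero_add, finsetSum_coeff]
    simp only [coeff_C_mul_X_pow]
    rw [Finset.sum_eq_single j]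
    · simp
    · intro i _ hij
      rw [if_neg fun h => hij (Fin.ext h.symm)]
    · simp
  refine ⟨k, ?_, ?_⟩
  · rcases lt_or_ge k m with h | h
    · exact h
    -- Multiplicity `m` would mean `Q = (X - w₀)ᵐ`; its subleading coefficient `-m w₀` vanishes, so
    -- `w₀ = 0` and all `b j` are zero.
    · exfalso
      have hP0 : P = 1 := hPm.natDegree_eq_zero.1 (by omega)
      have hkm : k = m := by rw [hP0] at hdeg; simpa using hdeg.symm
      rw [hP0, mul_one, hkm] at hP1
      have hm : m ≠ 0 := by
        rintro rfl
        exact hb' (Subsingleton.elim _ _)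
      have hw : w₀ = 0 := by
        have h1 := hb ⟨m - 1, by omega⟩ (by simp; omega)
        rw [← hcoeff, hP1] at h1
        have h2 := (monic_X_sub_C w₀).nextCoeff_pow m
        rw [nextCoeff_of_natDegree_pos (by rw [(monic_X_sub_C w₀).natDegree_pow]; simp; omega),
          (monic_X_sub_C w₀).natDegree_pow, natDegree_X_sub_C, mul_one] at h2
        simp only at h1
        rw [h1, nextCoeff_X_sub_C] at h2
        simpa [hm] using h2.symm
      apply hb'
      ext j
      rw [← hcoeff, hP1, hw]
      simp [coeff_X_pow, j.2.ne]
  · have hev : ∀ w, (w₀ + w) ^ m + ∑ j : Fin m, b j * (w₀ + w) ^ (j : ℕ) = Q.eval (w₀ + w) := by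
      intro w
      rw [hQ, hR]
      simp [eval_finsetSum]
    have han : ∀ S : ℂ[X], AnalyticAt ℂ (fun w => S.eval (w₀ + w)) 0 := fun S =>
      (S.differentiable.comp (by fun_prop : Differentiable ℂ fun w => w₀ + w)).analyticAt 0
    simp only [hev]
    rw [(han Q).analyticOrderAt_eq_natCast]
    refine ⟨fun w => P.eval (w₀ + w), han P, ?_, Eventually.of_forall fun w => ?_⟩
    · simpa [dvd_iff_isRoot] using hP2
    · conv_lhs => rw [hP1]
      simp

/-- For `‖w‖ > 1` the lower terms are at most `(∑ ‖b j‖) ‖w‖ᵐ⁻¹`. The bound confines the roots of a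
family to one compact disc. -/
theorem norm_le_of_monic_eq_zero {m : ℕ} {b : Fin m → ℂ} {w : ℂ}
    (h : w ^ m + ∑ j : Fin m, b j * w ^ (j : ℕ) = 0) : ‖w‖ ≤ max 1 (∑ j, ‖b j‖) := by
  by_contra hlt
  rw [not_le, max_lt_iff] at hlt
  obtain ⟨h1, h2⟩ := hlt
  rcases Nat.eq_zero_or_pos m with rfl | hm
  · simp at h
  have h3 : ‖w‖ ^ m ≤ (∑ j, ‖b j‖) * ‖w‖ ^ (m - 1) := by
    have e : w ^ m = - ∑ j : Fin m, b j * w ^ (j : ℕ) := eq_neg_of_add_eq_zero_left h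
    rw [← norm_pow, e, norm_neg, Finset.sum_mul]
    refine norm_sum_le_of_le _ fun j _ => ?_
    rw [norm_mul, norm_pow]
    exact mul_le_mul_of_nonneg_left (pow_le_pow_right₀ h1.le (by omega)) (norm_nonneg _)
  have h4 : 0 < ‖w‖ ^ (m - 1) := by positivity
  have h5 : ‖w‖ ^ m = ‖w‖ * ‖w‖ ^ (m - 1) := by
    rw [← pow_succ']
    congr 1
    omega
  rw [h5] at h3
  exact absurd (le_of_mul_le_mul_right h3 h4) (not_le.2 h2)

/-- The finitely many analytic functions in `L` parametrise, after the ramification `t = sᴺ`,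
all zeros of `q` near the origin. -/
def IsPuiseuxCover (q : ℂ × ℂ → ℂ) (N : ℕ) (L : Set (ℂ → ℂ)) : Prop :=
  L.Finite ∧ (∀ ρ ∈ L, AnalyticAt ℂ ρ 0) ∧
    ∀ᶠ p : ℂ × ℂ in 𝓝 0, q (p.1 ^ N, p.2) = 0 → ∃ ρ ∈ L, p.2 = ρ p.1

theorem tendsto_pow_nhds_zero {N : ℕ} (hN : N ≠ 0) :
    Tendsto (fun s : ℂ => s ^ N) (𝓝 0) (𝓝 0) :=
  (continuous_pow N).tendsto' 0 0 (zero_pow hN)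

theorem AnalyticAt.comp_pow {f : ℂ → ℂ} (hf : AnalyticAt ℂ f 0) {N : ℕ} (hN : N ≠ 0) :
    AnalyticAt ℂ (fun s => f (s ^ N)) 0 :=
  AnalyticAt.comp_of_eq (f := fun s : ℂ => s ^ N) hf (by fun_prop) (zero_pow hN)

/-- A Puiseux cover of all roots of a monic polynomial, from Puiseux covers at the roots of its
specialisation. -/
theorem exists_cover_of_monic {m : ℕ} {b : Fin m → ℂ → ℂ} (hb : ∀ j, AnalyticAt ℂ (b j) 0)
    (hloc : ∀ w₀ : ℂ, ∃ N ≠ 0, ∃ L, IsPuiseuxCover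
      (fun p => (w₀ + p.2) ^ m + ∑ j : Fin m, b j p.1 * (w₀ + p.2) ^ (j : ℕ)) N L) :
    ∃ N ≠ 0, ∃ L : Set (ℂ → ℂ), L.Finite ∧ (∀ ρ ∈ L, AnalyticAt ℂ ρ 0) ∧
      ∀ᶠ s in 𝓝 (0 : ℂ), ∀ w, w ^ m + ∑ j : Fin m, b j (s ^ N) * w ^ (j : ℕ) = 0 →
        ∃ ρ ∈ L, w = ρ s := by
  choose N₀ hN₀ L₀ hL₀ using hloc
  -- a compact set containing all the roots
  set M : ℝ := max 1 ((∑ j, ‖b j 0‖) + 1) with hM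
  have hbd : ∀ᶠ t in 𝓝 (0 : ℂ), ∑ j, ‖b j t‖ < (∑ j, ‖b j 0‖) + 1 := by
    have : Tendsto (fun t => ∑ j, ‖b j t‖) (𝓝 0) (𝓝 (∑ j, ‖b j 0‖)) :=
      tendsto_finsetSum _ fun j _ => (hb j).continuousAt.tendsto.norm
    exact this.eventually_lt_const (by linarith)
  -- finitely many local covers suffice
  have hnear : ∀ w₀ : ℂ, ∃ V ∈ 𝓝 w₀, ∀ᶠ s in 𝓝 (0 : ℂ), ∀ w ∈ V,
      w ^ m + ∑ j : Fin m, b j (s ^ N₀ w₀) * w ^ (j : ℕ) = 0 → ∃ ρ ∈ L₀ w₀, w = w₀ + ρ s := by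
    intro w₀
    have h1 := (hL₀ w₀).2.2
    rw [← Prod.mk_zero_zero, nhds_prod_eq] at h1
    obtain ⟨pa, ha, pb, hb', hab⟩ := eventually_prod_iff.1 h1
    have h2 : Tendsto (fun w => w - w₀) (𝓝 w₀) (𝓝 0) :=
      Continuous.tendsto' (by fun_prop) _ _ (sub_self _)
    refine ⟨{w | pb (w - w₀)}, h2.eventually hb', ?_⟩
    filter_upwards [ha] with s hs w hw h0
    obtain ⟨ρ, hρ, e⟩ := hab hs hw (by simpa using h0)
    exact ⟨ρ, hρ, by rw [← e]; ring⟩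
  choose V hV hVs using hnear
  obtain ⟨T, -, hT⟩ := (isCompact_closedBall (0 : ℂ) M).elim_nhds_subcover V fun w _ => hV w
  -- A common ramification index: the local cover at `w`, with index `N₀ w`, is pulled back by `s ↦
  -- s ^ K w` where `N = K w * N₀ w`.
  set N := ∏ w ∈ T, N₀ w with hN
  have hN0 : N ≠ 0 := Finset.prod_ne_zero_iff.2 fun w _ => hN₀ w
  have hdvd : ∀ w ∈ T, ∃ K ≠ 0, N = K * N₀ w := by
    intro w hw
    obtain ⟨K, hK⟩ := Finset.dvd_prod_of_mem N₀ hw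
    refine ⟨K, ?_, by rw [hN, hK, mul_comm]⟩
    rintro rfl
    exact hN0 (by rw [hN, hK, mul_zero])
  choose! K hK0 hK using hdvd
  refine ⟨N, hN0, ⋃ w ∈ T, (fun (ρ : ℂ → ℂ) s => w + ρ (s ^ K w)) '' L₀ w, ?_, ?_, ?_⟩
  · exact T.finite_toSet.biUnion fun w _ => (hL₀ w).1.image _
  · intro σ hσ
    simp only [Set.mem_iUnion] at hσ
    obtain ⟨w, hw, ρ, hρ, rfl⟩ := hσ
    exact analyticAt_const.add (((hL₀ w).2.1 ρ hρ).comp_pow (hK0 w hw))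
  · have h1 : ∀ᶠ s in 𝓝 (0 : ℂ), ∀ w₀ ∈ T, ∀ w ∈ V w₀,
        w ^ m + ∑ j : Fin m, b j (s ^ N) * w ^ (j : ℕ) = 0 → ∃ ρ ∈ L₀ w₀, w = w₀ + ρ (s ^ K w₀) := by
      rw [Finset.eventually_all]
      intro w₀ hw₀
      filter_upwards [(tendsto_pow_nhds_zero (hK0 w₀ hw₀)).eventually (hVs w₀)] with s hs w hw h0
      refine hs w hw ?_
      rw [← h0, hK w₀ hw₀, pow_mul]
    filter_upwards [h1, (tendsto_pow_nhds_zero hN0).eventually hbd] with s hs1 hs2 w h0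
    have hw : w ∈ Metric.closedBall (0 : ℂ) M := by
      rw [mem_closedBall_zero_iff]
      exact (norm_le_of_monic_eq_zero h0).trans (max_le_max le_rfl hs2.le)
    obtain ⟨w₀, hw₀, hwV⟩ := Set.mem_iUnion₂.1 (hT hw)
    obtain ⟨ρ, hρ, e⟩ := hs1 w₀ hw₀ w hwV h0
    exact ⟨_, Set.mem_iUnion₂.2 ⟨w₀, hw₀, ρ, hρ, rfl⟩, e⟩

/-- Rescaling a monic polynomial with analytic coefficients along the first slope of its Newton
polygon. -/
theorem exists_newton_slope {m : ℕ} {A : Fin m → ℂ → ℂ} (hA : ∀ j, AnalyticAt ℂ (A j) 0)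
    (hA0 : ∀ j, A j 0 = 0) (hne : ∃ j, ¬ ∀ᶠ t in 𝓝 0, A j t = 0) :
    ∃ K ≠ 0, ∃ p ≠ 0, ∃ b : Fin m → ℂ → ℂ, (∀ j, AnalyticAt ℂ (b j) 0) ∧ (∃ j, b j 0 ≠ 0) ∧
      (∀ j, (∀ᶠ t in 𝓝 0, A j t = 0) → b j 0 = 0) ∧
      ∀ᶠ s in 𝓝 (0 : ℂ), ∀ j : Fin m, A j (s ^ K) = s ^ (p * (m - j)) * b j s := by
  classical
  have hfac : ∀ j, ¬ (∀ᶠ t in 𝓝 0, A j t = 0) → ∃ (o : ℕ) (B : ℂ → ℂ), AnalyticAt ℂ B 0 ∧ B 0 ≠ 0 ∧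
      ∀ᶠ t in 𝓝 (0 : ℂ), A j t = t ^ o * B t := by
    intro j hj
    obtain ⟨o, B, h1, h2, h3⟩ := (hA j).exists_eventuallyEq_pow_smul_nonzero_iff.2 hj
    exact ⟨o, B, h1, h2, by simpa using h3⟩
  choose! o B hB hB0 hAB using hfac
  set S : Finset (Fin m) := Finset.univ.filter fun j => ¬ ∀ᶠ t in 𝓝 0, A j t = 0 with hS
  have hmS : ∀ j, j ∈ S ↔ ¬ ∀ᶠ t in 𝓝 0, A j t = 0 := by simp [hS]
  -- The smallest ratio of vanishing order to `m - j` is the slope `p / K`, with `p = o j₀` and `K =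
  -- m - j₀` (not necessarily reduced). After `t = s ^ K`, each `A j` is divisible by `s ^ (p * (m -
  -- j))`, with nonzero quotient at `0` for `j = j₀`.
  obtain ⟨j₀, hj₀, hmin⟩ := S.exists_min_image (fun j => (o j : ℚ) / (m - (j : ℕ) : ℕ))
    (by obtain ⟨j, hj⟩ := hne; exact ⟨j, (hmS j).2 hj⟩)
  have hpos : ∀ j : Fin m, 0 < m - (j : ℕ) := fun j => by omega
  have hslope : ∀ j ∈ S, o j₀ * (m - j) ≤ o j * (m - j₀) := by
    intro j hj
    have := hmin j hj
    rw [div_le_div_iff₀ (by exact_mod_cast hpos _) (by exact_mod_cast hpos _)] at this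
    exact_mod_cast this
  set K := m - (j₀ : ℕ) with hK
  have hK0 : K ≠ 0 := (hpos j₀).ne'
  refine ⟨K, hK0, o j₀, ?_, fun j s => if j ∈ S then
    s ^ (o j * K - o j₀ * (m - j)) * B j (s ^ K) else 0, ?_, ⟨j₀, ?_⟩, ?_, ?_⟩
  · intro h
    have h1 := (hAB j₀ ((hmS _).1 hj₀)).self_of_nhds
    rw [hA0, h, pow_zero, one_mul] at h1
    exact hB0 j₀ ((hmS _).1 hj₀) h1.symm
  · intro j
    by_cases h : j ∈ S
    · simp only [h, if_true]
      exact (by fun_prop : AnalyticAt ℂ (fun s : ℂ => s ^ (o j * K - o j₀ * (m - j))) 0).mul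
        ((hB j ((hmS _).1 h)).comp_pow hK0)
    · simp only [h, if_false]
      exact analyticAt_const
  · simp only [hj₀, if_true, zero_pow hK0]
    rw [← hK, Nat.sub_self, pow_zero, one_mul]
    exact hB0 j₀ ((hmS _).1 hj₀)
  · intro j hj
    have : j ∉ S := fun h => (hmS j).1 h hj
    simp [this]
  · rw [eventually_all]
    intro j
    by_cases h : j ∈ S
    · filter_upwards [(tendsto_pow_nhds_zero hK0).eventually (hAB j ((hmS _).1 h))] with s hs
      simp only [h, if_true]
      rw [hs, ← mul_assoc, ← pow_add, ← pow_mul, mul_comm K, Nat.add_sub_cancel' (hslope j h)]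
    · have h1 : ∀ᶠ t in 𝓝 0, A j t = 0 := by
        by_contra h2
        exact h ((hmS j).2 h2)
      filter_upwards [(tendsto_pow_nhds_zero hK0).eventually h1] with s hs
      simp [h, hs]

/-- **Puiseux's theorem**: after a ramification, the zeros near the origin of a holomorphic function
`q (t, z)` with `q (0, ·) ≢ 0` lie on finitely many graphs of holomorphic functions. -/
theorem exists_isPuiseuxCover (m : ℕ) : ∀ {q : ℂ × ℂ → ℂ}, AnalyticAt ℂ q 0 →
    analyticOrderAt (fun z => q (0, z)) 0 = m → ∃ N ≠ 0, ∃ L, IsPuiseuxCover q N L := by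
  induction m using Nat.strong_induction_on with
  | _ m ih =>
  intro q hq hm
  have hq0 : ¬ ∀ᶠ z in 𝓝 (0 : ℂ), q (0, z) = 0 := by
    rw [← analyticOrderAt_eq_top, hm]
    exact ENat.natCast_ne_top m
  obtain ⟨r, hr, -, m', ρ, hρt, hρ0, hρz, hρu, hm'⟩ := exists_weierstrass_roots hq hq0 one_pos
  obtain rfl : m' = m := by
    rw [hm] at hm'
    exact_mod_cast hm'.symm
  rcases Nat.eq_zero_or_pos m' with rfl | hmpos
  · refine ⟨1, one_ne_zero, ∅, Set.finite_empty, by simp, ?_⟩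
    have h1 := (continuous_fst.tendsto' (0 : ℂ × ℂ) 0 rfl).eventually hρz
    have h2 := (continuous_snd.tendsto' (0 : ℂ × ℂ) 0 rfl).eventually
      (Metric.closedBall_mem_nhds (0 : ℂ) hr)
    filter_upwards [h1, h2] with p hp1 hp2 h0
    obtain ⟨j, -⟩ := (hp1 p.2 hp2).1 (by simpa using h0)
    exact j.elim0
  have hm0 : (m' : ℂ) ≠ 0 := by exact_mod_cast hmpos.ne'
  -- the barycentre of the roots
  set c : ℂ → ℂ := fun t => (m' : ℂ)⁻¹ * ∑ j, ρ t j with hc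
  have hca : AnalyticAt ℂ c 0 := analyticAt_const.mul (hρu (fun p => p.2) fun z _ => analyticAt_snd)
  have hc0 : c 0 = 0 := by simp [hc, hρ0]
  -- Centring the roots at their barycentre kills the subleading coefficient. This forces roots of
  -- multiplicity less than `m'` after rescaling, so that the induction on the order proceeds.
  set P : ℂ → Polynomial ℂ := fun t => ∏ j, (Polynomial.X - Polynomial.C (ρ t j - c t)) with hP
  have hPa : ∀ k, AnalyticAt ℂ (fun t => (P t).coeff k) 0 :=
    analyticAt_coeff_prod_of_powerSums (x := fun t j => ρ t j - c t) fun k =>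
      hρu (fun p => (p.2 - c p.1) ^ k) fun z _ =>
        (analyticAt_snd.sub (hca.comp_of_eq analyticAt_fst rfl)).pow k
  have hPd : ∀ t, (P t).natDegree = m' := by
    intro t
    rw [hP, Polynomial.natDegree_prod_of_monic _ _ fun j _ => Polynomial.monic_X_sub_C _]
    simp only [Polynomial.natDegree_X_sub_C]
    simp
  have hPm : ∀ t, (P t).Monic := fun t =>
    Polynomial.monic_prod_of_monic _ _ fun j _ => Polynomial.monic_X_sub_C _
  set A : Fin m' → ℂ → ℂ := fun j t => (P t).coeff j with hA
  have hA0 : ∀ j, A j 0 = 0 := by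
    intro j
    simp [hA, hP, hρ0, hc0, Polynomial.coeff_X_pow, j.2.ne]
  have hAlast : ∀ j : Fin m', j + 1 = m' → ∀ t, A j t = 0 := by
    intro j hj t
    have h1 := Polynomial.prod_X_sub_C_coeff_card_pred (Finset.univ : Finset (Fin m'))
      (fun j => ρ t j - c t) (by simpa using hmpos)
    have h2 : (j : ℕ) = (Finset.univ : Finset (Fin m')).card - 1 := by simp; omega
    simp only [hA, hP]
    rw [h2, h1]
    simp only [Finset.sum_sub_distrib, Finset.sum_const, Finset.card_univ, Fintype.card_fin,
      nsmul_eq_mul, hc]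
    rw [mul_inv_cancel_left₀ hm0]
    simp
  have hroot : ∀ᶠ p : ℂ × ℂ in 𝓝 0, q p = 0 →
      (p.2 - c p.1) ^ m' + ∑ j : Fin m', A j p.1 * (p.2 - c p.1) ^ (j : ℕ) = 0 := by
    have h1 := (continuous_fst.tendsto' (0 : ℂ × ℂ) 0 rfl).eventually hρz
    have h2 := (continuous_snd.tendsto' (0 : ℂ × ℂ) 0 rfl).eventually
      (Metric.closedBall_mem_nhds (0 : ℂ) hr)
    filter_upwards [h1, h2] with p hp1 hp2 h0
    obtain ⟨j, hj⟩ := (hp1 p.2 hp2).1 h0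
    have h3 : (P p.1).eval (p.2 - c p.1) = 0 := by
      simp only [hP, Polynomial.eval_prod]
      exact Finset.prod_eq_zero (Finset.mem_univ j) (by simp [hj])
    rw [Polynomial.eval_eq_sum_range, hPd, Finset.sum_range_succ] at h3
    have h4 : (P p.1).coeff m' = 1 := by
      have := hPm p.1
      rwa [Polynomial.Monic, Polynomial.leadingCoeff, hPd] at this
    rw [h4, one_mul, Finset.sum_range, add_comm] at h3
    exact h3
  by_cases hall : ∀ j, ∀ᶠ t in 𝓝 0, A j t = 0
  · refine ⟨1, one_ne_zero, {c}, Set.finite_singleton _, by simpa using hca, ?_⟩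
    have h1 := (continuous_fst.tendsto' (0 : ℂ × ℂ) 0 rfl).eventually (eventually_all.2 hall)
    filter_upwards [hroot, h1] with p hp1 hp2 h0
    have := hp1 (by simpa using h0)
    simp only [hp2, zero_mul, Finset.sum_const_zero, add_zero] at this
    exact ⟨c, rfl, sub_eq_zero.1 (pow_eq_zero_iff hmpos.ne' |>.1 this)⟩
  · push Not at hall
    obtain ⟨K, hK, p, hp, b, hb, ⟨j₁, hj₁⟩, hbz, hAb⟩ := exists_newton_slope (A := A)
      (fun j => hPa j) hA0 (by simpa [not_eventually] using hall)
    -- The rescaled polynomial has a nonzero lower coefficient and no subleading one at `0`, so at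
    -- every `w₀` its order is less than `m'` and the induction hypothesis applies.
    obtain ⟨N, hN, L, hL1, hL2, hL3⟩ := exists_cover_of_monic hb (fun w₀ => by
      obtain ⟨k, hk, hord⟩ := exists_order_lt_of_isRoot (fun j => b j 0)
        (fun j hj => hbz j (Eventually.of_forall (hAlast j hj)))
        (fun h => hj₁ (congrFun h j₁)) w₀
      refine ih k hk ?_ hord
      refine AnalyticAt.add ((analyticAt_const.add analyticAt_snd).pow _) (Finset.analyticAt_fun_sum _ fun j _ => ?_)
      exact AnalyticAt.mul ((hb j).comp_of_eq analyticAt_fst rfl)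
        ((analyticAt_const.add analyticAt_snd).pow _))
    refine ⟨N * K, mul_ne_zero hN hK, insert (fun s => c (s ^ (N * K)))
      ((fun (σ : ℂ → ℂ) s => c (s ^ (N * K)) + (s ^ N) ^ p * σ s) '' L), (hL1.image _).insert _, ?_, ?_⟩
    · rintro σ (rfl | ⟨σ, hσ, rfl⟩)
      · exact hca.comp_pow (mul_ne_zero hN hK)
      · exact (hca.comp_pow (mul_ne_zero hN hK)).add (AnalyticAt.mul (by fun_prop) (hL2 σ hσ))
    · have t1 : Tendsto (fun x : ℂ × ℂ => (x.1 ^ (N * K), x.2)) (𝓝 0) (𝓝 0) :=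
        Continuous.tendsto' (by fun_prop) _ _ (by simp [hN, hK])
      have t2 : Tendsto (fun x : ℂ × ℂ => x.1 ^ N) (𝓝 0) (𝓝 0) :=
        Continuous.tendsto' (by fun_prop) _ _ (by simp [hN])
      have t3 : Tendsto (fun x : ℂ × ℂ => x.1) (𝓝 0) (𝓝 0) := continuous_fst.tendsto' _ _ rfl
      filter_upwards [t1.eventually hroot, t2.eventually hAb, t3.eventually hL3] with x hx1 hx2 hx3 h0
      have h1 := hx1 h0
      rw [pow_mul] at h1
      -- Over `0` the rescaling cannot be undone by division; the only root there is `c`, which is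
      -- why the curve of barycentres was added to the cover.
      by_cases hx : x.1 ^ N = 0
      · refine ⟨_, Set.mem_insert _ _, ?_⟩
        simp only [pow_mul, hx, zero_pow hK, hA0] at h1 ⊢
        simpa [hmpos.ne', sub_eq_zero] using h1
      · have hsp : (x.1 ^ N) ^ p ≠ 0 := pow_ne_zero _ hx
        set σ := x.1 ^ N with hσ
        set w := x.2 - c (σ ^ K) with hw
        have h2 : (w / σ ^ p) ^ m' + ∑ j : Fin m', b j σ * (w / σ ^ p) ^ (j : ℕ) = 0 := by
          have h3 : (σ ^ p) ^ m' * ((w / σ ^ p) ^ m' + ∑ j : Fin m', b j σ * (w / σ ^ p) ^ (j : ℕ)) = 0 := by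
            rw [← h1, mul_add, Finset.mul_sum, ← mul_pow, mul_div_cancel₀ _ hsp]
            congr 1
            refine Finset.sum_congr rfl fun j _ => ?_
            rw [hx2 j, div_pow, pow_mul]
            have : (σ ^ p) ^ m' = (σ ^ p) ^ (m' - (j : ℕ)) * (σ ^ p) ^ (j : ℕ) := by
              rw [← pow_add, Nat.sub_add_cancel j.2.le]
            rw [this]
            field_simp
          exact (mul_eq_zero.1 h3).resolve_left (pow_ne_zero _ hsp)
        obtain ⟨τ, hτ, e⟩ := hx3 _ h2
        refine ⟨_, Set.mem_insert_of_mem _ ⟨τ, hτ, rfl⟩, ?_⟩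
        simp only [pow_mul, ← hσ]
        rw [← e, mul_div_cancel₀ _ hsp, hw]
        ring

/-! ### The curve selection lemma. -/

/-- Finitely many linear forms suffice to separate any `m` vectors from zero simultaneously. -/
theorem exists_generic_forms (J : Type) [Fintype J] (m : ℕ) : ∃ T : Finset (J → ℂ),
    ∀ w : Fin m → J → ℂ, ∃ σ ∈ T, ∀ j, w j ≠ 0 → ∑ i, σ i * w j i ≠ 0 := by
  classical
  open Polynomial in
  let e := Fintype.equivFin J
  -- The forms are points of the moment curve. A nonzero `w j` is a nonzero polynomial in the
  -- parameter, of degree at most `card J`, so the product over `j` cannot vanish at `m * card J +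
  -- 1` parameters.
  set s : Finset ℂ := (Finset.range (m * Fintype.card J + 1)).image (fun k : ℕ => (k : ℂ)) with hs
  have hsc : s.card = m * Fintype.card J + 1 := by
    rw [hs, Finset.card_image_of_injective _ Nat.cast_injective, Finset.card_range]
  refine ⟨s.image fun a i => a ^ (e i : ℕ), fun w => ?_⟩
  set p : Fin m → ℂ[X] := fun j => ∑ i, C (w j i) * X ^ (e i : ℕ) with hp
  have hpc : ∀ j i, (p j).coeff (e i) = w j i := by
    intro j i
    rw [hp, finsetSum_coeff, Finset.sum_eq_single i]
    · simp
    · intro i' _ h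
      rw [coeff_C_mul_X_pow, if_neg]
      intro h'
      exact h (e.injective (Fin.ext h'.symm))
    · simp
  have hpd : ∀ j, (p j).natDegree ≤ Fintype.card J := fun j =>
    natDegree_sum_le_of_forall_le _ _ fun i _ => (natDegree_C_mul_X_pow_le _ _).trans (e i).2.le
  set Q : ℂ[X] := ∏ j with w j ≠ 0, p j with hQ
  have hQ0 : Q ≠ 0 := by
    refine Finset.prod_ne_zero_iff.2 fun j hj h0 => (Finset.mem_filter.1 hj).2 ?_
    ext i
    rw [← hpc, h0]
    simp
  have hQd : Q.natDegree ≤ m * Fintype.card J := by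
    refine (natDegree_prod_le _ _).trans ((Finset.sum_le_card_nsmul _ _ _ fun j _ => hpd j).trans ?_)
    rw [smul_eq_mul]
    refine Nat.mul_le_mul_right _ ((Finset.card_filter_le _ _).trans ?_)
    simp
  obtain ⟨a, ha, hQa⟩ : ∃ a ∈ s, Q.eval a ≠ 0 := by
    by_contra! h
    exact hQ0 (eq_zero_of_natDegree_lt_card_of_eval_eq_zero' Q s h (by omega))
  refine ⟨_, Finset.mem_image_of_mem _ ha, fun j hj h0 => hQa ?_⟩
  rw [hQ, eval_prod]
  refine Finset.prod_eq_zero (Finset.mem_filter.2 ⟨Finset.mem_univ j, hj⟩) ?_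
  rw [← h0, hp]
  simp only [eval_finsetSum, eval_mul, eval_C, eval_pow, eval_X]
  exact Finset.sum_congr rfl fun i _ => mul_comm _ _

-- The number of vanishing `y j` is the exact power of `X` dividing `∏ (X - y j)`, and divisibility
-- by `X ^ p` is the vanishing of the coefficients below `p`.
open Classical in
theorem le_card_zeros_iff {m : ℕ} (y : Fin m → ℂ) (p : ℕ) :
    p ≤ (Finset.univ.filter fun j => y j = 0).card ↔
      ∀ q < p, (∏ j, (Polynomial.X - Polynomial.C (y j))).coeff q = 0 := by
  open Polynomial in
  have hsplit : ∏ j, (X - C (y j)) = X ^ (Finset.univ.filter fun j => y j = 0).card *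
      ∏ j with ¬ y j = 0, (X - C (y j)) := by
    rw [← Finset.prod_filter_mul_prod_filter_not _ (fun j => y j = 0)]
    congr 1
    rw [← Finset.prod_const]
    refine Finset.prod_congr rfl fun j hj => ?_
    simp [(Finset.mem_filter.1 hj).2]
  rw [← X_pow_dvd_iff, hsplit]
  refine ⟨fun h => (pow_dvd_pow X h).mul_right _, fun h => ?_⟩
  by_contra hlt
  rw [not_le] at hlt
  have h1 : X ^ ((Finset.univ.filter fun j => y j = 0).card + 1) ∣
      X ^ (Finset.univ.filter fun j => y j = 0).card * ∏ j with ¬ y j = 0, (X - C (y j)) :=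
    (pow_dvd_pow X hlt).trans h
  rw [pow_succ, mul_dvd_mul_iff_left (pow_ne_zero _ X_ne_zero), X_dvd_iff, coeff_zero_eq_eval_zero,
    eval_prod, Finset.prod_eq_zero_iff] at h1
  obtain ⟨j, hj, h0⟩ := h1
  exact (Finset.mem_filter.1 hj).2 (by simpa using h0)

open Classical in
/-- The number of zero vectors in a family of `m` vectors is detected by symmetric functions. -/
theorem exists_forms_le_card_zeros_iff (J : Type) [Fintype J] (m : ℕ) : ∃ T : Finset (J → ℂ),
    ∀ (w : Fin m → J → ℂ) (p : ℕ), p ≤ (Finset.univ.filter fun j => w j = 0).card ↔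
      ∀ σ ∈ T, ∀ q < p,
        (∏ j, (Polynomial.X - Polynomial.C (∑ i, σ i * w j i))).coeff q = 0 := by
  obtain ⟨T, hT⟩ := exists_generic_forms J m
  refine ⟨T, fun w p => ⟨fun h σ _ => ?_, fun h => ?_⟩⟩
  · rw [← le_card_zeros_iff]
    refine h.trans (Finset.card_le_card fun j hj => ?_)
    rw [Finset.mem_filter] at hj ⊢
    exact ⟨hj.1, by simp [hj.2]⟩
  · obtain ⟨σ, hσ, hσw⟩ := hT w
    refine ((le_card_zeros_iff _ _).2 (h σ hσ)).trans (Finset.card_le_card fun j hj => ?_)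
    rw [Finset.mem_filter] at hj ⊢
    refine ⟨hj.1, ?_⟩
    by_contra h0
    exact hσw j h0 hj.2

/-- The identity theorem is applied on each complex line, in the convex set of parameters that stay
in a ball of analyticity. -/
theorem eventually_eq_zero_of_lines {E : Type} [NormedAddCommGroup E] [NormedSpace ℂ E]
    {g : E → ℂ} (hg : AnalyticAt ℂ g 0) (h : ∀ v : E, ∀ᶠ t in 𝓝 (0 : ℂ), g (t • v) = 0) :
    ∀ᶠ z in 𝓝 0, g z = 0 := by
  obtain ⟨r, hr, hrs⟩ := Metric.eventually_nhds_iff_ball.1 hg.eventually_analyticAt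
  filter_upwards [Metric.ball_mem_nhds 0 hr] with z hz
  have hz' : ‖z‖ < r := by simpa using hz
  set U : Set ℂ := {t | t • z ∈ Metric.ball (0 : E) r} with hU
  have hconv : Convex ℝ U := by
    intro a ha b hb s t hs ht hst
    have h1 := (convex_ball (0 : E) r) ha hb hs ht hst
    have h2 : (s • a + t • b) • z = s • (a • z) + t • (b • z) := by
      rw [add_smul, smul_assoc, smul_assoc]
    show (s • a + t • b) • z ∈ Metric.ball (0 : E) r
    rw [h2]
    exact h1
  have hf : AnalyticOnNhd ℂ (fun t : ℂ => g (t • z)) U := fun t ht =>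
    AnalyticAt.comp (g := g) (f := fun t : ℂ => t • z) (hrs _ ht) (by fun_prop)
  have h0 : (0 : ℂ) ∈ U := by simp [hU, hr]
  have h1 : (1 : ℂ) ∈ U := by simpa [hU] using hz'
  simpa using hf.eqOn_zero_of_preconnected_of_eventuallyEq_zero hconv.isPreconnected h0 (h z) h1

/-- Lifting curves along a finite projection: the inductive step of the curve selection lemma. -/
theorem curve_selection_prod {E : Type} [NormedAddCommGroup E] [NormedSpace ℂ E]
    [FiniteDimensional ℂ E]
    (ih : ∀ {I : Type} [Fintype I] {g : I → E → ℂ} {H : E → ℂ}, (∀ i, AnalyticAt ℂ (g i) 0) →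
      AnalyticAt ℂ H 0 → (∃ᶠ z in 𝓝 0, (∀ i, g i z = 0) ∧ H z ≠ 0) →
      ∃ γ : ℂ → E, AnalyticAt ℂ γ 0 ∧ γ 0 = 0 ∧ (∀ᶠ t in 𝓝 0, ∀ i, g i (γ t) = 0) ∧
        ¬ ∀ᶠ t in 𝓝 0, H (γ t) = 0)
    {I : Type} [Fintype I] {g : I → E × ℂ → ℂ} {H : E × ℂ → ℂ} (hg : ∀ i, AnalyticAt ℂ (g i) 0)
    (hH : AnalyticAt ℂ H 0) (hf : ∃ᶠ z in 𝓝 0, (∀ i, g i z = 0) ∧ H z ≠ 0) {i₀ : I}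
    (hi₀ : ¬ ∀ᶠ z in 𝓝 (0 : ℂ), g i₀ (0, z) = 0) :
    ∃ γ : ℂ → E × ℂ, AnalyticAt ℂ γ 0 ∧ γ 0 = 0 ∧ (∀ᶠ t in 𝓝 0, ∀ i, g i (γ t) = 0) ∧
        ¬ ∀ᶠ t in 𝓝 0, H (γ t) = 0 := by
  classical
  have han : ∀ᶠ z in 𝓝 (0 : ℂ), (∀ i, AnalyticAt ℂ (g i) (0, z)) ∧ AnalyticAt ℂ H (0, z) := by
    have h1 : Continuous fun z : ℂ => ((0 : E), z) := by fun_prop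
    exact (h1.tendsto' 0 0 rfl).eventually
      ((eventually_all.2 fun i => (hg i).eventually_analyticAt).and hH.eventually_analyticAt)
  obtain ⟨r₀, hr₀, hr₀s⟩ := Metric.nhds_basis_closedBall.mem_iff.1 han
  obtain ⟨r, hr, hrr₀, m, ρ, hρt, hρ0, hρz, hρu, hord⟩ := exists_weierstrass_roots (hg i₀) hi₀ hr₀
  have hrs : ∀ z ∈ Metric.closedBall (0 : ℂ) r,
      (∀ i, AnalyticAt ℂ (g i) (0, z)) ∧ AnalyticAt ℂ H (0, z) :=
    fun z hz => hr₀s (Metric.closedBall_subset_closedBall hrr₀ hz)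
  -- Zeros of `wa x` are the roots solving all equations, zeros of `wb x` those where `H` vanishes
  -- too. A solution with `H ≠ 0` exists over `x` exactly when the second count is smaller, and both
  -- counts are read off from symmetric functions analytic in `x`.
  set wa : E → Fin m → I → ℂ := fun x j i => g i (x, ρ x j) with hwa
  set wb : E → Fin m → Option I → ℂ := fun x j o => o.elim (H (x, ρ x j)) fun i => g i (x, ρ x j)
    with hwb
  have hwa0 : ∀ x j, wa x j = 0 ↔ ∀ i, g i (x, ρ x j) = 0 := fun x j => funext_iff
  have hwb0 : ∀ x j, wb x j = 0 ↔ (∀ i, g i (x, ρ x j) = 0) ∧ H (x, ρ x j) = 0 := by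
    intro x j
    rw [funext_iff, Option.forall, and_comm]
    rfl
  obtain ⟨Ta, hTa⟩ := exists_forms_le_card_zeros_iff I m
  obtain ⟨Tb, hTb⟩ := exists_forms_le_card_zeros_iff (Option I) m
  set ca : (I → ℂ) → ℕ → E → ℂ := fun σ q x =>
    (∏ j, (Polynomial.X - Polynomial.C (∑ i, σ i * wa x j i))).coeff q with hca
  set cb : (Option I → ℂ) → ℕ → E → ℂ := fun σ q x =>
    (∏ j, (Polynomial.X - Polynomial.C (∑ i, σ i * wb x j i))).coeff q with hcb
  have hcaa : ∀ σ q, AnalyticAt ℂ (ca σ q) 0 := fun σ q =>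
    analyticAt_coeff_prod_of_powerSums (x := fun x j => ∑ i, σ i * wa x j i) (fun k =>
      hρu (fun p => (∑ i, σ i * g i p) ^ k) fun z hz =>
        (Finset.analyticAt_fun_sum _ fun i _ => analyticAt_const.mul ((hrs z hz).1 i)).pow k) q
  have hcba : ∀ σ q, AnalyticAt ℂ (cb σ q) 0 := fun σ q =>
    analyticAt_coeff_prod_of_powerSums (x := fun x j => ∑ i, σ i * wb x j i) (fun k =>
      hρu (fun p => (∑ i : Option I, σ i * i.elim (H p) fun i => g i p) ^ k) fun z hz =>
        (Finset.analyticAt_fun_sum _ fun i _ => analyticAt_const.mul (by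
          cases i with
          | none => exact (hrs z hz).2
          | some i => exact (hrs z hz).1 i)).pow k) q
  -- the projection of the set meets, near the origin, one of finitely many strata
  have hproj : ∃ᶠ x in 𝓝 (0 : E), ∃ j, (∀ i, g i (x, ρ x j) = 0) ∧ H (x, ρ x j) ≠ 0 := by
    have h1 := (continuous_fst.tendsto' (0 : E × ℂ) 0 rfl).eventually hρz
    have h2 := (continuous_snd.tendsto' (0 : E × ℂ) 0 rfl).eventually
      (Metric.closedBall_mem_nhds (0 : ℂ) hr)
    have h3 := hf.and_eventually (h1.and h2)
    refine (continuous_fst.tendsto' (0 : E × ℂ) 0 rfl).frequently (h3.mono ?_)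
    rintro ⟨x, z⟩ ⟨⟨h4, h5⟩, h6, h7⟩
    obtain ⟨j, hj⟩ := (h6 z h7).1 (h4 i₀)
    exact ⟨j, by simpa [← hj] using h4, by simpa [← hj] using h5⟩
  -- Take `p` to be the number of roots solving all equations. Fewer than `p` of them are zeros of
  -- `H`, so some coefficient `cb` of index below `p` is nonzero. There are finitely many choices of
  -- `p ≤ m`, `σ` and `q`, so one of them occurs arbitrarily close to `0`.
  obtain ⟨p, σ, hσ, q, hqp, hstrat⟩ : ∃ p : ℕ, ∃ σ ∈ Tb, ∃ q < p, ∃ᶠ x in 𝓝 (0 : E),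
      (∀ i : Ta × Fin p, ca i.1 i.2 x = 0) ∧ cb σ q x ≠ 0 := by
    by_contra! hcon
    have h1 : ∀ᶠ x in 𝓝 (0 : E), ∀ p ∈ Finset.range (m + 1), ∀ σ ∈ Tb, ∀ q ∈ Finset.range p,
        (∀ i : Ta × Fin p, ca i.1 i.2 x = 0) → cb σ q x = 0 := by
      rw [Finset.eventually_all]
      intro p _
      rw [Finset.eventually_all]
      intro σ hσ
      rw [Finset.eventually_all]
      intro q hq
      exact hcon p σ hσ q (Finset.mem_range.1 hq)
    obtain ⟨x, ⟨j, hj1, hj2⟩, hx⟩ := (hproj.and_eventually h1).exists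
    set a := (Finset.univ.filter fun j => wa x j = 0).card with ha
    have ham : a ≤ m := (Finset.card_filter_le _ _).trans (by simp)
    have hba : ¬ a ≤ (Finset.univ.filter fun j => wb x j = 0).card := by
      rw [not_le]
      refine Finset.card_lt_card (Finset.ssubset_iff_of_subset ?_ |>.2 ⟨j, ?_, ?_⟩)
      · intro j' hj'
        rw [Finset.mem_filter] at hj' ⊢
        exact ⟨hj'.1, (hwa0 x j').2 ((hwb0 x j').1 hj'.2).1⟩
      · exact Finset.mem_filter.2 ⟨Finset.mem_univ _, (hwa0 x j).2 hj1⟩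
      · rw [Finset.mem_filter]
        exact fun h => hj2 ((hwb0 x j).1 h.2).2
    rw [hTb] at hba
    push Not at hba
    obtain ⟨σ, hσ, q, hq, hne⟩ := hba
    refine hne (hx a (Finset.mem_range.2 (by omega)) σ hσ q (Finset.mem_range.2 hq) ?_)
    rintro ⟨τ, q'⟩
    exact (hTa (wa x) a).1 le_rfl τ τ.2 q' q'.2
  obtain ⟨γ, hγ, hγ0, hγg, hγH⟩ := ih (fun i : Ta × Fin p => hcaa i.1 i.2) (hcba σ q) hstrat
  have hγH' : ∀ᶠ t in 𝓝[≠] (0 : ℂ), cb σ q (γ t) ≠ 0 :=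
    (((hcba σ q).comp_of_eq hγ hγ0).eventually_eq_zero_or_eventually_ne_zero).resolve_left hγH
  -- Along the curve the `ca` vanish, giving at least `p` common zeros; if `H` vanished at all of
  -- them, `cb σ q` would vanish too.
  have hlift : ∀ᶠ t in 𝓝[≠] (0 : ℂ),
      ∃ j, (∀ i, g i (γ t, ρ (γ t) j) = 0) ∧ H (γ t, ρ (γ t) j) ≠ 0 := by
    filter_upwards [hγH', hγg.filter_mono nhdsWithin_le_nhds] with t ht1 ht2
    by_contra! hcon
    have h1 : p ≤ (Finset.univ.filter fun j => wa (γ t) j = 0).card :=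
      (hTa _ _).2 fun τ hτ q' hq' => ht2 (⟨τ, hτ⟩, ⟨q', hq'⟩)
    have h2 : p ≤ (Finset.univ.filter fun j => wb (γ t) j = 0).card := by
      refine h1.trans (Finset.card_le_card fun j hj => ?_)
      rw [Finset.mem_filter] at hj ⊢
      have := (hwa0 _ j).1 hj.2
      exact ⟨hj.1, (hwb0 _ j).2 ⟨this, hcon j this⟩⟩
    exact ht1 ((hTb _ _).1 h2 σ hσ q hqp)
  -- lift the curve by Puiseux's theorem
  have hqa : AnalyticAt ℂ (fun y : ℂ × ℂ => g i₀ (γ y.1, y.2)) 0 :=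
    (hg i₀).comp_of_eq ((hγ.comp_of_eq analyticAt_fst rfl).prod analyticAt_snd)
      (by simp [hγ0])
  obtain ⟨N, hN, L, hLf, hLa, hLc⟩ := exists_isPuiseuxCover m hqa (by simpa only [hγ0] using hord)
  have hpow : Tendsto (fun s : ℂ => s ^ N) (𝓝[≠] 0) (𝓝[≠] 0) := by
    refine tendsto_nhdsWithin_of_tendsto_nhds_of_eventually_within _
      ((tendsto_pow_nhds_zero hN).mono_left nhdsWithin_le_nhds) ?_
    filter_upwards [self_mem_nhdsWithin] with s hs
    exact pow_ne_zero N hs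
  have hρs : Tendsto (fun s : ℂ => ρ (γ (s ^ N))) (𝓝 0) (𝓝 0) :=
    hρt.comp ((hγ.continuousAt.tendsto.comp (tendsto_pow_nhds_zero hN)).trans (by rw [hγ0]))
  have hcov : ∀ᶠ s in 𝓝 (0 : ℂ), ∀ j, g i₀ (γ (s ^ N), ρ (γ (s ^ N)) j) = 0 →
      ∃ σ ∈ L, ρ (γ (s ^ N)) j = σ s := by
    rw [eventually_all]
    intro j
    have h1 : Tendsto (fun s : ℂ => (s, ρ (γ (s ^ N)) j)) (𝓝 0) (𝓝 0) := by
      rw [← Prod.mk_zero_zero, nhds_prod_eq]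
      exact tendsto_id.prodMk (tendsto_pi_nhds.1 hρs j)
    exact h1.eventually hLc
  -- Finitely many Puiseux branches carry the good roots, so one branch carries them for parameters
  -- accumulating at `0`. The identity theorem then makes all equations hold along the whole branch.
  obtain ⟨τ, hτL, hτ⟩ : ∃ τ ∈ L, ∃ᶠ s in 𝓝[≠] (0 : ℂ), ∃ j, ρ (γ (s ^ N)) j = τ s ∧
      (∀ i, g i (γ (s ^ N), τ s) = 0) ∧ H (γ (s ^ N), τ s) ≠ 0 := by
    by_contra! hcon
    have h1 := (eventually_all_finite hLf).2 hcon
    obtain ⟨s, h2, h3, j, hj1, hj2⟩ := (h1.and ((hcov.filter_mono nhdsWithin_le_nhds).and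
      (hpow.eventually hlift))).exists
    obtain ⟨σ, hσL, hσ⟩ := h3 j (hj1 i₀)
    exact hj2 (by simpa [← hσ] using h2 σ hσL j hσ (by simpa [← hσ] using hj1))
  have hτ0 : τ 0 = 0 := by
    by_contra h0
    have h1 : ∀ᶠ s in 𝓝 (0 : ℂ), ‖τ 0‖ / 2 < ‖τ s‖ :=
      (hLa τ hτL).continuousAt.norm.tendsto.eventually_const_lt (by
        have := norm_pos_iff.2 h0
        linarith)
    have h2 : ∀ᶠ s in 𝓝 (0 : ℂ), ‖ρ (γ (s ^ N))‖ < ‖τ 0‖ / 2 := by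
      have h3 := hρs.norm
      rw [norm_zero] at h3
      exact h3.eventually_lt_const (by have := norm_pos_iff.2 h0; linarith)
    obtain ⟨s, ⟨j, hj, -⟩, h3, h4⟩ := (hτ.and_eventually
      ((h1.and h2).filter_mono nhdsWithin_le_nhds)).exists
    have h5 := norm_le_pi_norm (ρ (γ (s ^ N))) j
    rw [hj] at h5
    linarith
  have hγN : AnalyticAt ℂ (fun s => γ (s ^ N)) 0 :=
    AnalyticAt.comp_of_eq (f := fun s : ℂ => s ^ N) hγ (by fun_prop) (zero_pow hN)
  have hδ : AnalyticAt ℂ (fun s => (γ (s ^ N), τ s)) 0 := hγN.prod (hLa τ hτL)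
  have hδ0 : (fun s => (γ (s ^ N), τ s)) 0 = 0 := by simp [hN, hγ0, hτ0]
  refine ⟨fun s => (γ (s ^ N), τ s), hδ, hδ0, ?_, ?_⟩
  · rw [eventually_all]
    intro i
    refine ((hg i).comp_of_eq hδ hδ0).frequently_zero_iff_eventually_zero.1 (hτ.mono ?_)
    rintro s ⟨j, -, h, -⟩
    exact h i
  · intro hcon
    obtain ⟨s, ⟨j, -, -, h⟩, h'⟩ :=
      (hτ.and_eventually (hcon.filter_mono nhdsWithin_le_nhds)).exists
    exact h h'

/-- **Curve selection lemma**: if the origin is in the closure of the part of an analytic set where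
`H` does not vanish, then there is an analytic curve through the origin in the analytic set, along
which `H` does not vanish identically. -/
theorem curve_selection (n : ℕ) : ∀ {I : Type} [Fintype I] {g : I → (Fin n → ℂ) → ℂ}
    {H : (Fin n → ℂ) → ℂ}, (∀ i, AnalyticAt ℂ (g i) 0) → AnalyticAt ℂ H 0 →
    (∃ᶠ z in 𝓝 0, (∀ i, g i z = 0) ∧ H z ≠ 0) →
    ∃ γ : ℂ → (Fin n → ℂ), AnalyticAt ℂ γ 0 ∧ γ 0 = 0 ∧ (∀ᶠ t in 𝓝 0, ∀ i, g i (γ t) = 0) ∧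
      ¬ ∀ᶠ t in 𝓝 0, H (γ t) = 0 := by
  induction n with
  | zero =>
    intro I _ g H _ _ hf
    obtain ⟨z, hz1, hz2⟩ := hf.exists
    refine ⟨fun _ => z, analyticAt_const, Subsingleton.elim _ _, Eventually.of_forall fun _ => hz1, ?_⟩
    intro h
    exact hz2 h.self_of_nhds
  | succ n ih =>
    intro I _ g H hg hH hf
    by_cases hall : ∀ i, ∀ᶠ z in 𝓝 0, g i z = 0
    · have h1 : ¬ ∀ v : Fin (n + 1) → ℂ, ∀ᶠ t in 𝓝 (0 : ℂ), H (t • v) = 0 := by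
        intro h
        obtain ⟨z, hz1, hz2⟩ := (hf.and_eventually (eventually_eq_zero_of_lines hH h)).exists
        exact hz1.2 hz2
      push Not at h1
      obtain ⟨v, hv⟩ := h1
      have hline : Continuous fun t : ℂ => t • v := by fun_prop
      refine ⟨fun t => t • v, by fun_prop, zero_smul _ _, ?_, not_eventually.2 hv⟩
      exact (hline.tendsto' 0 0 (zero_smul _ _)).eventually (eventually_all.2 hall)
    · push Not at hall
      obtain ⟨i₀, hi₀⟩ := hall
      have hg0 : g i₀ 0 = 0 := by
        by_contra h0
        obtain ⟨z, hz1, hz2⟩ := (hf.and_eventually ((hg i₀).continuousAt.eventually_ne h0)).exists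
        exact hz2 (hz1.1 i₀)
      obtain ⟨v, hv⟩ : ∃ v : Fin (n + 1) → ℂ, ¬ ∀ᶠ t in 𝓝 (0 : ℂ), g i₀ (t • v) = 0 := by
        by_contra! h
        exact not_eventually.2 hi₀ (eventually_eq_zero_of_lines (hg i₀) fun v => by
          simpa using h v)
      have hv0 : v ≠ 0 := by
        rintro rfl
        exact hv (by simp [hg0])
      set e₀ := finSuccSplit n
      -- A linear change of coordinates turns `v`, a direction along which `g i₀` is not identically
      -- zero, into the last coordinate axis.
      obtain ⟨A, hA⟩ := SeparatingDual.exists_continuousLinearEquiv_apply_eq (R := ℂ)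
        (x := e₀ v) (y := ((0 : Fin n → ℂ), (1 : ℂ))) (by simpa using hv0) (by simp)
      set e := e₀.trans A with he
      have hev : e.symm (0, 1) = v := by
        rw [ContinuousLinearEquiv.symm_apply_eq]
        exact hA.symm
      have hsym : ∀ {f : (Fin (n + 1) → ℂ) → ℂ}, AnalyticAt ℂ f 0 → AnalyticAt ℂ (f ∘ e.symm) 0 :=
        fun h => h.comp_of_eq (e.symm.analyticAt 0) (map_zero _)
      obtain ⟨γ, h1, h2, h3, h4⟩ := curve_selection_prod (E := Fin n → ℂ) ih
        (g := fun i => g i ∘ e.symm) (H := H ∘ e.symm) (fun i => hsym (hg i)) (hsym hH) (by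
          refine (e.continuous.tendsto' 0 0 (map_zero _)).frequently (hf.mono fun z hz => ?_)
          simpa using hz) (i₀ := i₀) (by
          convert hv using 4 with t
          have : ((0 : Fin n → ℂ), t) = t • ((0 : Fin n → ℂ), (1 : ℂ)) := by simp
          rw [Function.comp, this, map_smul, hev])
      exact ⟨fun t => e.symm (γ t), (e.symm.analyticAt _).comp h1, by simp [h2], h3, h4⟩

/-! ### The graph transform and the strong stable manifold. -/

/-- One step of the graph transform for `F` with linear part `A × B` at the origin. -/
def graphTransform {S C : Type} [NormedAddCommGroup S] [NormedSpace ℂ S] [NormedAddCommGroup C]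
    [NormedSpace ℂ C] (F : S × C → S × C) (B : C ≃L[ℂ] C) (φ : S → C) : S → C :=
  fun s => B.symm (φ (F (s, φ s)).1 - ((F (s, φ s)).2 - B (φ s)))

/-- The functions to which the graph transform is applied. -/
structure IsLipschitzGraph {S C : Type} [NormedAddCommGroup S] [NormedSpace ℂ S]
    [NormedAddCommGroup C] [NormedSpace ℂ C] (δ : ℝ) (φ : S → C) : Prop where
  analytic : AnalyticOnNhd ℂ φ (Metric.ball 0 δ)
  map_zero : φ 0 = 0
  lip : ∀ s ∈ Metric.ball (0 : S) δ, ∀ s' ∈ Metric.ball (0 : S) δ, ‖φ s - φ s'‖ ≤ ‖s - s'‖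

section GraphTransform

variable {S C : Type} [NormedAddCommGroup S] [NormedSpace ℂ S] [NormedAddCommGroup C]
  [NormedSpace ℂ C]

theorem IsLipschitzGraph.norm_le {δ : ℝ} {φ : S → C} (h : IsLipschitzGraph δ φ) {s : S}
    (hs : s ∈ Metric.ball (0 : S) δ) : ‖φ s‖ ≤ ‖s‖ := by
  have h0 : (0 : S) ∈ Metric.ball (0 : S) δ :=
    Metric.mem_ball_self (Metric.pos_of_mem_ball hs)
  simpa [h.map_zero] using h.lip s hs 0 h0

theorem IsLipschitzGraph.mk_mem {δ : ℝ} {φ : S → C} (h : IsLipschitzGraph δ φ) {s : S}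
    (hs : s ∈ Metric.ball (0 : S) δ) : (s, φ s) ∈ Metric.ball (0 : S × C) δ := by
  rw [mem_ball_zero_iff] at hs ⊢
  exact (max_le le_rfl (h.norm_le (mem_ball_zero_iff.2 hs))).trans_lt hs

/-- Bounds for a map which is close to its linear part `A × B` on a ball. -/
structure IsCloseToLinear (F : S × C → S × C) (A : S →L[ℂ] S) (B : C ≃L[ℂ] C) (δ η : ℝ) :
    Prop where
  analytic : AnalyticOnNhd ℂ F (Metric.ball 0 δ)
  map_zero : F 0 = 0
  fst : ∀ x ∈ Metric.ball (0 : S × C) δ, ∀ y ∈ Metric.ball (0 : S × C) δ,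
    ‖(F x).1 - (F y).1 - A (x.1 - y.1)‖ ≤ η * ‖x - y‖
  snd : ∀ x ∈ Metric.ball (0 : S × C) δ, ∀ y ∈ Metric.ball (0 : S × C) δ,
    ‖((F x).2 - B x.2) - ((F y).2 - B y.2)‖ ≤ η * ‖x - y‖
  η_pos : 0 < η
  lt_one : ‖A‖ + η < 1
  gap : ‖(B.symm : C →L[ℂ] C)‖ * (‖A‖ + 3 * η) < 1

variable {F : S × C → S × C} {A : S →L[ℂ] S} {B : C ≃L[ℂ] C} {δ η : ℝ}

theorem IsCloseToLinear.norm_fst_sub_le (h : IsCloseToLinear F A B δ η) {φ : S → C}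
    (hφ : IsLipschitzGraph δ φ) {s s' : S} (hs : s ∈ Metric.ball (0 : S) δ)
    (hs' : s' ∈ Metric.ball (0 : S) δ) :
    ‖(F (s, φ s)).1 - (F (s', φ s')).1‖ ≤ (‖A‖ + η) * ‖s - s'‖ := by
  have h1 := h.fst _ (hφ.mk_mem hs) _ (hφ.mk_mem hs')
  have h2 : ‖(s, φ s) - (s', φ s')‖ ≤ ‖s - s'‖ := max_le le_rfl (hφ.lip s hs s' hs')
  have h3 := A.le_opNorm (s - s')
  have h4 := norm_le_norm_add_norm_sub' ((F (s, φ s)).1 - (F (s', φ s')).1) (A (s - s'))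
  have h5 := mul_le_mul_of_nonneg_left h2 h.η_pos.le
  simp only at h1
  linarith

theorem IsCloseToLinear.fst_mem (h : IsCloseToLinear F A B δ η) {φ : S → C}
    (hφ : IsLipschitzGraph δ φ) {s : S} (hs : s ∈ Metric.ball (0 : S) δ) :
    (F (s, φ s)).1 ∈ Metric.ball (0 : S) δ ∧ ‖(F (s, φ s)).1‖ ≤ (‖A‖ + η) * ‖s‖ := by
  have h0 : (0 : S) ∈ Metric.ball (0 : S) δ :=
    Metric.mem_ball_self (Metric.pos_of_mem_ball hs)
  have h1 := h.norm_fst_sub_le hφ hs h0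
  rw [hφ.map_zero, Prod.mk_zero_zero, h.map_zero, Prod.fst_zero, sub_zero, sub_zero] at h1
  refine ⟨?_, h1⟩
  rw [mem_ball_zero_iff] at hs ⊢
  have := h.lt_one
  nlinarith [norm_nonneg s]

/-- The transform solves `F₂ = φ ∘ F₁` for the linear term `B φ`, so only `B` has to be inverted and
`A` may be singular. Composition with `F₁` costs `‖A‖ + η` and the nonlinear term `η`; the gap
condition brings the Lipschitz constant back below one. -/
theorem IsCloseToLinear.isLipschitzGraph_graphTransform (h : IsCloseToLinear F A B δ η)
    {φ : S → C} (hφ : IsLipschitzGraph δ φ) : IsLipschitzGraph δ (graphTransform F B φ) where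
  analytic := by
    intro s hs
    have h1 : AnalyticAt ℂ (fun s => F (s, φ s)) s :=
      AnalyticAt.comp (f := fun s => (s, φ s)) (h.analytic _ (hφ.mk_mem hs))
        (analyticAt_id.prod (hφ.analytic s hs))
    have h2 : AnalyticAt ℂ (fun s => (F (s, φ s)).1) s := analyticAt_fst.comp h1
    have h3 : AnalyticAt ℂ (fun s => (F (s, φ s)).2) s := analyticAt_snd.comp h1
    have h4 : AnalyticAt ℂ (fun s => φ (F (s, φ s)).1) s :=
      AnalyticAt.comp (hφ.analytic _ (h.fst_mem hφ hs).1) h2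
    have h5 : AnalyticAt ℂ (fun s => B (φ s)) s := (B.analyticAt _).comp (hφ.analytic s hs)
    exact AnalyticAt.comp (B.symm.analyticAt _) (h4.sub (h3.sub h5))
  map_zero := by
    simp [graphTransform, hφ.map_zero, Prod.mk_zero_zero, h.map_zero]
  lip := by
    intro s hs s' hs'
    have h1 := h.norm_fst_sub_le hφ hs hs'
    have h2 := hφ.lip _ (h.fst_mem hφ hs).1 _ (h.fst_mem hφ hs').1
    have h3 := h.snd _ (hφ.mk_mem hs) _ (hφ.mk_mem hs')
    have h4 : ‖(s, φ s) - (s', φ s')‖ ≤ ‖s - s'‖ := max_le le_rfl (hφ.lip s hs s' hs')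
    have h5 := mul_le_mul_of_nonneg_left h4 h.η_pos.le
    simp only [graphTransform, ← map_sub]
    refine ((B.symm : C →L[ℂ] C).le_opNorm _).trans ?_
    rw [sub_sub_sub_comm]
    have h6 := norm_sub_le (φ (F (s, φ s)).1 - φ (F (s', φ s')).1)
      (((F (s, φ s)).2 - B (φ s)) - ((F (s', φ s')).2 - B (φ s')))
    simp only at h3
    have h7 : ‖(φ (F (s, φ s)).1 - φ (F (s', φ s')).1) -
      (((F (s, φ s)).2 - B (φ s)) - ((F (s', φ s')).2 - B (φ s')))‖ ≤
        (‖A‖ + 3 * η) * ‖s - s'‖ := by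
      have := mul_nonneg h.η_pos.le (norm_nonneg (s - s'))
      linarith
    refine (mul_le_mul_of_nonneg_left h7 (norm_nonneg _)).trans ?_
    rw [← mul_assoc]
    exact mul_le_of_le_one_left (norm_nonneg _) h.gap.le

/-- The weight `‖s‖` is essential: evaluation at `F₁`, of norm at most `(‖A‖ + η) ‖s‖`, gains the
factor `‖A‖` that compensates `‖B⁻¹‖`, which may exceed one. An unweighted sup norm would not give a
contraction. -/
theorem IsCloseToLinear.graphTransform_sub_le (h : IsCloseToLinear F A B δ η)
    {φ ψ : S → C} (hφ : IsLipschitzGraph δ φ) (hψ : IsLipschitzGraph δ ψ) {D : ℝ} (hD : 0 ≤ D)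
    (hφψ : ∀ s ∈ Metric.ball (0 : S) δ, ‖φ s - ψ s‖ ≤ D * ‖s‖) {s : S}
    (hs : s ∈ Metric.ball (0 : S) δ) :
    ‖graphTransform F B φ s - graphTransform F B ψ s‖ ≤
      ‖(B.symm : C →L[ℂ] C)‖ * (‖A‖ + 3 * η) * D * ‖s‖ := by
  have e1 : ‖(s, φ s) - (s, ψ s)‖ = ‖φ s - ψ s‖ := by
    rw [Prod.mk_sub_mk, sub_self, Prod.norm_mk, norm_zero]
    exact max_eq_right (norm_nonneg _)
  have h1 := h.fst _ (hφ.mk_mem hs) _ (hψ.mk_mem hs)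
  have h2 := h.snd _ (hφ.mk_mem hs) _ (hψ.mk_mem hs)
  simp only [sub_self, _root_.map_zero, sub_zero, e1] at h1 h2
  have h3 := hφψ s hs
  have h4 := hφψ _ (h.fst_mem hφ hs).1
  have h5 := hψ.lip _ (h.fst_mem hφ hs).1 _ (h.fst_mem hψ hs).1
  have h6 := mul_le_mul_of_nonneg_left (h.fst_mem hφ hs).2 hD
  have h7 := mul_le_mul_of_nonneg_left h3 h.η_pos.le
  simp only [graphTransform, ← map_sub]
  refine ((B.symm : C →L[ℂ] C).le_opNorm _).trans ?_
  rw [mul_assoc, mul_assoc]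
  refine mul_le_mul_of_nonneg_left ?_ (norm_nonneg _)
  rw [sub_sub_sub_comm]
  have h8 := norm_sub_le (φ (F (s, φ s)).1 - ψ (F (s, ψ s)).1)
      (((F (s, φ s)).2 - B (φ s)) - ((F (s, ψ s)).2 - B (ψ s)))
  have h9 := norm_sub_le_norm_sub_add_norm_sub (φ (F (s, φ s)).1) (ψ (F (s, φ s)).1)
    (ψ (F (s, ψ s)).1)
  linarith

/-- An invariant analytic graph for a map close to its linear part. -/
theorem IsCloseToLinear.exists_invariant_graph [FiniteDimensional ℂ S] [CompleteSpace C]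
    (h : IsCloseToLinear F A B δ η) (hδ : 0 < δ) :
    ∃ φ : S → C, IsLipschitzGraph δ φ ∧
      ∀ s ∈ Metric.ball (0 : S) δ, (F (s, φ s)).2 = φ (F (s, φ s)).1 := by
  set κ := ‖(B.symm : C →L[ℂ] C)‖ * (‖A‖ + 3 * η) with hκ
  have hκ0 : 0 ≤ κ := by
    have := h.η_pos
    positivity
  set φ : ℕ → S → C := fun k => (graphTransform F B)^[k] 0 with hφdef
  have hsucc : ∀ k, φ (k + 1) = graphTransform F B (φ k) := fun k =>
    Function.iterate_succ_apply' _ _ _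
  have hφ : ∀ k, IsLipschitzGraph δ (φ k) := by
    intro k
    induction k with
    | zero => exact ⟨analyticOnNhd_const, rfl, by simp [hφdef]⟩
    | succ k ih =>
      rw [hsucc]
      exact h.isLipschitzGraph_graphTransform ih
  have hgeo : ∀ k, ∀ s ∈ Metric.ball (0 : S) δ, ‖φ (k + 1) s - φ k s‖ ≤ κ ^ k * ‖s‖ := by
    intro k
    induction k with
    | zero =>
      intro s hs
      have : φ 0 s = 0 := rfl
      simpa [this] using (hφ 1).norm_le hs
    | succ k ih =>
      intro s hs
      rw [hsucc (k + 1)]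
      conv_lhs => rw [hsucc k]
      have := h.graphTransform_sub_le (hφ (k + 1)) (hφ k) (pow_nonneg hκ0 k) ih hs
      rw [hsucc k] at this
      rw [pow_succ']
      exact this
  have hdist : ∀ s ∈ Metric.ball (0 : S) δ, ∀ k, dist (φ k s) (φ (k + 1) s) ≤ δ * κ ^ k := by
    intro s hs k
    rw [dist_comm, dist_eq_norm, mul_comm]
    exact (hgeo k s hs).trans (mul_le_mul_of_nonneg_left (mem_ball_zero_iff.1 hs).le
      (pow_nonneg hκ0 k))
  have hlim : ∀ s ∈ Metric.ball (0 : S) δ, ∃ c, Tendsto (fun k => φ k s) atTop (𝓝 c) :=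
    fun s hs => cauchySeq_tendsto_of_complete
      (cauchySeq_of_le_geometric κ δ h.gap (hdist s hs))
  choose! f hf using hlim
  have hunif : TendstoUniformlyOn φ f atTop (Metric.ball 0 δ) := by
    rw [Metric.tendstoUniformlyOn_iff]
    intro ε hε
    have h1 : Tendsto (fun k => δ * κ ^ k / (1 - κ)) atTop (𝓝 0) := by
      have := ((tendsto_pow_atTop_nhds_zero_of_lt_one hκ0 h.gap).const_mul δ).div_const (1 - κ)
      simpa using this
    filter_upwards [h1.eventually_lt_const hε] with k hk s hs
    rw [dist_comm]
    exact (dist_le_of_le_geometric_of_tendsto κ δ h.gap (hdist s hs) (hf s hs) k).trans_lt hk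
  have hfg : IsLipschitzGraph δ f := by
    have h0 : (0 : S) ∈ Metric.ball (0 : S) δ := Metric.mem_ball_self hδ
    refine ⟨analyticOnNhd_of_tendstoUniformlyOn Metric.isOpen_ball (fun k => (hφ k).analytic) hunif,
      ?_, ?_⟩
    · refine tendsto_nhds_unique (hf 0 h0) ?_
      simp only [fun k => (hφ k).map_zero]
      exact tendsto_const_nhds
    · intro s hs s' hs'
      exact le_of_tendsto ((hf s hs).sub (hf s' hs')).norm
        (Eventually.of_forall fun k => (hφ k).lip s hs s' hs')
  refine ⟨f, hfg, fun s hs => ?_⟩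
  have hp : Tendsto (fun k => F (s, φ k s)) atTop (𝓝 (F (s, f s))) :=
    (h.analytic _ (hfg.mk_mem hs)).continuousAt.tendsto.comp
      (tendsto_const_nhds.prodMk_nhds (hf s hs))
  have h1 : Tendsto (fun k => φ k (F (s, φ k s)).1) atTop (𝓝 (f (F (s, f s)).1)) := by
    refine hunif.tendsto_comp (hfg.analytic _ (h.fst_mem hfg hs).1).continuousAt.continuousWithinAt
      (tendsto_nhdsWithin_iff.2 ⟨(continuous_fst.tendsto _).comp hp,
        Eventually.of_forall fun k => (h.fst_mem (hφ k) hs).1⟩)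
  have h2 : Tendsto (fun k => (F (s, φ k s)).2 - B (φ k s) + B (φ (k + 1) s)) atTop
      (𝓝 ((F (s, f s)).2 - B (f s) + B (f s))) :=
    (((continuous_snd.tendsto _).comp hp).sub ((B.continuous.tendsto _).comp (hf s hs))).add
      ((B.continuous.tendsto _).comp ((hf s hs).comp (tendsto_add_atTop_nat 1)))
  have h3 : ∀ k, (F (s, φ k s)).2 - B (φ k s) + B (φ (k + 1) s) = φ k (F (s, φ k s)).1 := by
    intro k
    rw [hsucc]
    simp [graphTransform]
  rw [sub_add_cancel] at h2
  exact tendsto_nhds_unique (h2.congr h3) h1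

theorem exists_isCloseToLinear [CompleteSpace S] [CompleteSpace C]
    (hF : AnalyticAt ℂ F 0) (hF0 : F 0 = 0)
    (hD : fderiv ℂ F 0 = A.prodMap (B : C →L[ℂ] C)) (hA : ‖A‖ < 1)
    (hAB : ‖(B.symm : C →L[ℂ] C)‖ * ‖A‖ < 1) :
    ∃ δ > 0, ∃ η, IsCloseToLinear F A B δ η := by
  obtain ⟨η, ⟨h1, h2⟩, h3⟩ : ∃ η, (‖A‖ + η < 1 ∧
      ‖(B.symm : C →L[ℂ] C)‖ * (‖A‖ + 3 * η) < 1) ∧ 0 < η := by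
    have e1 : ∀ᶠ η in 𝓝 (0 : ℝ), ‖A‖ + η < 1 :=
      ContinuousAt.eventually_lt (by fun_prop) continuousAt_const (by simpa using hA)
    have e2 : ∀ᶠ η in 𝓝 (0 : ℝ), ‖(B.symm : C →L[ℂ] C)‖ * (‖A‖ + 3 * η) < 1 :=
      ContinuousAt.eventually_lt (by fun_prop) continuousAt_const (by simpa using hAB)
    exact (((e1.and e2).filter_mono nhdsWithin_le_nhds).and
      (self_mem_nhdsWithin : Set.Ioi (0 : ℝ) ∈ 𝓝[>] 0)).exists
  have hs : HasStrictFDerivAt F (A.prodMap (B : C →L[ℂ] C)) 0 := hD ▸ hF.hasStrictFDerivAt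
  obtain ⟨U, hU, hUF⟩ := hs.approximates_deriv_on_nhds (c := ⟨η, h3.le⟩)
    (Or.inr (by exact_mod_cast h3))
  obtain ⟨δ, hδ, hδs⟩ := Metric.nhds_basis_ball.mem_iff.1
    (inter_mem hU hF.eventually_analyticAt)
  have key : ∀ x ∈ Metric.ball (0 : S × C) δ, ∀ y ∈ Metric.ball (0 : S × C) δ,
      ‖F x - F y - (A.prodMap (B : C →L[ℂ] C)) (x - y)‖ ≤ η * ‖x - y‖ :=
    fun x hx y hy => hUF x (hδs hx).1 y (hδs hy).1
  refine ⟨δ, hδ, η, fun x hx => (hδs hx).2, hF0, fun x hx y hy => ?_, fun x hx y hy => ?_, h3, h1, h2⟩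
  · exact (norm_fst_le _).trans (key x hx y hy)
  · refine le_trans (le_of_eq ?_) ((norm_snd_le _).trans (key x hx y hy))
    congr 1
    simp
    abel

/-- **Strong stable manifold theorem.** If the linear part `A × B` of `F` contracts more on the
first factor than on the second, there is an analytic submersion `h` onto the second factor with
`h ∘ F = B ∘ h` up to terms small compared with `h`. -/
theorem exists_semiconjugacy [FiniteDimensional ℂ S] [CompleteSpace C]
    (hF : AnalyticAt ℂ F 0) (hF0 : F 0 = 0)
    (hD : fderiv ℂ F 0 = A.prodMap (B : C →L[ℂ] C)) (hA : ‖A‖ < 1)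
    (hAB : ‖(B.symm : C →L[ℂ] C)‖ * ‖A‖ < 1) :
    ∃ h : S × C → C, AnalyticAt ℂ h 0 ∧ h 0 = 0 ∧ (∀ c, fderiv ℂ h 0 (0, c) = c) ∧
      ∀ ε > 0, ∀ᶠ z in 𝓝 0, ‖h (F z) - B (h z)‖ ≤ ε * ‖h z‖ := by
  have := FiniteDimensional.complete ℂ S
  obtain ⟨δ, hδ, η, hcl⟩ := exists_isCloseToLinear hF hF0 hD hA hAB
  obtain ⟨φ, hφ, hinv⟩ := hcl.exists_invariant_graph hδ
  have hφa : AnalyticAt ℂ φ 0 := hφ.analytic 0 (Metric.mem_ball_self hδ)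
  set h : S × C → C := fun z => z.2 - φ z.1 with hh
  have hφ1 : AnalyticAt ℂ (fun z : S × C => φ z.1) 0 := hφa.comp_of_eq analyticAt_fst rfl
  have ha : AnalyticAt ℂ h 0 := analyticAt_snd.sub hφ1
  have h0 : h 0 = 0 := by simp [hh, hφ.map_zero]
  have hd : ∀ c, fderiv ℂ h 0 (0, c) = c := by
    intro c
    have e1 : HasFDerivAt h (ContinuousLinearMap.snd ℂ S C -
        (fderiv ℂ φ 0).comp (ContinuousLinearMap.fst ℂ S C)) 0 :=
      hasFDerivAt_snd.sub (HasFDerivAt.comp (0 : S × C) (g := φ) (f := Prod.fst)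
        hφa.differentiableAt.hasFDerivAt hasFDerivAt_fst)
    rw [e1.fderiv]
    simp
  refine ⟨h, ha, h0, hd, fun ε hε => ?_⟩
  -- Strict differentiability compares `z` with the point of the graph having the same first
  -- component. The two differ by `(0, h z)`, and `h ∘ F` vanishes on the graph by invariance, so
  -- the error is small relative to `‖h z‖` rather than to `‖z‖`.
  have hstr : HasStrictFDerivAt (h ∘ F) ((fderiv ℂ h 0).comp (fderiv ℂ F 0)) 0 := by
    refine HasStrictFDerivAt.comp (g := h) (f := F) 0 ?_ hF.hasStrictFDerivAt
    rw [hF0]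
    exact ha.hasStrictFDerivAt
  have hlit := hstr.isLittleO.def hε
  have htend : Tendsto (fun z : S × C => (z, ((z.1, φ z.1) : S × C))) (𝓝 0) (𝓝 (0, 0)) := by
    refine tendsto_id.prodMk_nhds ?_
    have : ContinuousAt (fun z : S × C => (z.1, φ z.1)) 0 :=
      continuous_fst.continuousAt.prodMk hφ1.continuousAt
    rw [ContinuousAt, Prod.fst_zero, hφ.map_zero] at this
    exact this
  have hball : ∀ᶠ z : S × C in 𝓝 0, z.1 ∈ Metric.ball (0 : S) δ :=
    (continuous_fst.tendsto' (0 : S × C) 0 rfl).eventually (Metric.ball_mem_nhds 0 hδ)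
  filter_upwards [htend.eventually hlit, hball] with z hz hzb
  have e1 : z - (z.1, φ z.1) = (0, h z) := by
    ext <;> simp [hh]
  have e2 : h (F (z.1, φ z.1)) = 0 := by
    simp only [hh]
    rw [hinv _ hzb, sub_self]
  simp only [Function.comp, e1, e2, sub_zero, hD, ContinuousLinearMap.comp_apply] at hz
  have e3 : (A.prodMap (B : C →L[ℂ] C)) (0, h z) = (0, B (h z)) := by simp
  rw [e3, hd] at hz
  refine hz.trans (le_of_eq ?_)
  rw [Prod.norm_mk, norm_zero, max_eq_right (norm_nonneg _)]

end GraphTransform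
-- Spectral splitting of the linear part.
section Splitting
open Module.End

theorem ContinuousLinearMap.hasEigenvalue_iff_mem_spectrum {V : Type*} [NormedAddCommGroup V]
    [NormedSpace ℂ V] [FiniteDimensional ℂ V] (T : V →L[ℂ] V) (μ : ℂ) :
    HasEigenvalue (T : V →ₗ[ℂ] V) μ ↔ μ ∈ spectrum ℂ T := by
  rw [Module.End.hasEigenvalue_iff_mem_spectrum,
    ← AlgEquiv.spectrum_eq (Module.End.toContinuousLinearMap V)]
  rfl

theorem eventually_norm_pow_le_of_spectralRadius_lt {A : Type*} [NormedRing A] [NormedAlgebra ℂ A]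
    [CompleteSpace A] (a : A) {r : NNReal} (h : spectralRadius ℂ a < r) :
    ∀ᶠ n : ℕ in atTop, ‖a ^ n‖ ≤ (r : ℝ) ^ n := by
  have h1 := (spectrum.pow_nnnorm_pow_one_div_tendsto_nhds_spectralRadius a).eventually
    (gt_mem_nhds h)
  filter_upwards [h1, eventually_gt_atTop 0] with n hn hn0
  have hn0' : (0 : ℝ) < n := by exact_mod_cast hn0
  have h2 := ENNReal.rpow_le_rpow hn.le hn0'.le
  rw [← ENNReal.rpow_mul, one_div, inv_mul_cancel₀ hn0'.ne', ENNReal.rpow_one,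
    ENNReal.rpow_natCast] at h2
  exact_mod_cast h2

theorem ContinuousLinearMap.spectralRadius_lt_of_eigenvalues {V : Type*} [NormedAddCommGroup V]
    [NormedSpace ℂ V] [FiniteDimensional ℂ V] (T : V →L[ℂ] V) {r : NNReal} (hr : 0 < r)
    (h : ∀ μ : ℂ, HasEigenvalue (T : V →ₗ[ℂ] V) μ → ‖μ‖ < r) : spectralRadius ℂ T < r := by
  have : CompleteSpace V := FiniteDimensional.complete ℂ V
  rcases subsingleton_or_nontrivial V with hV | hV
  · have : T = 0 := Subsingleton.elim _ _
    rw [this]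
    simpa using hr
  · refine spectrum.spectralRadius_lt_of_forall_lt T fun μ hμ => ?_
    exact_mod_cast h μ ((T.hasEigenvalue_iff_mem_spectrum μ).2 hμ)

theorem ContinuousLinearMap.exists_norm_pow_le_of_eigenvalues {V : Type*} [NormedAddCommGroup V]
    [NormedSpace ℂ V] [FiniteDimensional ℂ V] (T : V →L[ℂ] V)
    (h : ∀ μ : ℂ, HasEigenvalue (T : V →ₗ[ℂ] V) μ → ‖μ‖ < 1) :
    ∃ r : ℝ, 0 < r ∧ r < 1 ∧ ∀ᶠ n : ℕ in atTop, ‖T ^ n‖ ≤ r ^ n := by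
  have : CompleteSpace V := FiniteDimensional.complete ℂ V
  have h1 := T.spectralRadius_lt_of_eigenvalues (r := 1) one_pos (by simpa using h)
  obtain ⟨r, hr1, hr2⟩ := ENNReal.lt_iff_exists_nnreal_btwn.1 h1
  have hr0 : (0 : NNReal) < r := by
    have := (zero_le).trans_lt hr1
    exact_mod_cast this
  exact ⟨r, by exact_mod_cast hr0, by exact_mod_cast hr2,
    eventually_norm_pow_le_of_spectralRadius_lt T hr1⟩

/-- The inverse has spectral radius at most one. A constant `R > 1` is needed because Jordan blocks
with eigenvalues of modulus one let the powers grow. -/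
theorem ContinuousLinearEquiv.eventually_norm_symm_pow_le {V : Type*} [NormedAddCommGroup V]
    [NormedSpace ℂ V] [FiniteDimensional ℂ V] (T : V ≃L[ℂ] V)
    (h : ∀ μ : ℂ, HasEigenvalue ((T : V →L[ℂ] V) : V →ₗ[ℂ] V) μ → 1 ≤ ‖μ‖) {R : ℝ} (hR : 1 < R) :
    ∀ᶠ n : ℕ in atTop, ‖(T.symm : V →L[ℂ] V) ^ n‖ ≤ R ^ n := by
  have : CompleteSpace V := FiniteDimensional.complete ℂ V
  lift R to NNReal using by linarith
  refine eventually_norm_pow_le_of_spectralRadius_lt _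
    (ContinuousLinearMap.spectralRadius_lt_of_eigenvalues _ (by exact_mod_cast one_pos.trans hR)
      fun μ hμ => ?_)
  obtain ⟨v, hv⟩ := hμ.exists_hasEigenvector
  have h1 : T.symm v = μ • v := hv.apply_eq_smul
  have hμ0 : μ ≠ 0 := by
    rintro rfl
    rw [zero_smul] at h1
    exact hv.2 (T.symm.map_eq_zero_iff.1 h1)
  have h2 : T v = μ⁻¹ • v := by
    have := congrArg T h1
    rw [T.apply_symm_apply, map_smul] at this
    rw [eq_inv_smul_iff₀ hμ0, ← this]
  have h3 := h μ⁻¹ (hasEigenvalue_of_hasEigenvector ⟨mem_eigenspace_iff.2 h2, hv.2⟩)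
  rw [norm_inv, one_le_inv₀ (norm_pos_iff.2 hμ0)] at h3
  exact h3.trans_lt hR

/-- The attracted vectors form an invariant subspace; if nonzero, it would contain an eigenvector,
whose iterates do not shrink. -/
theorem ContinuousLinearMap.eq_zero_of_tendsto_pow_zero {V : Type*} [NormedAddCommGroup V]
    [NormedSpace ℂ V] [FiniteDimensional ℂ V] (T : V →L[ℂ] V)
    (h : ∀ μ : ℂ, HasEigenvalue (T : V →ₗ[ℂ] V) μ → 1 ≤ ‖μ‖) (N : ℕ) {v : V}
    (hv : Tendsto (fun n : ℕ => ((T ^ N) ^ n) v) atTop (𝓝 0)) : v = 0 := by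
  let K : Submodule ℂ V :=
    { carrier := {v | Tendsto (fun n : ℕ => ((T ^ N) ^ n) v) atTop (𝓝 0)}
      add_mem' := fun {a b} ha hb => by
        simpa only [Set.mem_ofPred_eq, map_add, add_zero] using Tendsto.add ha hb
      zero_mem' := by simpa only [Set.mem_ofPred_eq, map_zero] using tendsto_const_nhds
      smul_mem' := fun c a ha => by
        simpa only [Set.mem_ofPred_eq, map_smul, smul_zero] using Tendsto.const_smul ha c }
  have hK : ∀ v, v ∈ K ↔ Tendsto (fun n : ℕ => ((T ^ N) ^ n) v) atTop (𝓝 0) := fun v => Iff.rfl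
  have hcomm : ∀ (n : ℕ) v, ((T ^ N) ^ n) (T v) = T (((T ^ N) ^ n) v) := fun n v => by
    have := ((Commute.refl T).pow_left N).pow_left n
    exact congrArg (fun f : V →L[ℂ] V => f v) this.eq
  have hTK : ∀ v ∈ K, (T : V →ₗ[ℂ] V) v ∈ K := fun v hv => by
    rw [hK] at hv ⊢
    simp only [ContinuousLinearMap.coe_coe, hcomm]
    exact (T.continuous.tendsto' 0 0 (map_zero T)).comp hv
  suffices hbot : K = ⊥ by
    have : v ∈ K := (hK v).2 hv
    rwa [hbot, Submodule.mem_bot] at this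
  by_contra hne
  have : Nontrivial K := Submodule.nontrivial_iff_ne_bot.2 hne
  obtain ⟨μ, hμ⟩ := exists_eigenvalue ((T : V →ₗ[ℂ] V).restrict hTK)
  obtain ⟨w, hw⟩ := hμ.exists_hasEigenvector
  have hw1 : T w = μ • (w : V) := congrArg Subtype.val hw.apply_eq_smul
  have hw0 : (w : V) ≠ 0 := fun h0 => hw.2 (Subtype.ext h0)
  have hμ1 : 1 ≤ ‖μ‖ := h μ (hasEigenvalue_of_hasEigenvector ⟨mem_eigenspace_iff.2 hw1, hw0⟩)
  have hpow : ∀ n : ℕ, (T ^ n) (w : V) = μ ^ n • (w : V) := fun n => by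
    induction n with
    | zero => simp
    | succ n ih => rw [pow_succ, mul_apply_eq_comp, hw1, map_smul, ih, smul_smul,
        pow_succ, mul_comm]
  have ht := ((hK w).1 w.2).norm
  rw [norm_zero] at ht
  refine hw0 (norm_le_zero_iff.1 (ge_of_tendsto' ht fun n => ?_))
  rw [← pow_mul, hpow, norm_smul, norm_pow]
  exact le_mul_of_one_le_left (norm_nonneg _) (one_le_pow₀ hμ1)

theorem ContinuousLinearEquiv.coe_pow {V : Type*} [NormedAddCommGroup V] [NormedSpace ℂ V]
    (B : V ≃L[ℂ] V) (n : ℕ) : ((B ^ n : V ≃L[ℂ] V) : V →L[ℂ] V) = (B : V →L[ℂ] V) ^ n := by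
  induction n with
  | zero => rfl
  | succ n ih => rw [pow_succ, pow_succ, ← ih]; rfl

/-- The sum of the generalized eigenspaces whose eigenvalues lie in a given set. -/
def spectralSubspace {V : Type*} [AddCommGroup V] [Module ℂ V] (T : Module.End ℂ V) (s : Set ℂ) :
    Submodule ℂ V :=
  ⨆ μ ∈ s, T.maxGenEigenspace μ

theorem mem_spectralSubspace_of_mem {V : Type*} [AddCommGroup V] [Module ℂ V]
    (T : Module.End ℂ V) (s : Set ℂ) {v : V} (hv : v ∈ spectralSubspace T s) :
    T v ∈ spectralSubspace T s := by
  have : spectralSubspace T s ≤ (spectralSubspace T s).comap T := by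
    refine iSup₂_le fun μ hμ v hv => ?_
    exact (le_iSup₂ (f := fun μ (_ : μ ∈ s) => T.maxGenEigenspace μ) μ hμ)
      (mapsTo_maxGenEigenspace_of_comm (Commute.refl T) μ hv)
  exact this hv

theorem isCompl_spectralSubspace {V : Type*} [AddCommGroup V] [Module ℂ V] [FiniteDimensional ℂ V]
    (T : Module.End ℂ V) (s : Set ℂ) : IsCompl (spectralSubspace T s) (spectralSubspace T sᶜ) := by
  refine ⟨T.independent_maxGenEigenspace.disjoint_biSup_biSup disjoint_compl_right, ?_⟩
  rw [codisjoint_iff, eq_top_iff, ← T.iSup_maxGenEigenspace_eq_top]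
  refine iSup_le fun μ => ?_
  by_cases hμ : μ ∈ s
  · exact le_sup_of_le_left (le_iSup₂ (f := fun μ (_ : μ ∈ s) => T.maxGenEigenspace μ) μ hμ)
  · exact le_sup_of_le_right (le_iSup₂ (f := fun μ (_ : μ ∈ sᶜ) => T.maxGenEigenspace μ) μ hμ)

theorem mem_of_hasEigenvector_of_mem_spectralSubspace {V : Type*} [AddCommGroup V] [Module ℂ V]
    (T : Module.End ℂ V) (s : Set ℂ) {μ : ℂ} {v : V} (hv : T.HasEigenvector μ v)
    (hvs : v ∈ spectralSubspace T s) : μ ∈ s := by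
  by_contra hμ
  have := T.independent_maxGenEigenspace.disjoint_biSup hμ
  exact hv.2 (Submodule.disjoint_def.1 this v (eigenspace_le_maxGenEigenspace hv.1) hvs)

/-- A linear map splits, up to passing to a power, into a contracting block and a block that
does not contract any vector. -/
theorem ContinuousLinearMap.exists_dominated_splitting {V : Type} [NormedAddCommGroup V]
    [NormedSpace ℂ V] [FiniteDimensional ℂ V] (T : V →L[ℂ] V) :
    ∃ (S C : Submodule ℂ V) (e : V ≃L[ℂ] S × C) (N : ℕ) (A : S →L[ℂ] S) (B : C ≃L[ℂ] C),
      0 < N ∧ (∀ v, e ((T ^ N) v) = (A (e v).1, B (e v).2)) ∧ ‖A‖ < 1 ∧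
      ‖(B.symm : C →L[ℂ] C)‖ * ‖A‖ < 1 ∧
      (∀ c : C, Tendsto (fun n : ℕ => ((B : C →L[ℂ] C) ^ n) c) atTop (𝓝 0) → c = 0) ∧
      ((∃ μ : ℂ, HasEigenvalue (T : V →ₗ[ℂ] V) μ ∧ 1 ≤ ‖μ‖) → Nontrivial C) := by
  set f : Module.End ℂ V := (T : V →ₗ[ℂ] V) with hf
  set s : Set ℂ := {μ | ‖μ‖ < 1} with hs
  set S := spectralSubspace f s with hS
  set C := spectralSubspace f sᶜ with hC
  have hSC : IsCompl S C := isCompl_spectralSubspace f s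
  let fS : S →ₗ[ℂ] S := f.restrict fun v hv => mem_spectralSubspace_of_mem f s hv
  let fC : C →ₗ[ℂ] C := f.restrict fun v hv => mem_spectralSubspace_of_mem f sᶜ hv
  have hfS : ∀ μ, HasEigenvalue fS μ → ‖μ‖ < 1 := fun μ hμ => by
    obtain ⟨w, hw⟩ := hμ.exists_hasEigenvector
    exact mem_of_hasEigenvector_of_mem_spectralSubspace f s (μ := μ) (v := w)
      ⟨mem_eigenspace_iff.2 (congrArg Subtype.val hw.apply_eq_smul),
        fun h0 => hw.2 (Subtype.ext h0)⟩ w.2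
  have hfC : ∀ μ, HasEigenvalue fC μ → 1 ≤ ‖μ‖ := fun μ hμ => by
    obtain ⟨w, hw⟩ := hμ.exists_hasEigenvector
    have := mem_of_hasEigenvector_of_mem_spectralSubspace f sᶜ (μ := μ) (v := w)
      ⟨mem_eigenspace_iff.2 (congrArg Subtype.val hw.apply_eq_smul),
        fun h0 => hw.2 (Subtype.ext h0)⟩ w.2
    simpa [hs] using this
  have hinj : Function.Injective fC := by
    rw [← LinearMap.ker_eq_bot, LinearMap.ker_eq_bot']
    intro c hc
    by_contra hc0
    have h0 : HasEigenvalue fC 0 := hasEigenvalue_of_hasEigenvector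
      ⟨mem_eigenspace_iff.2 (by rw [hc, zero_smul]), hc0⟩
    have := hfC 0 h0
    simp at this
    linarith
  let A₀ : S →L[ℂ] S := fS.toContinuousLinearMap
  let B₀ : C ≃L[ℂ] C := (LinearEquiv.ofInjectiveEndo fC hinj).toContinuousLinearEquiv
  have hB₀ : ((B₀ : C →L[ℂ] C) : C →ₗ[ℂ] C) = fC := by
    ext c
    rfl
  obtain ⟨r, hr0, hr1, hrA⟩ := A₀.exists_norm_pow_le_of_eigenvalues hfS
  -- This `R` lies strictly between `1` and `r⁻¹`, so that `R * r = (1 + r) / 2 < 1` gives the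
  -- domination for large powers.
  have hB := B₀.eventually_norm_symm_pow_le (by rw [hB₀]; exact hfC) (R := (r⁻¹ + 1) / 2)
    (by have := (one_lt_inv₀ hr0).2 hr1; linarith)
  obtain ⟨N, hN1, hN2, hN0⟩ := (hrA.and (hB.and (eventually_gt_atTop 0))).exists
  let e : V ≃L[ℂ] S × C := (Submodule.prodEquivOfIsCompl S C hSC).symm.toContinuousLinearEquiv
  have he : ∀ v, ((e v).1 : V) + (e v).2 = v := fun v =>
    (Submodule.prodEquivOfIsCompl S C hSC).apply_symm_apply v
  have heT : ∀ v, e (T v) = (A₀ (e v).1, B₀ (e v).2) := fun v => by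
    have h1 : T v = ((A₀ (e v).1 : S) : V) + (B₀ (e v).2 : C) := by
      conv_lhs => rw [← he v, map_add]
      rfl
    rw [h1]
    exact (Submodule.prodEquivOfIsCompl S C hSC).symm_apply_apply (A₀ (e v).1, B₀ (e v).2)
  have hBN : ((B₀ ^ N : C ≃L[ℂ] C) : C →L[ℂ] C) = (B₀ : C →L[ℂ] C) ^ N := B₀.coe_pow N
  have hBNs : (((B₀ ^ N : C ≃L[ℂ] C).symm : C ≃L[ℂ] C) : C →L[ℂ] C)
      = (B₀.symm : C →L[ℂ] C) ^ N := by
    rw [← ContinuousLinearEquiv.coe_pow]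
    exact congrArg _ (inv_pow B₀ N).symm
  refine ⟨S, C, e, N, A₀ ^ N, B₀ ^ N, hN0, ?_, ?_, ?_, ?_, ?_⟩
  · have : ∀ (n : ℕ) v, e ((T ^ n) v) = ((A₀ ^ n) (e v).1, ((B₀ : C →L[ℂ] C) ^ n) (e v).2) := by
      intro n
      induction n with
      | zero => simp
      | succ n ih =>
        intro v
        rw [pow_succ, mul_apply_eq_comp, ih, heT, pow_succ, pow_succ]
        rfl
    intro v
    rw [this, ← hBN]
    rfl
  · exact hN1.trans_lt (pow_lt_one₀ hr0.le hr1 hN0.ne')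
  · rw [hBNs]
    calc _ ≤ ((r⁻¹ + 1) / 2) ^ N * r ^ N := by gcongr
      _ = ((1 + r) / 2) ^ N := by
        rw [← mul_pow]
        congr 1
        field_simp
      _ < 1 := pow_lt_one₀ (by linarith) (by linarith) hN0.ne'
  · intro c hc
    rw [hBN] at hc
    exact (B₀ : C →L[ℂ] C).eq_zero_of_tendsto_pow_zero (by rw [hB₀]; exact hfC) N hc
  · rintro ⟨μ, hμ, h1⟩
    obtain ⟨w, hw⟩ := hμ.exists_hasEigenvector
    have hwC : w ∈ C := (le_iSup₂ (f := fun μ (_ : μ ∈ sᶜ) => f.maxGenEigenspace μ) μ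
      (by simpa [hs] using h1)) (eigenspace_le_maxGenEigenspace hw.1)
    exact ⟨⟨w, hwC⟩, 0, fun h0 => hw.2 (congrArg Subtype.val h0)⟩

end Splitting
-- Attracted curves and contracting neighbourhoods.
section Dynamics

/-- Cauchy's estimate for a leading coefficient: `φ t / tᵏ` extends holomorphically over `0`, and
the maximum principle is applied on the circle of radius `r / 2`. -/
theorem norm_le_of_tendsto_inv_pow_smul {C : Type*} [NormedAddCommGroup C] [NormedSpace ℂ C]
    [CompleteSpace C] {φ : ℂ → C} {r ε : ℝ} {k : ℕ} {c : C} (hr : 0 < r)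
    (hφ : AnalyticOnNhd ℂ φ (Metric.ball 0 r)) (hε : ∀ t ∈ Metric.ball (0 : ℂ) r, ‖φ t‖ ≤ ε)
    (hc : Tendsto (fun t => (t ^ k)⁻¹ • φ t) (𝓝[≠] 0) (𝓝 c)) : ‖c‖ ≤ ((r / 2) ^ k)⁻¹ * ε := by
  set ψ : ℂ → C := Function.update (fun t => (t ^ k)⁻¹ • φ t) 0 c with hψ
  have h1 : ∀ t ∈ Metric.ball (0 : ℂ) r, t ≠ 0 → DifferentiableAt ℂ ψ t := fun t ht h0 => by
    have : DifferentiableAt ℂ (fun t : ℂ => (t ^ k)⁻¹ • φ t) t :=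
      ((differentiableAt_id.pow k).inv (pow_ne_zero k h0)).smul (hφ t ht).differentiableAt
    refine this.congr_of_eventuallyEq ?_
    filter_upwards [isOpen_ne.mem_nhds h0] with s hs
    exact Function.update_of_ne hs _ _
  have h2 : DifferentiableOn ℂ ψ (Metric.ball 0 r) := fun t ht => by
    rcases eq_or_ne t 0 with rfl | h0
    · refine (Complex.analyticAt_of_differentiable_on_punctured_nhds_of_continuousAt ?_
        (continuousAt_update_same.2 hc)).differentiableAt.differentiableWithinAt
      filter_upwards [mem_nhdsWithin_of_mem_nhds (Metric.ball_mem_nhds (0 : ℂ) hr),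
        self_mem_nhdsWithin] with s hs hs0 using h1 s hs hs0
    · exact (h1 t ht h0).differentiableWithinAt
  have h3 : DiffContOnCl ℂ ψ (Metric.ball 0 (r / 2)) :=
    (h2.mono ((Metric.closedBall_subset_ball (by linarith)))).diffContOnCl_ball subset_rfl
  have h4 : ‖ψ 0‖ ≤ ((r / 2) ^ k)⁻¹ * ε := by
    refine Complex.norm_le_of_forall_mem_frontier_norm_le Metric.isBounded_ball h3 (fun t ht => ?_)
      (subset_closure (Metric.mem_ball_self (by linarith)))
    rw [frontier_ball _ (by linarith), mem_sphere_zero_iff_norm] at ht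
    have h0 : t ≠ 0 := by
      rintro rfl
      rw [norm_zero] at ht
      linarith
    rw [hψ, Function.update_of_ne h0, norm_smul, norm_inv, norm_pow, ht]
    gcongr
    exact hε t (by rw [mem_ball_zero_iff, ht]; linarith)
  rwa [hψ, Function.update_self] at h4

/-- Because the defect of the semiconjugacy is `o(h)`, it disappears after division by `tᵏ`, and
each step multiplies the coefficient exactly by `B`. -/
theorem tendsto_inv_pow_smul_iterate {V C : Type*} [NormedAddCommGroup V] [NormedSpace ℂ V]
    [NormedAddCommGroup C] [NormedSpace ℂ C] {G : V → V} {h : V → C} {B : C →L[ℂ] C} (hG0 : G 0 = 0)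
    (hGB : ∀ ε > 0, ∀ᶠ z in 𝓝 0, ‖h (G z) - B (h z)‖ ≤ ε * ‖h z‖) {γ : ℂ → V} (hγ0 : γ 0 = 0)
    (hγ : ∀ n : ℕ, ContinuousAt (fun t => G^[n] (γ t)) 0) {k : ℕ} {c : C}
    (hc : Tendsto (fun t => (t ^ k)⁻¹ • h (γ t)) (𝓝[≠] 0) (𝓝 c)) (n : ℕ) :
    Tendsto (fun t => (t ^ k)⁻¹ • h (G^[n] (γ t))) (𝓝[≠] 0) (𝓝 ((B ^ n) c)) := by
  induction n with
  | zero => simpa using hc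
  | succ n ih =>
    have h0 : Tendsto (fun t => G^[n] (γ t)) (𝓝[≠] 0) (𝓝 0) := by
      have := (hγ n).tendsto
      rw [hγ0, Function.iterate_fixed hG0] at this
      exact this.mono_left nhdsWithin_le_nhds
    have hlit : (fun t : ℂ => (t ^ k)⁻¹ • (h (G (G^[n] (γ t))) - B (h (G^[n] (γ t)))))
        =o[𝓝[≠] 0] fun t => (t ^ k)⁻¹ • h (G^[n] (γ t)) := by
      refine Asymptotics.IsLittleO.of_bound fun ε hε => ?_
      filter_upwards [h0.eventually (hGB ε hε)] with t ht
      rw [norm_smul, norm_smul, mul_left_comm]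
      gcongr
    have hz := (Asymptotics.isLittleO_one_iff ℂ).1 (hlit.trans_isBigO (ih.isBigO_one ℂ))
    have hB := (B.continuous.tendsto _).comp ih
    have := hz.add hB
    rw [zero_add, ← mul_apply_eq_comp, ← pow_succ'] at this
    refine this.congr fun t => ?_
    rw [Function.iterate_succ_apply', Function.comp_apply, map_smul, ← smul_add, sub_add_cancel]

/-- If `h ∘ γ` had a leading coefficient `u 0 ≠ 0`, then `Bⁿ (u 0)` would be the coefficient of the
same order along the `n`-th iterated curve. Uniform attraction on a disc of radius independent of
`n` forces it to zero. -/
theorem eventually_eq_zero_of_iterate_tendsto {V C : Type*} [NormedAddCommGroup V]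
    [NormedSpace ℂ V] [NormedAddCommGroup C] [NormedSpace ℂ C] [CompleteSpace C]
    {G : V → V} {h : V → C} {B : C →L[ℂ] C} (hG0 : G 0 = 0) (hh : AnalyticAt ℂ h 0) (hh0 : h 0 = 0)
    (hGB : ∀ ε > 0, ∀ᶠ z in 𝓝 0, ‖h (G z) - B (h z)‖ ≤ ε * ‖h z‖)
    (hB : ∀ c : C, Tendsto (fun n : ℕ => (B ^ n) c) atTop (𝓝 0) → c = 0)
    {γ : ℂ → V} (hγ0 : γ 0 = 0) {r : ℝ} (hr : 0 < r)
    (hγ : ∀ n : ℕ, AnalyticOnNhd ℂ (fun t => G^[n] (γ t)) (Metric.ball 0 r))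
    (hunif : ∀ ε > 0, ∀ᶠ n : ℕ in atTop, ∀ t ∈ Metric.ball (0 : ℂ) r, ‖G^[n] (γ t)‖ < ε) :
    ∀ᶠ t in 𝓝 0, h (γ t) = 0 := by
  have hmem : (0 : ℂ) ∈ Metric.ball (0 : ℂ) r := Metric.mem_ball_self hr
  have hγa : AnalyticAt ℂ γ 0 := hγ 0 0 hmem
  have hha : AnalyticAt ℂ (fun t => h (γ t)) 0 :=
    AnalyticAt.comp (g := h) (by rw [hγ0]; exact hh) hγa
  by_contra hne
  obtain ⟨k, u, hu, hu0, hku⟩ := hha.exists_eventuallyEq_pow_smul_nonzero_iff.2 hne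
  have hc : Tendsto (fun t => (t ^ k)⁻¹ • h (γ t)) (𝓝[≠] 0) (𝓝 (u 0)) := by
    refine (hu.continuousAt.tendsto.mono_left nhdsWithin_le_nhds).congr' ?_
    filter_upwards [hku.filter_mono nhdsWithin_le_nhds, self_mem_nhdsWithin] with t ht ht0
    rw [ht, sub_zero, inv_smul_smul₀ (pow_ne_zero k ht0)]
  refine hu0 (hB _ (Metric.tendsto_nhds.2 fun ε hε => ?_))
  have hr2 : 0 < (r / 2) ^ k := by positivity
  set η : ℝ := (r / 2) ^ k * (ε / 2) with hη
  have hη0 : 0 < η := by positivity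
  have h1 : ∀ᶠ z in 𝓝 (0 : V), AnalyticAt ℂ h z ∧ ‖h z‖ < η := by
    refine hh.eventually_analyticAt.and ?_
    have := hh.continuousAt.norm.tendsto
    rw [hh0, norm_zero] at this
    exact this.eventually (gt_mem_nhds hη0)
  obtain ⟨δ, hδ, hball⟩ := Metric.eventually_nhds_iff_ball.1 h1
  filter_upwards [hunif δ hδ] with n hn
  have h2 := tendsto_inv_pow_smul_iterate hG0 hGB hγ0 (fun n => (hγ n 0 hmem).continuousAt) hc n
  have h3 := norm_le_of_tendsto_inv_pow_smul hr (φ := fun t => h (G^[n] (γ t))) (ε := η)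
    (fun t ht => AnalyticAt.comp (g := h) (hball _ (mem_ball_zero_iff.2 (hn t ht))).1 (hγ n t ht))
    (fun t ht => (hball _ (mem_ball_zero_iff.2 (hn t ht))).2.le) h2
  rw [dist_zero_right]
  calc _ ≤ ((r / 2) ^ k)⁻¹ * η := h3
    _ = ε / 2 := by rw [hη, inv_mul_cancel_left₀ hr2.ne']
    _ < ε := by linarith

theorem AnalyticAt.iterate_of_fixed {V : Type*} [NormedAddCommGroup V] [NormedSpace ℂ V]
    {F : V → V} (hF : AnalyticAt ℂ F 0) (hF0 : F 0 = 0) (n : ℕ) : AnalyticAt ℂ F^[n] 0 := by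
  induction n with
  | zero => exact analyticAt_id
  | succ n ih =>
    rw [Function.iterate_succ]
    exact AnalyticAt.comp (by rw [hF0]; exact ih) hF

/-- If `D₀F` has an eigenvalue of modulus at least one, some nontrivial analytic function vanishes
along every analytic curve whose iterates under `F` tend uniformly to the origin. -/
theorem exists_vanishing_along_attracted_curves {V : Type} [NormedAddCommGroup V] [NormedSpace ℂ V]
    [FiniteDimensional ℂ V] {F : V → V} (hF : AnalyticAt ℂ F 0) (hF0 : F 0 = 0)
    (hev : ∃ μ : ℂ, Module.End.HasEigenvalue (fderiv ℂ F 0 : V →ₗ[ℂ] V) μ ∧ 1 ≤ ‖μ‖) :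
    ∃ (C : Submodule ℂ V) (h : V → C), AnalyticAt ℂ h 0 ∧ h 0 = 0 ∧ fderiv ℂ h 0 ≠ 0 ∧
      ∀ γ : ℂ → V, γ 0 = 0 → ∀ r > 0,
        (∀ n : ℕ, AnalyticOnNhd ℂ (fun t => F^[n] (γ t)) (Metric.ball 0 r)) →
        (∀ ε > 0, ∀ᶠ n : ℕ in atTop, ∀ t ∈ Metric.ball (0 : ℂ) r, ‖F^[n] (γ t)‖ < ε) →
        ∀ᶠ t in 𝓝 0, h (γ t) = 0 := by
  obtain ⟨S, C, e, N, A, B, hN, heT, hA, hAB, hB, hC⟩ :=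
    (fderiv ℂ F 0).exists_dominated_splitting
  have := hC hev
  set G : S × C → S × C := fun z => e (F^[N] (e.symm z)) with hG
  have hFN : AnalyticAt ℂ F^[N] 0 := hF.iterate_of_fixed hF0 N
  have hFN0 : F^[N] 0 = 0 := Function.iterate_fixed hF0 N
  have hGa : AnalyticAt ℂ G 0 := by
    refine (e.analyticAt _).comp (AnalyticAt.comp (g := F^[N]) ?_ (e.symm.analyticAt 0))
    rwa [map_zero]
  have hG0 : G 0 = 0 := by simp [hG, hFN0]
  have hFd : HasFDerivAt F^[N] (fderiv ℂ F 0 ^ N) 0 :=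
    hF.differentiableAt.hasFDerivAt.iterate hF0 N
  have hGd : fderiv ℂ G 0 = A.prodMap (B : C →L[ℂ] C) := by
    have h1 : HasFDerivAt G ((e : V →L[ℂ] S × C).comp
        ((fderiv ℂ F 0 ^ N).comp (e.symm : S × C →L[ℂ] V))) 0 := by
      refine e.hasFDerivAt.comp (0 : S × C) (HasFDerivAt.comp (0 : S × C) ?_ e.symm.hasFDerivAt)
      rwa [map_zero]
    rw [h1.fderiv]
    refine ContinuousLinearMap.ext fun z => ?_
    have := heT (e.symm z)
    rw [e.apply_symm_apply] at this
    exact this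
  obtain ⟨h₀, hh, hh0, hhd, hsemi⟩ := exists_semiconjugacy hGa hG0 hGd hA hAB
  have h_an : AnalyticAt ℂ (h₀ ∘ e) 0 :=
    AnalyticAt.comp (by rwa [map_zero]) (e.analyticAt 0)
  refine ⟨C, h₀ ∘ e, h_an, by simp [hh0], ?_, fun γ hγ0 r hr hγ hunif => ?_⟩
  · obtain ⟨c, hc⟩ := exists_ne (0 : C)
    intro hz
    have h1 : HasFDerivAt (h₀ ∘ e) ((fderiv ℂ h₀ 0).comp (e : V →L[ℂ] S × C)) 0 := by
      refine HasFDerivAt.comp (0 : V) ?_ e.hasFDerivAt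
      rw [map_zero]
      exact hh.differentiableAt.hasFDerivAt
    rw [h1.fderiv] at hz
    have h2 := congrArg (fun L : V →L[ℂ] C => L (e.symm (0, c))) hz
    simp only [ContinuousLinearMap.comp_apply, ContinuousLinearEquiv.coe_coe,
      e.apply_symm_apply, hhd] at h2
    exact hc h2
  · have hit : ∀ n, (F^[N])^[n] = F^[N * n] := fun n => (Function.iterate_mul F N n).symm
    refine eventually_eq_zero_of_iterate_tendsto (G := F^[N]) (h := h₀ ∘ e) (B := (B : C →L[ℂ] C))
      hFN0 h_an (by simp [hh0]) (fun ε hε => ?_) hB hγ0 hr (fun n => ?_) (fun ε hε => ?_)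
    · have := (e.continuous.tendsto' 0 0 (map_zero e)).eventually (hsemi ε hε)
      filter_upwards [this] with z hz
      simpa [hG] using hz
    · rw [hit]
      exact hγ _
    · have := (tendsto_id.const_mul_atTop' hN).eventually (hunif ε hε)
      filter_upwards [this] with n hn
      rw [hit]
      exact hn

/-- A map whose linear part at a fixed point has all eigenvalues in the open unit disc has
arbitrarily small contracting neighbourhoods. -/
theorem exists_contracting_nhds {V : Type*} [NormedAddCommGroup V] [NormedSpace ℂ V]
    [FiniteDimensional ℂ V] {F : V → V} (hF : DifferentiableAt ℂ F 0) (hF0 : F 0 = 0)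
    (hev : ∀ μ : ℂ, Module.End.HasEigenvalue (fderiv ℂ F 0 : V →ₗ[ℂ] V) μ → ‖μ‖ < 1)
    {W : Set V} (hW : IsOpen W) (hW0 : 0 ∈ W) :
    ∃ U : Set V, IsOpen U ∧ 0 ∈ U ∧ U ⊆ W ∧ (∃ K : Set V, IsCompact K ∧ F '' U ⊆ K ∧ K ⊆ U) ∧
      ⋂ n : ℕ, F^[n] '' U = {0} := by
  have : ProperSpace V := FiniteDimensional.proper ℂ V
  set T := fderiv ℂ F 0 with hT
  obtain ⟨r, hr0, hr1, hr⟩ := T.exists_norm_pow_le_of_eigenvalues hev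
  obtain ⟨N, hN, hN0⟩ := (hr.and (eventually_gt_atTop 0)).exists
  -- A norm adapted to `T`: since `‖T ^ N‖ ≤ r ^ N`, shifting the sum by one index shows `q (T x) ≤
  -- r * q x`.
  set q : V → ℝ := fun x => ∑ k ∈ Finset.range N, (r ^ k)⁻¹ * ‖(T ^ k) x‖ with hq
  have hqc : Continuous q := by
    refine continuous_finsetSum _ fun k _ => continuous_const.mul ?_
    exact (T ^ k).continuous.norm
  have hq0 : q 0 = 0 := by simp [hq]
  have hqn : ∀ x, ‖x‖ ≤ q x := fun x => by
    have := Finset.single_le_sum (f := fun k => (r ^ k)⁻¹ * ‖(T ^ k) x‖)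
      (fun k _ => by positivity) (Finset.mem_range.2 hN0)
    simpa only [pow_zero, inv_one, one_mul, one_apply_eq_self] using this
  have hqadd : ∀ x y, q (x + y) ≤ q x + q y := fun x y => by
    rw [hq, ← Finset.sum_add_distrib]
    refine Finset.sum_le_sum fun k _ => ?_
    rw [← mul_add, map_add]
    gcongr
    exact norm_add_le _ _
  set M : ℝ := ∑ k ∈ Finset.range N, (r ^ k)⁻¹ * ‖T ^ k‖ with hM
  have hM0 : 0 ≤ M := Finset.sum_nonneg fun k _ => by positivity
  have hqM : ∀ x, q x ≤ M * ‖x‖ := fun x => by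
    rw [hq, hM, Finset.sum_mul]
    refine Finset.sum_le_sum fun k _ => ?_
    rw [mul_assoc]
    gcongr
    exact (T ^ k).le_opNorm x
  have hqT : ∀ x, q (T x) ≤ r * q x := fun x => by
    have h1 : q (T x) = r * ∑ k ∈ Finset.range N, (r ^ (k + 1))⁻¹ * ‖(T ^ (k + 1)) x‖ := by
      rw [hq, Finset.mul_sum]
      refine Finset.sum_congr rfl fun k _ => ?_
      rw [pow_succ T, mul_apply_eq_comp, pow_succ]
      field_simp
    have h2 := Finset.sum_range_succ' (fun k => (r ^ k)⁻¹ * ‖(T ^ k) x‖) N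
    rw [Finset.sum_range_succ] at h2
    have h3 : (r ^ N)⁻¹ * ‖(T ^ N) x‖ ≤ ‖x‖ := by
      rw [inv_mul_le_iff₀ (by positivity)]
      exact ((T ^ N).le_opNorm x).trans (by gcongr)
    rw [h1]
    gcongr
    simp only [pow_zero, inv_one, one_mul, one_apply_eq_self] at h2
    simp only [hq]
    linarith
  set r' := (1 + r) / 2 with hr'
  -- With this tolerance the nonlinear part costs at most `(1 - r) / 2` in the norm `q`, so `F`
  -- still contracts by `r' = (1 + r) / 2`. The `+ 1` avoids division by zero.
  have hε : 0 < (1 - r) / 2 / (M + 1) := by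
    have : 0 < 1 - r := by linarith
    positivity
  have hlit := hF.hasFDerivAt.isLittleO.def hε
  simp only [hF0, sub_zero] at hlit
  have hqF : ∀ᶠ x in 𝓝 (0 : V), q (F x) ≤ r' * q x := by
    filter_upwards [hlit] with x hx
    have h1 : q (F x) ≤ q (F x - T x) + q (T x) := by
      have := hqadd (F x - T x) (T x)
      rwa [sub_add_cancel] at this
    have h2 : q (F x - T x) ≤ (1 - r) / 2 * q x := by
      calc _ ≤ M * ‖F x - T x‖ := hqM _
        _ ≤ (M + 1) * ((1 - r) / 2 / (M + 1) * ‖x‖) := by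
          gcongr
          linarith
        _ = (1 - r) / 2 * ‖x‖ := by field_simp
        _ ≤ _ := by
          have : 0 ≤ 1 - r := by linarith
          gcongr
          exact hqn x
    have := hqT x
    rw [hr']
    linarith
  obtain ⟨δ, hδ, hball⟩ := Metric.eventually_nhds_iff_ball.1 (hqF.and (hW.mem_nhds hW0))
  have hsub : ∀ x, q x < δ → x ∈ Metric.ball (0 : V) δ := fun x hx =>
    mem_ball_zero_iff.2 ((hqn x).trans_lt hx)
  have hr'0 : 0 < r' := by rw [hr']; linarith
  have hr'1 : r' < 1 := by rw [hr']; linarith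
  have hiter : ∀ n : ℕ, ∀ x, q x < δ → q (F^[n] x) ≤ r' ^ n * δ ∧ q (F^[n] x) < δ := by
    intro n x hx
    induction n with
    | zero => simpa using ⟨hx.le, hx⟩
    | succ n ih =>
      rw [Function.iterate_succ_apply']
      have h1 := (hball _ (hsub _ ih.2)).1
      have h2 : q (F (F^[n] x)) ≤ r' ^ (n + 1) * δ := by
        rw [pow_succ', mul_assoc]
        exact h1.trans (by gcongr; exact ih.1)
      exact ⟨h2, h2.trans_lt (mul_lt_of_lt_one_left hδ (pow_lt_one₀ hr'0.le hr'1 n.succ_ne_zero))⟩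
  refine ⟨{x | q x < δ}, isOpen_lt hqc continuous_const, by simpa [hq0] using hδ,
    fun x hx => (hball x (hsub x hx)).2, ⟨{x | q x ≤ r' * δ}, ?_, ?_, ?_⟩, ?_⟩
  · refine (isCompact_closedBall (0 : V) (r' * δ)).of_isClosed_subset
      (isClosed_le hqc continuous_const) fun x hx => ?_
    exact mem_closedBall_zero_iff.2 ((hqn x).trans hx)
  · rintro _ ⟨x, hx, rfl⟩
    simpa using (hiter 1 x hx).1
  · intro x hx
    exact lt_of_le_of_lt hx (mul_lt_of_lt_one_left hδ hr'1)
  · refine Set.Subset.antisymm (fun y hy => ?_) ?_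
    · rw [Set.mem_iInter] at hy
      have hlim : Tendsto (fun n : ℕ => r' ^ n * δ) atTop (𝓝 0) := by
        simpa using (tendsto_pow_atTop_nhds_zero_of_lt_one hr'0.le hr'1).mul_const δ
      refine norm_le_zero_iff.1 (ge_of_tendsto' hlim fun n => ?_)
      obtain ⟨x, hx, rfl⟩ := hy n
      exact (hqn _).trans (hiter n x hx).1
    · rintro _ rfl
      exact Set.mem_iInter.2 fun n => ⟨0, by simpa [hq0] using hδ, Function.iterate_fixed hF0 n⟩

end Dynamics
-- Germs of embeddings and changes of target.
section Embeddings

/-- The analytic inverse function theorem at a fixed point of a self-map. -/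
theorem AnalyticAt.exists_analytic_inverse {V : Type*} [NormedAddCommGroup V] [NormedSpace ℂ V]
    [FiniteDimensional ℂ V] {f : V → V} (hf : AnalyticAt ℂ f 0) (hf0 : f 0 = 0)
    (hd : Function.Injective (fderiv ℂ f 0)) :
    ∃ g : V → V, AnalyticAt ℂ g 0 ∧ g 0 = 0 ∧ (∀ᶠ x in 𝓝 0, g (f x) = x) ∧
      ∀ᶠ x in 𝓝 0, f (g x) = x := by
  have : CompleteSpace V := FiniteDimensional.complete ℂ V
  let e : V ≃L[ℂ] V :=
    (LinearEquiv.ofInjectiveEndo (fderiv ℂ f 0 : V →ₗ[ℂ] V) hd).toContinuousLinearEquiv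
  have he : fderiv ℂ f 0 = (e : V →L[ℂ] V) := by
    ext v
    rfl
  have hs : HasStrictFDerivAt f (e : V →L[ℂ] V) 0 := he ▸ hf.hasStrictFDerivAt
  refine ⟨hs.localInverse f e 0, ?_, ?_, hs.eventually_left_inverse, ?_⟩
  · have := (hs.toOpenPartialHomeomorph f).analyticAt_symm' (a := 0) (i := e)
      hs.mem_toOpenPartialHomeomorph_source hf he
    rw [hs.toOpenPartialHomeomorph_coe, hf0] at this
    exact this
  · have := hs.localInverse_apply_image
    rwa [hf0] at this
  · have := hs.eventually_right_inverse
    rwa [hf0] at this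

theorem coe_mem_localRing_affineGerm {d : ℕ} (h : (Fin d → ℂ) → ℂ) :
    (h : Germ (𝓝 (0 : Fin d → ℂ)) ℂ) ∈ (affineGerm d).localRing ↔ AnalyticAt ℂ h 0 := by
  constructor
  · rintro ⟨H, hH, e⟩
    exact hH.congr (Germ.coe_eq.1 e).symm
  · intro h
    exact ⟨_, h, rfl⟩

theorem isMorphism_affineGerm_iff {d m : ℕ} (F : (Fin d → ℂ) → (Fin m → ℂ)) :
    (affineGerm d).IsMorphism (affineGerm m) F ↔ F 0 = 0 ∧ AnalyticAt ℂ F 0 := by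
  constructor
  · rintro ⟨h0, -, h⟩
    refine ⟨h0, analyticAt_pi_iff.2 fun i => ?_⟩
    refine (coe_mem_localRing_affineGerm _).1 (h (fun z => z i) ?_)
    exact (coe_mem_localRing_affineGerm _).2
      ((ContinuousLinearMap.proj (R := ℂ) (φ := fun _ : Fin m => ℂ) i).analyticAt 0)
  · rintro ⟨h0, h⟩
    refine ⟨h0, h.eventually_analyticAt.mono fun x hx => hx.continuousAt, fun k hk => ?_⟩
    rw [coe_mem_localRing_affineGerm] at hk ⊢
    exact AnalyticAt.comp (by rwa [h0]) h

theorem isAutomorphism_affineGerm_iff {d : ℕ} (F : (Fin d → ℂ) → (Fin d → ℂ)) :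
    (affineGerm d).IsAutomorphism F ↔
      F 0 = 0 ∧ AnalyticAt ℂ F 0 ∧ Function.Injective (fderiv ℂ F 0) := by
  constructor
  · rintro ⟨hF, G, hG, hGF, -⟩
    rw [isMorphism_affineGerm_iff] at hF hG
    refine ⟨hF.1, hF.2, ?_⟩
    have h1 : HasFDerivAt (G ∘ F) ((fderiv ℂ G 0).comp (fderiv ℂ F 0)) 0 := by
      refine HasFDerivAt.comp (0 : Fin d → ℂ) ?_ hF.2.differentiableAt.hasFDerivAt
      rw [hF.1]
      exact hG.2.differentiableAt.hasFDerivAt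
    have h2 := h1.unique ((hasFDerivAt_id (0 : Fin d → ℂ)).congr_of_eventuallyEq hGF)
    exact Function.LeftInverse.injective (g := fderiv ℂ G 0) fun v =>
      congrArg (fun L : (Fin d → ℂ) →L[ℂ] (Fin d → ℂ) => L v) h2
  · rintro ⟨h0, ha, hd⟩
    obtain ⟨g, hg, hg0, h1, h2⟩ := ha.exists_analytic_inverse h0 hd
    exact ⟨(isMorphism_affineGerm_iff F).2 ⟨h0, ha⟩, g, (isMorphism_affineGerm_iff g).2 ⟨hg0, hg⟩,
      h1, h2⟩

namespace IsClosedImmersionGerm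

variable {X : Type*} [TopologicalSpace X] {x₀ : X} {O : Subring (Germ (𝓝 x₀) ℂ)} {d : ℕ}
  {ι : X → (Fin d → ℂ)}

theorem exists_open_of_mem_nhds {U s : Set X} (hx : x₀ ∈ U)
    (he : IsEmbedding (U.domRestrict ι)) (hs : s ∈ 𝓝 x₀) :
    ∃ Ω : Set (Fin d → ℂ), IsOpen Ω ∧ ι x₀ ∈ Ω ∧ ∀ x ∈ U, ι x ∈ Ω → x ∈ s := by
  have h1 : Subtype.val ⁻¹' s ∈ 𝓝 (⟨x₀, hx⟩ : U) := continuous_subtype_val.continuousAt hs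
  rw [he.isInducing.nhds_eq_comap, mem_comap] at h1
  obtain ⟨t, ht, hts⟩ := h1
  obtain ⟨Ω, hΩt, hΩ, hmem⟩ := mem_nhds_iff.1 ht
  exact ⟨Ω, hΩ, hmem, fun x hxU hxΩ => hts (a := ⟨x, hxU⟩) (hΩt hxΩ)⟩

theorem tendsto (hι : IsClosedImmersionGerm x₀ O ι) : Tendsto ι (𝓝 x₀) (𝓝 0) := by
  obtain ⟨h0, ⟨U, Ω, r, g, hU, hx, hΩ, he, hg, himg⟩, hO⟩ := hι
  have := (continuousOn_iff_continuous_domRestrict.2 he.continuous).continuousAt (hU.mem_nhds hx)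
  rw [ContinuousAt, h0] at this
  exact this

/-- Each component lifts because the local ring consists of pullbacks. Extensions of automorphisms
and transition maps between embeddings both arise this way. -/
theorem exists_factor (hι : IsClosedImmersionGerm x₀ O ι) {m : ℕ} {ψ : X → (Fin m → ℂ)}
    (h0 : ψ x₀ = 0) (hψ : ∀ i, ((fun x => ψ x i : X → ℂ) : Germ (𝓝 x₀) ℂ) ∈ O) :
    ∃ G : (Fin d → ℂ) → (Fin m → ℂ), AnalyticAt ℂ G 0 ∧ G 0 = 0 ∧ ∀ᶠ x in 𝓝 x₀, G (ι x) = ψ x := by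
  choose G hG hGe using fun i => (hι.2.2 _).1 (hψ i)
  have h1 : ∀ᶠ x in 𝓝 x₀, (fun i => G i (ι x)) = ψ x := by
    filter_upwards [eventually_all.2 hGe] with x hx
    exact funext fun i => (hx i).symm
  refine ⟨fun z i => G i z, analyticAt_pi_iff.2 hG, ?_, h1⟩
  have := h1.self_of_nhds
  rwa [hι.1, h0] at this

theorem coord_mem (hι : IsClosedImmersionGerm x₀ O ι) (i : Fin d) :
    ((fun x => ι x i : X → ℂ) : Germ (𝓝 x₀) ℂ) ∈ O :=
  (hι.2.2 _).2 ⟨fun z => z i,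
    (ContinuousLinearMap.proj (R := ℂ) (φ := fun _ : Fin d => ℂ) i).analyticAt 0,
    Eventually.of_forall fun _ => rfl⟩

/-- Changing the target of an embedding by analytic maps that are mutually inverse on its image. -/
theorem comp (hι : IsClosedImmersionGerm x₀ O ι) {m : ℕ} {B : (Fin d → ℂ) → (Fin m → ℂ)}
    {A : (Fin m → ℂ) → (Fin d → ℂ)} (hB : AnalyticAt ℂ B 0) (hB0 : B 0 = 0) (hA : AnalyticAt ℂ A 0)
    (hA0 : A 0 = 0) (hAB : ∀ᶠ x in 𝓝 x₀, A (B (ι x)) = ι x) :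
    IsClosedImmersionGerm x₀ O (B ∘ ι) := by
  have hιt := hι.tendsto
  obtain ⟨h0, ⟨U, Ω, r, g, hU, hx, hΩ, he, hg, himg⟩, hO⟩ := hι
  have hcU : ContinuousOn ι U := continuousOn_iff_continuous_domRestrict.2 he.continuous
  have hUΩ : ∀ x ∈ U, ι x ∈ Ω ∧ g (ι x) = 0 := fun x hx => by
    have : ι x ∈ ι '' U := ⟨x, hx, rfl⟩
    rwa [himg] at this
  obtain ⟨Ω₁, hΩ₁, hmem₁, hΩ₁s⟩ := exists_open_of_mem_nhds hx he hAB
  rw [h0] at hmem₁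
  set Ω₂ : Set (Fin d → ℂ) := Ω ∩ (Ω₁ ∩ {z | AnalyticAt ℂ B z}) with hΩ₂
  have hΩ₂o : IsOpen Ω₂ := hΩ.inter (hΩ₁.inter (isOpen_analyticAt ℂ B))
  have hmem₂ : (0 : Fin d → ℂ) ∈ Ω₂ := ⟨h0 ▸ (hUΩ x₀ hx).1, hmem₁, hB⟩
  set D : Set (Fin m → ℂ) := {w | AnalyticAt ℂ A w} with hD
  have hDo : IsOpen D := isOpen_analyticAt ℂ A
  have hBc : ContinuousOn B Ω₂ := fun z hz => hz.2.2.continuousAt.continuousWithinAt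
  have hAc : ContinuousOn A D := fun w hw => AnalyticAt.continuousAt hw |>.continuousWithinAt
  set U' : Set X := U ∩ ι ⁻¹' (Ω₂ ∩ B ⁻¹' D) with hU'
  have hABU : ∀ x ∈ U', A (B (ι x)) = ι x := fun x hx => hΩ₁s x hx.1 hx.2.1.2.1
  have hU'U : U' ⊆ U := Set.inter_subset_left
  -- The new image is cut out by `g (A w) = 0`, which puts `A w` on the old image, and `B (A w) =
  -- w`, which puts `w` on its image under `B`.
  refine ⟨by rw [Function.comp, h0, hB0], ⟨U', D ∩ A ⁻¹' Ω₂, r + m,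
    fun w => Fin.append (g (A w)) (B (A w) - w), ?_, ?_, ?_, ?_, ?_, ?_⟩, fun h => ?_⟩
  · exact hcU.isOpen_inter_preimage hU (hBc.isOpen_inter_preimage hΩ₂o hDo)
  · refine ⟨hx, ?_, ?_⟩
    · rw [h0]
      exact hmem₂
    · rw [Set.mem_preimage, h0, hB0]
      exact hA
  · exact hAc.isOpen_inter_preimage hDo hΩ₂o
  · let f : U' → D := fun x => ⟨B (ι x), x.2.2.2⟩
    have hf : Continuous f := by
      refine Continuous.subtype_mk ?_ _
      exact continuousOn_iff_continuous_domRestrict.1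
        (hBc.comp (hcU.mono hU'U) fun x hx => hx.2.1)
    have h1 : IsEmbedding (D.domRestrict A ∘ f) := by
      have h2 : D.domRestrict A ∘ f = U.domRestrict ι ∘ Set.inclusion hU'U :=
        funext fun x => hABU x x.2
      rw [h2]
      exact he.comp (.inclusion hU'U)
    exact IsEmbedding.subtypeVal.comp
      (.of_comp hf (continuousOn_iff_continuous_domRestrict.1 hAc) h1)
  · intro w hw
    have h1 : AnalyticAt ℂ (fun w => g (A w)) w := (hg (A w) hw.2.1).comp hw.1
    have h2 : AnalyticAt ℂ (fun w => B (A w) - w) w :=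
      (AnalyticAt.comp (g := B) hw.2.2.2 hw.1).sub analyticAt_id
    refine analyticAt_pi_iff.2 fun i => ?_
    refine Fin.addCases (fun i => ?_) (fun i => ?_) i
    · simpa only [Fin.append_left] using analyticAt_pi_iff.1 h1 i
    · simpa only [Fin.append_right] using analyticAt_pi_iff.1 h2 i
  · ext w
    constructor
    · rintro ⟨x, hx, rfl⟩
      have hAx := hABU x hx
      refine ⟨⟨hx.2.2, ?_⟩, ?_⟩
      · rw [Set.mem_preimage, Function.comp_apply, hAx]
        exact hx.2.1
      · simp only [Function.comp_apply, hAx, (hUΩ x hx.1).2, sub_self]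
        funext i
        refine Fin.addCases (fun i => ?_) (fun i => ?_) i <;> simp
    · rintro ⟨hw, hgw⟩
      have h1 : g (A w) = 0 := funext fun i => by
        simpa using congrFun hgw (Fin.castAdd m i)
      have h2 : B (A w) = w := sub_eq_zero.1 <| funext fun i => by
        simpa using congrFun hgw (Fin.natAdd r i)
      have h3 : A w ∈ ι '' U := by
        rw [himg]
        exact ⟨hw.2.1, h1⟩
      obtain ⟨x, hxU, hxw⟩ := h3
      refine ⟨x, ⟨hxU, ?_, ?_⟩, ?_⟩
      · rw [hxw]
        exact hw.2
      · rw [Set.mem_preimage, hxw, h2]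
        exact hw.1
      · rw [Function.comp_apply, hxw, h2]
  · rw [hO]
    constructor
    · rintro ⟨H, hH, e⟩
      refine ⟨H ∘ A, AnalyticAt.comp (by rwa [hA0]) hA, ?_⟩
      filter_upwards [e, hAB] with x hx hx2
      rw [hx, Function.comp_apply, Function.comp_apply, Function.comp_apply, Function.comp_apply,
        hx2]
    · rintro ⟨H, hH, e⟩
      exact ⟨H ∘ B, AnalyticAt.comp (by rwa [hB0]) hB, e⟩

/-- An analytic function with nonzero differential that vanishes on the image of an embedding
lowers the dimension of the target. -/
theorem exists_lower_of_vanishing (hι : IsClosedImmersionGerm x₀ O ι) {H : (Fin d → ℂ) → ℂ}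
    (hH : AnalyticAt ℂ H 0) (hHι : ∀ᶠ x in 𝓝 x₀, H (ι x) = 0) (hd : fderiv ℂ H 0 ≠ 0) :
    ∃ m < d, ∃ j : X → (Fin m → ℂ), IsClosedImmersionGerm x₀ O j := by
  obtain ⟨v, hv⟩ : ∃ v, fderiv ℂ H 0 v ≠ 0 := by
    by_contra! h
    exact hd (ContinuousLinearMap.ext h)
  have hH0 : H 0 = 0 := by
    have := hHι.self_of_nhds
    rwa [hι.1] at this
  have hv0 : v ≠ 0 := by
    rintro rfl
    exact hv (map_zero _)
  cases d with
  | zero => exact absurd (Subsingleton.elim v 0) hv0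
  | succ m =>
    obtain ⟨e₁, he₁⟩ := SeparatingDual.exists_continuousLinearEquiv_apply_eq (R := ℂ) hv0
      (y := (finSuccSplit m).symm (0, 1)) (by simp)
    set e : (Fin (m + 1) → ℂ) ≃L[ℂ] (Fin m → ℂ) × ℂ := e₁.trans (finSuccSplit m) with he
    have hev : e v = (0, 1) := by simp [he, he₁]
    -- `H` replaces the coordinate along `v`, where its derivative is nonzero. In these coordinates
    -- the image of `ι` lies in a hyperplane, so the other `m` coordinates still embed.
    set Φ : (Fin (m + 1) → ℂ) → (Fin (m + 1) → ℂ) := fun z => e.symm ((e z).1, H z) with hΦ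
    set p : (Fin (m + 1) → ℂ) →L[ℂ] (Fin m → ℂ) :=
      (ContinuousLinearMap.fst ℂ (Fin m → ℂ) ℂ).comp
        (e : (Fin (m + 1) → ℂ) →L[ℂ] (Fin m → ℂ) × ℂ) with hp
    have hfst : AnalyticAt ℂ (fun z => (e z).1) 0 := p.analyticAt 0
    have hΦa : AnalyticAt ℂ Φ 0 := (e.symm.analyticAt _).comp (hfst.prod hH)
    have hΦ0 : Φ 0 = 0 := by simp [hΦ, hH0]
    have hΦd : HasFDerivAt Φ ((e.symm : (Fin m → ℂ) × ℂ →L[ℂ] _).comp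
        (p.prod (fderiv ℂ H 0))) 0 := by
      refine e.symm.hasFDerivAt.comp (0 : Fin (m + 1) → ℂ) (HasFDerivAt.prodMk ?_
        hH.differentiableAt.hasFDerivAt)
      exact p.hasFDerivAt
    have hinj : Function.Injective (fderiv ℂ Φ 0) := by
      rw [hΦd.fderiv, injective_iff_map_eq_zero]
      intro z hz
      have h1 := e.symm.map_eq_zero_iff.1 hz
      have h2 : (e z).1 = 0 := congrArg Prod.fst h1
      have h3 : fderiv ℂ H 0 z = 0 := congrArg Prod.snd h1
      have h4 : z = (e z).2 • v := by
        apply e.injective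
        rw [map_smul, hev]
        ext <;> simp [h2]
      rw [h4, map_smul, smul_eq_mul] at h3
      rw [h4, (mul_eq_zero.1 h3).resolve_right hv, zero_smul]
    obtain ⟨Ψ, hΨ, hΨ0, hΨΦ, -⟩ := hΦa.exists_analytic_inverse hΦ0 hinj
    refine ⟨m, m.lt_succ_self, (fun z => (e z).1) ∘ ι,
      hι.comp (A := fun w => Ψ (e.symm (w, 0))) hfst (by simp) ?_ ?_ ?_⟩
    · refine AnalyticAt.comp (g := Ψ) ?_ ?_
      · have : e.symm ((0 : Fin m → ℂ), (0 : ℂ)) = 0 := map_zero e.symm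
        rwa [this]
      exact (e.symm.analyticAt _).comp (analyticAt_id.prod analyticAt_const)
    · have : e.symm ((0 : Fin m → ℂ), (0 : ℂ)) = 0 := map_zero e.symm
      rw [this, hΨ0]
    · filter_upwards [hHι, hι.tendsto.eventually hΨΦ] with x hx hx2
      simp only [hΦ, hx] at hx2
      exact hx2

end IsClosedImmersionGerm
end Embeddings
-- Good embeddings, contraction and the equivalences.
namespace Singularity

variable {X : Type*} [TopologicalSpace X] {x₀ : X} {S : Singularity X x₀} {d : ℕ}
  {ι : X → (Fin d → ℂ)}

theorem isEmbeddingGerm_id (d : ℕ) : (affineGerm d).IsEmbeddingGerm (id : (Fin d → ℂ) → _) := by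
  refine ⟨rfl, ⟨Set.univ, Set.univ, 0, 0, isOpen_univ, trivial, isOpen_univ,
    IsEmbedding.subtypeVal, analyticOnNhd_const, by ext z; simp⟩, fun h => ?_⟩
  rw [coe_mem_localRing_affineGerm]
  constructor
  · intro hh
    exact ⟨h, hh, EventuallyEq.rfl⟩
  · rintro ⟨H, hH, e⟩
    exact hH.congr e.symm

theorem isAutomorphism_id (S : Singularity X x₀) : S.IsAutomorphism id := by
  have : S.IsMorphism S id := ⟨rfl, Eventually.of_forall fun _ => continuousAt_id, fun h hh => hh⟩
  exact ⟨this, id, this, EventuallyEq.rfl, EventuallyEq.rfl⟩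

theorem IsMorphism.tendsto {f : X → X} (hf : S.IsMorphism S f) : Tendsto f (𝓝 x₀) (𝓝 x₀) := by
  have := hf.2.1.self_of_nhds
  rwa [ContinuousAt, hf.1] at this

theorem IsMorphism.exists_extension {f : X → X} (hf : S.IsMorphism S f)
    (hι : S.IsEmbeddingGerm ι) : ∃ F, S.IsExtension ι f F := by
  obtain ⟨F, hF, hF0, hFe⟩ := hι.exists_factor (ψ := fun x => ι (f x)) (by rw [hf.1, hι.1])
    fun i => hf.2.2 _ (hι.coord_mem i)
  exact ⟨F, (isMorphism_affineGerm_iff F).2 ⟨hF0, hF⟩, hFe⟩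

theorem fderiv_eq_zero_of_vanishing (hι : S.IsEmbeddingGerm ι) (hd : d = S.embeddingDimension)
    {E : Type*} [NormedAddCommGroup E] [NormedSpace ℂ E] {H : (Fin d → ℂ) → E}
    (hH : AnalyticAt ℂ H 0) (hHι : ∀ ℓ : E →L[ℂ] ℂ, ∀ᶠ x in 𝓝 x₀, ℓ (H (ι x)) = 0) :
    fderiv ℂ H 0 = 0 := by
  ext1 v
  refine SeparatingDual.eq_zero_of_forall_dual_eq_zero (R := ℂ) fun ℓ => ?_
  have h1 : fderiv ℂ (fun z => ℓ (H z)) 0 = 0 := by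
    by_contra hne
    obtain ⟨m, hm, j, hj⟩ := hι.exists_lower_of_vanishing ((ℓ.analyticAt _).comp hH) (hHι ℓ) hne
    have : S.embeddingDimension ≤ m := Nat.sInf_le ⟨j, hj⟩
    omega
  have h2 : HasFDerivAt (fun z => ℓ (H z)) (ℓ.comp (fderiv ℂ H 0)) 0 :=
    ℓ.hasFDerivAt.comp (0 : Fin d → ℂ) hH.differentiableAt.hasFDerivAt
  rw [h2.fderiv] at h1
  exact congrArg (fun L : (Fin d → ℂ) →L[ℂ] ℂ => L v) h1

/-- An extension `G` of the inverse germ makes `G ∘ F - id` vanish on the image, so by minimality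
`D₀G` is a left inverse of `D₀F`. -/
theorem isGoodEmbedding_of_eq_embeddingDimension (hι : S.IsEmbeddingGerm ι)
    (hd : d = S.embeddingDimension) : S.IsGoodEmbedding ι := by
  rintro f ⟨hf, g, hg, hgf, -⟩ F ⟨hF, hFe⟩
  obtain ⟨G, hG, hGe⟩ := hg.exists_extension hι
  rw [isMorphism_affineGerm_iff] at hF hG
  have hGF : AnalyticAt ℂ (fun z => G (F z)) 0 :=
    AnalyticAt.comp (g := G) (by rw [hF.1]; exact hG.2) hF.2
  have hv : ∀ᶠ x in 𝓝 x₀, G (F (ι x)) - ι x = 0 := by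
    filter_upwards [hFe, hf.tendsto.eventually hGe, hgf] with x h1 h2 h3
    simp only [Function.comp_apply, id] at h1 h2 h3
    rw [h1, h2, h3, sub_self]
  have hz := fderiv_eq_zero_of_vanishing hι hd (hGF.sub analyticAt_id)
    fun ℓ => hv.mono fun x hx => (congrArg ℓ hx).trans (map_zero ℓ)
  have h1 : HasFDerivAt ((fun z => G (F z)) - id)
      ((fderiv ℂ G 0).comp (fderiv ℂ F 0) - ContinuousLinearMap.id ℂ (Fin d → ℂ)) 0 := by
    refine HasFDerivAt.sub (HasFDerivAt.comp (g := G) (0 : Fin d → ℂ) ?_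
      hF.2.differentiableAt.hasFDerivAt) (hasFDerivAt_id _)
    rw [hF.1]
    exact hG.2.differentiableAt.hasFDerivAt
  rw [h1.fderiv, sub_eq_zero] at hz
  exact (isAutomorphism_affineGerm_iff F).2 ⟨hF.1, hF.2,
    Function.LeftInverse.injective (g := fderiv ℂ G 0) fun v =>
      congrArg (fun L : (Fin d → ℂ) →L[ℂ] (Fin d → ℂ) => L v) hz⟩

/-- The identity of `X` already suffices: it has an extension that factors through the target of a
minimal embedding. -/
theorem eq_embeddingDimension_of_isGoodEmbedding (hι : S.IsEmbeddingGerm ι)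
    (hgood : S.IsGoodEmbedding ι) : d = S.embeddingDimension := by
  have hne : {d : ℕ | ∃ ι : X → (Fin d → ℂ), S.IsEmbeddingGerm ι}.Nonempty := ⟨d, ι, hι⟩
  have hle : S.embeddingDimension ≤ d := Nat.sInf_le ⟨ι, hι⟩
  obtain ⟨j, hj⟩ : ∃ j : X → (Fin S.embeddingDimension → ℂ), S.IsEmbeddingGerm j :=
    Nat.sInf_mem hne
  obtain ⟨A, hA, hA0, hAe⟩ := hj.exists_factor hι.1 hι.coord_mem
  obtain ⟨B, hB, hB0, hBe⟩ := hι.exists_factor hj.1 hj.coord_mem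
  have hAB : AnalyticAt ℂ (A ∘ B) 0 := AnalyticAt.comp (by rwa [hB0]) hB
  have hext : S.IsExtension ι id (A ∘ B) := by
    refine ⟨(isMorphism_affineGerm_iff _).2 ⟨by simp [hB0, hA0], hAB⟩, ?_⟩
    filter_upwards [hAe, hBe] with x h1 h2
    simp only [Function.comp_apply, id, h2, h1]
  have hinj := ((isAutomorphism_affineGerm_iff _).1 (hgood id S.isAutomorphism_id _ hext)).2.2
  have hd : HasFDerivAt (A ∘ B) ((fderiv ℂ A 0).comp (fderiv ℂ B 0)) 0 := by
    refine HasFDerivAt.comp (0 : Fin d → ℂ) ?_ hB.differentiableAt.hasFDerivAt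
    rw [hB0]
    exact hA.differentiableAt.hasFDerivAt
  rw [hd.fderiv] at hinj
  have hB' : Function.Injective
      (fderiv ℂ B 0 : (Fin d → ℂ) →ₗ[ℂ] (Fin S.embeddingDimension → ℂ)) :=
    fun v w hvw => hinj (congrArg (fderiv ℂ A 0) hvw)
  have := LinearMap.finrank_le_finrank_of_injective hB'
  rw [Module.finrank_fin_fun, Module.finrank_fin_fun] at this
  omega

/-- Under an extension of a contracting automorphism, analytic curves in the image of the
embedding are attracted uniformly by the origin. -/
theorem IsContracting.iterate_curve_tendsto {f : X → X} (hf : S.IsContracting f)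
    (hι : S.IsEmbeddingGerm ι) {F : (Fin d → ℂ) → (Fin d → ℂ)} (hF : S.IsExtension ι f F)
    {γ : ℂ → (Fin d → ℂ)} (hγ : AnalyticAt ℂ γ 0)
    (hγι : ∀ W : Set X, IsOpen W → x₀ ∈ W → ∀ᶠ t in 𝓝 0, γ t ∈ ι '' W) :
    ∃ r > 0, (∀ n : ℕ, AnalyticOnNhd ℂ (fun t => F^[n] (γ t)) (Metric.ball 0 r)) ∧
      ∀ ε > 0, ∀ᶠ n : ℕ in atTop, ∀ t ∈ Metric.ball (0 : ℂ) r, ‖F^[n] (γ t)‖ < ε := by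
  have hιt := hι.tendsto
  obtain ⟨hF, hFe⟩ := hF
  rw [isMorphism_affineGerm_iff] at hF
  obtain ⟨hι0, ⟨U₀, Ω, m, g, hU₀, hx₀, hΩ, he, -, -⟩, -⟩ := hι
  have hnear : ∀ᶠ x in 𝓝 x₀, x ∈ U₀ ∧ F (ι x) = ι (f x) ∧ AnalyticAt ℂ F (ι x) ∧
      ContinuousAt f x := by
    filter_upwards [hU₀.mem_nhds hx₀, hFe, hιt.eventually hF.2.eventually_analyticAt,
      hf.1.1.2.1] with x h1 h2 h3 h4 using ⟨h1, h2, h3, h4⟩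
  obtain ⟨W, hW, hWo, hxW⟩ := mem_nhds_iff.1 hnear
  obtain ⟨U, hU, hxU, hUW, ⟨K, hK, hfK, hKU⟩, hinter⟩ := hf.2 W hWo hxW
  have hmaps : Set.MapsTo f U U := fun x hx => hKU (hfK ⟨x, hx, rfl⟩)
  have hfc : ContinuousOn f U := fun x hx => (hW (hUW hx)).2.2.2.continuousWithinAt
  have hιc : ContinuousOn ι U :=
    (continuousOn_iff_continuous_domRestrict.2 he.continuous).mono fun x hx => (hW (hUW hx)).1
  have hit : ∀ n : ℕ, ∀ x ∈ U, F^[n] (ι x) = ι (f^[n] x) := fun n x hx => by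
    induction n with
    | zero => rfl
    | succ n ih =>
      rw [Function.iterate_succ_apply', Function.iterate_succ_apply', ih,
        (hW (hUW (hmaps.iterate n hx))).2.1]
  obtain ⟨r, hr, hball⟩ := Metric.eventually_nhds_iff_ball.1
    ((hγι U hU hxU).and hγ.eventually_analyticAt)
  refine ⟨r, hr, fun n t ht => ?_, fun ε hε => ?_⟩
  · obtain ⟨⟨x, hx, hxt⟩, hγt⟩ := hball t ht
    induction n with
    | zero => exact hγt
    | succ n ih =>
      simp only [Function.iterate_succ_apply']
      refine AnalyticAt.comp (g := F) ?_ ih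
      rw [← hxt, hit n x hx]
      exact (hW (hUW (hmaps.iterate n hx))).2.2.1
  -- A decreasing sequence of compact sets with intersection `{0}` eventually enters each ball. The
  -- sets are taken in `ℂᵈ`, which is Hausdorff, as `X` carries no separation hypothesis.
  · have hanti : Antitone fun n : ℕ => ι '' (f^[n] '' K) := by
      refine antitone_nat_of_succ_le fun n => Set.image_mono ?_
      rw [Function.iterate_succ, Set.image_comp]
      exact Set.image_mono ((Set.image_mono hKU).trans hfK)
    have hcomp : ∀ n : ℕ, IsCompact (ι '' (f^[n] '' K)) := fun n => by
      refine (hK.image_of_continuousOn ((hfc.iterate hmaps n).mono hKU)).image_of_continuousOn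
        (hιc.mono ?_)
      rintro _ ⟨x, hx, rfl⟩
      exact hmaps.iterate n (hKU hx)
    obtain ⟨N, hN⟩ := exists_subset_nhds_of_isCompact hanti.directed_ge hcomp
      (U := Metric.ball 0 ε) fun z hz => by
        rw [Set.mem_iInter] at hz
        obtain ⟨_, ⟨x, hx, rfl⟩, hxz⟩ := hz 0
        have hxmem : f^[0] x ∈ ⋂ n : ℕ, f^[n] '' U := by
          refine Set.mem_iInter.2 fun n => ?_
          obtain ⟨_, ⟨y, hy, rfl⟩, hyz⟩ := hz n
          have h1 := (hW (hUW (hmaps.iterate n (hKU hy)))).1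
          have h2 := (hW (hUW (hKU hx))).1
          have h3 : (⟨f^[n] y, h1⟩ : U₀) = ⟨f^[0] x, h2⟩ := he.injective (hyz.trans hxz.symm)
          exact ⟨y, hKU hy, congrArg Subtype.val h3⟩
        rw [hinter, Set.mem_singleton_iff] at hxmem
        rw [← hxz, hxmem, hι0]
        exact Metric.ball_mem_nhds 0 hε
    -- The strict inequality spends one iteration moving the point from `U` into `K`.
    filter_upwards [eventually_gt_atTop N] with n hn t ht
    obtain ⟨⟨x, hx, hxt⟩, -⟩ := hball t ht
    obtain ⟨k, rfl⟩ := Nat.exists_eq_add_of_lt hn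
    rw [← mem_ball_zero_iff, ← hxt, hit _ x hx]
    refine hN (hanti (Nat.le_add_right N k) ⟨_, ⟨f x, hfK ⟨x, hx, rfl⟩, ?_⟩, rfl⟩)
    rw [← Function.iterate_succ_apply]

theorem isContracting_affineGerm_of_eigenvalues {F : (Fin d → ℂ) → (Fin d → ℂ)}
    (hF : (affineGerm d).IsAutomorphism F)
    (hev : ∀ μ : ℂ, Module.End.HasEigenvalue
      (fderiv ℂ F 0 : (Fin d → ℂ) →ₗ[ℂ] (Fin d → ℂ)) μ → ‖μ‖ < 1) :
    (affineGerm d).IsContracting F := by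
  obtain ⟨hF0, hFa, -⟩ := (isAutomorphism_affineGerm_iff F).1 hF
  exact ⟨hF, fun W hW hW0 => exists_contracting_nhds hFa.differentiableAt hF0 hev hW hW0⟩

/-- Otherwise every line through `0` is an attracted curve, so `h` vanishes near `0` along every
line and its differential is zero. -/
theorem norm_eigenvalue_lt_one_of_isContracting_affineGerm {F : (Fin d → ℂ) → (Fin d → ℂ)}
    (hF : (affineGerm d).IsContracting F) {μ : ℂ}
    (hμ : Module.End.HasEigenvalue (fderiv ℂ F 0 : (Fin d → ℂ) →ₗ[ℂ] (Fin d → ℂ)) μ) :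
    ‖μ‖ < 1 := by
  by_contra! h1
  obtain ⟨hF0, hFa, -⟩ := (isAutomorphism_affineGerm_iff F).1 hF.1
  obtain ⟨C, h, hh, hh0, hd, hvan⟩ := exists_vanishing_along_attracted_curves hFa hF0 ⟨μ, hμ, h1⟩
  refine hd (ContinuousLinearMap.ext fun v => ?_)
  have hline : HasFDerivAt (fun t : ℂ => t • v) (ContinuousLinearMap.toSpanSingleton ℂ v) 0 :=
    (ContinuousLinearMap.toSpanSingleton ℂ v).hasFDerivAt
  have hla : AnalyticAt ℂ (fun t : ℂ => t • v) 0 :=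
    (ContinuousLinearMap.toSpanSingleton ℂ v).analyticAt 0
  obtain ⟨r, hr, hr1, hr2⟩ := hF.iterate_curve_tendsto (isEmbeddingGerm_id d) (F := F)
    ⟨hF.1.1, EventuallyEq.rfl⟩ hla fun W hW hW0 => by
      rw [Set.image_id]
      exact hla.continuousAt.eventually_mem (by simpa using hW.mem_nhds hW0)
  have hz := hvan _ (zero_smul ℂ v) r hr hr1 hr2
  have hcomp : HasFDerivAt (fun t : ℂ => h (t • v))
      ((fderiv ℂ h 0).comp (ContinuousLinearMap.toSpanSingleton ℂ v)) 0 := by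
    refine HasFDerivAt.comp (g := h) (0 : ℂ) ?_ hline
    rw [zero_smul]
    exact hh.differentiableAt.hasFDerivAt
  have := hcomp.unique ((hasFDerivAt_const (0 : C) (0 : ℂ)).congr_of_eventuallyEq hz)
  simpa using congrArg (fun L : ℂ →L[ℂ] C => L 1) this

theorem isGoodContractingEmbedding_of_eq_embeddingDimension (hι : S.IsEmbeddingGerm ι)
    (hd : d = S.embeddingDimension) : S.IsGoodContractingEmbedding ι := by
  have hgood := isGoodEmbedding_of_eq_embeddingDimension hι hd
  refine ⟨hgood, fun f hf F hF => ?_⟩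
  have hFaut := hgood f hf.1 F hF
  refine isContracting_affineGerm_of_eigenvalues hFaut fun μ hμ => ?_
  by_contra! h1
  obtain ⟨hF0, hFa, -⟩ := (isAutomorphism_affineGerm_iff F).1 hFaut
  obtain ⟨C, h, hh, hh0, hdh, hvan⟩ := exists_vanishing_along_attracted_curves hFa hF0 ⟨μ, hμ, h1⟩
  -- By minimality some scalar component of `h` is not identically zero on the germ of `X`; it
  -- serves as the function `H` of the curve selection lemma.
  obtain ⟨ℓ, hℓ⟩ : ∃ ℓ : C →L[ℂ] ℂ, ¬ ∀ᶠ x in 𝓝 x₀, ℓ (h (ι x)) = 0 := by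
    by_contra! hall
    exact hdh (fderiv_eq_zero_of_vanishing hι hd hh hall)
  have hιt := hι.tendsto
  obtain ⟨hι0, ⟨U, Ω, m, g, hU, hx₀, hΩ, he, hg, himg⟩, -⟩ := id hι
  have hmem : ∀ z, z ∈ ι '' U ↔ z ∈ Ω ∧ g z = 0 := fun z => by
    rw [himg]
    rfl
  have h0Ω : (0 : Fin d → ℂ) ∈ Ω := ((hmem 0).1 ⟨x₀, hx₀, hι0⟩).1
  have hfreq : ∃ᶠ z in 𝓝 (0 : Fin d → ℂ), (∀ i, g z i = 0) ∧ ℓ (h z) ≠ 0 := by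
    refine hιt.frequently ((not_eventually.1 hℓ).and_eventually (hU.mem_nhds hx₀) |>.mono ?_)
    rintro x ⟨hx, hxU⟩
    exact ⟨fun i => congrFun ((hmem _).1 ⟨x, hxU, rfl⟩).2 i, hx⟩
  obtain ⟨γ, hγ, hγ0, hgγ, hHγ⟩ := curve_selection d (g := fun i z => g z i)
    (H := fun z => ℓ (h z)) (analyticAt_pi_iff.1 (hg 0 h0Ω)) ((ℓ.analyticAt _).comp hh) hfreq
  -- The equations put `γ t` in `ι '' U`. Since `ι` is a homeomorphism from `U` onto its image,
  -- smallness of `γ t` puts its preimage in `W`.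
  obtain ⟨r, hr, hr1, hr2⟩ := hf.iterate_curve_tendsto hι hF hγ fun W hW hxW => by
    obtain ⟨Ω₁, hΩ₁, hm, hΩ₁W⟩ :=
      IsClosedImmersionGerm.exists_open_of_mem_nhds hx₀ he (hW.mem_nhds hxW)
    rw [hι0] at hm
    have hγt : Tendsto γ (𝓝 0) (𝓝 0) := by
      have := hγ.continuousAt.tendsto
      rwa [hγ0] at this
    filter_upwards [hgγ, hγt.eventually (hΩ.mem_nhds h0Ω), hγt.eventually (hΩ₁.mem_nhds hm)]
      with t h1 h2 h3
    obtain ⟨x, hxU, hxt⟩ := (hmem (γ t)).2 ⟨h2, funext h1⟩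
    exact ⟨x, hΩ₁W x hxU (hxt ▸ h3), hxt⟩
  refine hHγ ?_
  filter_upwards [hvan γ hγ0 r hr hr1 hr2] with t ht
  rw [ht, map_zero]

end Singularity

end

theorem mainTheorem2 {X : Type*} [TopologicalSpace X] {x₀ : X} (S : Singularity X x₀)
    {d : ℕ} (ι : X → (Fin d → ℂ)) (hι : S.IsEmbeddingGerm ι) :
    [d = S.embeddingDimension, S.IsGoodEmbedding ι, S.IsGoodContractingEmbedding ι].TFAE ∧
    ∀ F : (Fin d → ℂ) → (Fin d → ℂ), (affineGerm d).IsAutomorphism F →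
      ((affineGerm d).IsContracting F ↔
        ∀ μ : ℂ, Module.End.HasEigenvalue
          (fderiv ℂ F 0 : (Fin d → ℂ) →ₗ[ℂ] (Fin d → ℂ)) μ → ‖μ‖ < 1) := by
  refine ⟨?_, fun F hF => ⟨fun h μ hμ =>
    Singularity.norm_eigenvalue_lt_one_of_isContracting_affineGerm h hμ,
    Singularity.isContracting_affineGerm_of_eigenvalues hF⟩⟩
  tfae_have 1 → 3 := Singularity.isGoodContractingEmbedding_of_eq_embeddingDimension hι
  tfae_have 3 → 2 := fun h => h.1
  tfae_have 2 → 1 := Singularity.eq_embeddingDimension_of_isGoodEmbedding hι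
  tfae_finish
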